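/- **Setting.** Let $a\le b$, let $\Theta=\mathbb R^2\times[a,b]$ and $\theta_0=(\alpha_0,\beta_0,\zeta_0)\in\Theta$ with $\alpha_0\ne\beta_0$. Let $X_i=(Y_i,Z_i)$, $i\ge 1$, be i.i.d. random vectors on a probability space $(\Omega,\mathcal A,\mathbf P)$ with common law $\mathbb P$ satisfying $$Y=\alpha_0\mathbf 1_{Z\le\zeta_0}+\beta_0\mathbf 1_{Z>\zeta_0}+\epsilon ,$$ where $\epsilon$ is a random variable without atoms, independent of $Z$, with $\mathbb P(\epsilon)=0$, positive variance and $\mathbb P(|\epsilon|^3)<\infty$; $Z$ has a density $f$ and distribution function $F$; $f$ is bounded and strictly positive on $[a,b]$; $\inf_{|z-\zeta_0|\le\eta_0}f(z)>0$ for some $\eta_0>0$; and $\mathbb P(Z<a)\wedge\mathbb P(Z>b)>0$. (Here $\mu(\cdot)$ denotes expectation under $\mu$.) For $\theta=(\alpha,\beta,\zeta)$ put $m_\theta(y,z)=-(y-\alpha\mathbf 1_{z\le\zeta}-\beta\mathbf 1_{z>\zeta})^2$. For a bivariate law $Q$, a maximizer of $Q(m_\theta)$ over $\Theta$ is a $\theta\in\Theta$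 at which the larger of $Q(m_\theta)$ and its left limit in $\zeta$ (taken within $[a,b]$) equals $\sup_{\Theta}Q(m_\theta)$; a smallest argmax is a maximizer with the smallest $\zeta$. The least squares estimator of a sample is a measurable function of the sample that is a smallest argmax for its empirical measure. Let $\hat\theta_n=(\hat\alpha_n,\hat\beta_n,\hat\zeta_n)$ be the least squares estimator of $X_1,\dots,X_n$. **Smoothed bootstrap.** Let $\hat f_n$ be (random) probability densities with distribution functions $\hat F_n$, and let $\mathbb P_n^\epsilon$ be the empirical measure of the centered residuals $\hat\epsilon_{n,j}-\frac1n\sum_{i=1}^n\hat\epsilon_{n,i}$, where $\hat\epsilon_{n,j}=Y_j-\hat\alpha_n\mathbf 1_{Z_j\le\hat\zeta_n}-\hat\beta_n\mathbf 1_{Z_j>\hat\zeta_n}$, $1\le j\le n$. Let $\mathbb Q_n$ be the (random) law of $(Y^*,Z^*)$, where $Z^*\sim\hat F_n$ and $\epsilon^*\sim\mathbb P_n^\epsilon$ are independent and $Y^*=\hat\alpha_n\mathbf 1_{Z^*\le\hat\zeta_n}+\hat\beta_n\mathbf 1_{Z^*>\hat\zeta_n}+\epsilon^*$. Conditionally on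 $\mathfrak X=\sigma(X_1,X_2,\dots)$, let the bootstrap sample $X^*_{n,1},\dots,X^*_{n,n}$ be i.i.d. with law $\mathbb Q_n$, and let $\theta_n^*=(\alpha_n^*,\beta_n^*,\zeta_n^*)$ be its least squares estimator. **Claim.** Suppose that $\sup_{z\in\mathbb R}|\hat F_n(z)-F(z)|\to0$ almost surely and that $\sup_{z\in[c,d]}|\hat f_n(z)-f(z)|\to0$ almost surely for some compact interval $[c,d]$ with $\zeta_0\in(c,d)$. Then, with probability one, the sequence ($n\ge1$) of conditional distributions given $\mathfrak X$ of $$\bigl(\sqrt n(\alpha_n^*-\hat\alpha_n),\ \sqrt n(\beta_n^*-\hat\beta_n),\ n(\zeta_n^*-\hat\zeta_n)\bigr)$$ is tight. Moreover, with probability one, the following conditions (I)–(V) hold with $m_n=n$, $\theta_n=(\alpha_n,\beta_n,\zeta_n)=\hat\theta_n$ and $\tilde\epsilon_n(y,z)=y-\alpha_n\mathbf 1_{z\le\zeta_n}-\beta_n\mathbf 1_{z>\zeta_n}$. Write $\|\mathbb Q_n-\mathbb P\|_{\mathcal C}=\sup_{g\in\mathcal C}|\mathbb Q_n(g)-\mathbb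 P(g)|$, and let $I$ range over all intervals of $\mathbb R$. - (I) $\|\mathbb Q_n-\mathbb P\|_{\mathcal F}\to0$ for $\mathcal F=\{\mathbf 1_I(z)\}$. - (II) For every $M>0$, $\|\mathbb Q_n-\mathbb P\|_{\mathcal G}\to0$ for $\mathcal G=\{y\mathbf 1_I(z)\}\cup\{|y+t|\mathbf 1_I(z):|t|\le M\}$. - (III) $\|\mathbb Q_n-\mathbb P\|_{\mathcal H}\to0$ for $\mathcal H=\{y^2\mathbf 1_I(z)\}$. - (IV) $\theta_n\to\theta_0$. - (V) There are $\eta,\rho,L>0$ such that for every $\delta\in(0,\eta)$ there is $N$ such that for all $n\ge N$ $$\inf_{\frac1{\sqrt{m_n}}\le|\zeta-\zeta_n|<\delta^2}\frac{\mathbb Q_n(\zeta\wedge\zeta_n<Z\le\zeta\vee\zeta_n)}{|\zeta-\zeta_n|}>\rho,$$ $$\sup_{|\zeta-\zeta_n|<\delta^2}\bigl|\mathbb Q_n(\tilde\epsilon_n\mathbf 1_{\zeta\wedge\zeta_n<Z\le\zeta\vee\zeta_n})\bigr|\le\frac{L\delta}{\sqrt{m_n}},$$ $$\sup_{|\zeta-\zeta_n|<\delta^2}\bigl\{|\mathbb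 Q_n(\tilde\epsilon_n\mathbf 1_{Z\le\zeta\wedge\zeta_n})|+|\mathbb Q_n(\tilde\epsilon_n\mathbf 1_{Z>\zeta\vee\zeta_n})|\bigr\}\le\frac L{\sqrt{m_n}}.$$ -/

import Mathlib

open MeasureTheory ProbabilityTheory Set Filter Topology

noncomputable section

namespace ChangePoint

/-- A parameter `(α, β, ζ)`. -/
abbrev Param : Type := ℝ × ℝ × ℝ

/-- An observation `(y, z)`: response `y`, covariate `z`. -/
abbrev Obs : Type := ℝ × ℝ

/-- The regression function `α 1{z ≤ ζ} + β 1{z > ζ}`. -/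
def regFn (θ : Param) (z : ℝ) : ℝ := if z ≤ θ.2.2 then θ.1 else θ.2.1

/-- The residual `y - α 1{z ≤ ζ} - β 1{z > ζ}`. -/
def resid (θ : Param) (x : Obs) : ℝ := x.1 - regFn θ x.2

/-- The least squares criterion function `m_θ(y, z) = -(y - α 1{z ≤ ζ} - β 1{z > ζ})²`. -/
def mFn (θ : Param) (x : Obs) : ℝ := -(resid θ x) ^ 2

/-- The criterion `θ ↦ Q(m_θ)` of a bivariate distribution `Q`. -/
def crit (Q : Measure Obs) (θ : Param) : ℝ := ∫ x, mFn θ x ∂Q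

/-- The parameter space `Θ = ℝ² × [a, b]`. -/
def Theta (a b : ℝ) : Set Param := {θ | θ.2.2 ∈ Icc a b}

/-- The left limit `Q(m_{α, β, ζ-})` of the criterion, regarded as a function of `ζ ∈ [a, b]`;
at the left endpoint `a` there is nothing to the left and it is the value itself. -/
def critLeft (a : ℝ) (Q : Measure Obs) (θ : Param) : ℝ :=
  if a < θ.2.2 then Function.leftLim (fun ζ => crit Q (θ.1, θ.2.1, ζ)) θ.2.2 else crit Q θ

/-- `θ ∈ Θ` is a maximizer: the larger of the value and the left limit (in `ζ`) of the criterion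
at `θ` is the supremum of the criterion over `Θ`. -/
def IsMaximizer (a b : ℝ) (Q : Measure Obs) (θ : Param) : Prop :=
  θ ∈ Theta a b ∧ IsLUB (crit Q '' Theta a b) (max (crit Q θ) (critLeft a Q θ))

/-- `θ` is a smallest argmax: a maximizer with the smallest possible `ζ`. -/
def IsSargmax (a b : ℝ) (Q : Measure Obs) (θ : Param) : Prop :=
  IsMaximizer a b Q θ ∧ ∀ θ', IsMaximizer a b Q θ' → θ.2.2 ≤ θ'.2.2

/-- The empirical measure of a finite sample. -/
def empMeasure {E : Type*} [MeasurableSpace E] {n : ℕ} (x : Fin n → E) : Measure E :=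
  (n : ENNReal)⁻¹ • ∑ j, Measure.dirac (x j)

/-- `T` is a least squares estimator: a measurable function of the sample which, for every sample
of every size `n ≥ 1`, is a smallest argmax over `Θ` of the empirical criterion. (It is unique as
soon as the sample has a covariate to the left of `a` and one to the right of `b`.) -/
structure IsLSE (a b : ℝ) (T : (n : ℕ) → (Fin n → Obs) → Param) : Prop where
  measurable : ∀ n, 1 ≤ n → Measurable (T n)
  sargmax : ∀ n, 1 ≤ n → ∀ x : Fin n → Obs, IsSargmax a b (empMeasure x) (T n x)

/-- The bivariate law `P` of `(Y, Z)` satisfies the change-point model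
`Y = α₀ 1{Z ≤ ζ₀} + β₀ 1{Z > ζ₀} + ε` with parameter `θ₀ = (α₀, β₀, ζ₀)`, where `f` is the
Lebesgue density of `Z`. Here `ε` is `resid θ₀` and `Z` is the second coordinate. -/
structure Model (a b : ℝ) (f : ℝ → ℝ) (θ₀ : Param) (P : Measure Obs) : Prop where
  isProb : IsProbabilityMeasure P
  alpha_ne_beta : θ₀.1 ≠ θ₀.2.1
  zeta_mem : θ₀.2.2 ∈ Icc a b
  indep : IndepFun (resid θ₀) Prod.snd P
  eps_noAtoms : ∀ t : ℝ, P {x | resid θ₀ x = t} = 0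
  eps_moment : MemLp (resid θ₀) 3 P
  eps_mean : ∫ x, resid θ₀ x ∂P = 0
  eps_var : 0 < ∫ x, resid θ₀ x ^ 2 ∂P
  f_measurable : Measurable f
  f_nonneg : ∀ z, 0 ≤ f z
  law_Z : P.map Prod.snd = volume.withDensity (fun z => ENNReal.ofReal (f z))
  f_bounded : ∃ C, ∀ z ∈ Icc a b, f z ≤ C
  f_pos : ∀ z ∈ Icc a b, 0 < f z
  f_lower : ∃ η > 0, ∃ κ > 0, ∀ z, |z - θ₀.2.2| ≤ η → κ < f z
  mass_left : 0 < P {x | x.2 < a}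
  mass_right : 0 < P {x | b < x.2}

/-! ### The smoothed bootstrap -/

/-- `g` is a probability density on the line. -/
def IsDensity (g : ℝ → ℝ) : Prop :=
  Measurable g ∧ (∀ z, 0 ≤ g z) ∧ ∫⁻ z, ENNReal.ofReal (g z) = 1

/-- The measure on the line with density `g`. -/
def densMeasure (g : ℝ → ℝ) : Measure ℝ := volume.withDensity (fun z => ENNReal.ofReal (g z))

/-- The distribution function of the measure with density `g`. -/
def distFn (g : ℝ → ℝ) (z : ℝ) : ℝ := (densMeasure g).real (Iic z)

/-- The centered residuals of the sample `x` with respect to the fitted parameter `θ`. -/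
def centeredResid {n : ℕ} (θ : Param) (x : Fin n → Obs) (j : Fin n) : ℝ :=
  resid θ (x j) - (∑ i, resid θ (x i)) / n

/-- The law of one bootstrap observation: `Z*` has density `g`, `ε*` is independent of `Z*` and
drawn from the empirical measure of the centered residuals of the sample `x`, and
`Y* = α 1{Z* ≤ ζ} + β 1{Z* > ζ} + ε*` with the fitted parameter `θ = (α, β, ζ)`. -/
def bootLaw {n : ℕ} (θ : Param) (x : Fin n → Obs) (g : ℝ → ℝ) : Measure Obs :=
  ((densMeasure g).prod (empMeasure (centeredResid θ x))).map
    (fun p => (regFn θ p.1 + p.2, p.1))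

/-! ### Classes of functions and the conditions (I)-(V) -/

/-- The functions `(y, z) ↦ 1_I(z)`, `I` an interval. -/
def classF : Set (Obs → ℝ) :=
  {φ | ∃ I : Set ℝ, I.OrdConnected ∧ φ = fun x => I.indicator 1 x.2}

/-- The functions `y φ` and `|y + t| φ`, with `φ` the indicator of an interval in `z` and
`|t| ≤ M`. -/
def classG (M : ℝ) : Set (Obs → ℝ) :=
  {ψ | ∃ φ ∈ classF, ψ = fun x => x.1 * φ x} ∪
    {ψ | ∃ φ ∈ classF, ∃ t : ℝ, |t| ≤ M ∧ ψ = fun x => |x.1 + t| * φ x}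

/-- The functions `y² φ`, with `φ` the indicator of an interval in `z`. -/
def classH : Set (Obs → ℝ) := {ψ | ∃ φ ∈ classF, ψ = fun x => x.1 ^ 2 * φ x}

/-- `sup {|Q_n(φ) - P(φ)| : φ ∈ 𝓒} → 0`, where all these integrals converge absolutely (under
`Q_n` for `n ≥ 1`). -/
def UnifConv (Q : ℕ → Measure Obs) (P : Measure Obs) (𝓒 : Set (Obs → ℝ)) : Prop :=
  (∀ φ ∈ 𝓒, Integrable φ P ∧ ∀ n, 1 ≤ n → Integrable φ (Q n)) ∧
  TendstoUniformlyOn (fun n φ => ∫ x, φ x ∂(Q n)) (fun φ => ∫ x, φ x ∂P) atTop 𝓒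

/-- The event (as a set of observations) that `ζ ∧ ζ' < Z ≤ ζ ∨ ζ'`. -/
def between (ζ ζ' : ℝ) : Set Obs := {x | min ζ ζ' < x.2 ∧ x.2 ≤ max ζ ζ'}

/-- Condition (V). That an infimum exceeds `ρ` is expressed by a lower bound `ρ' > ρ`. -/
def CondV (Q : ℕ → Measure Obs) (m : ℕ → ℕ) (θ : ℕ → Param) : Prop :=
  ∃ η > 0, ∃ ρ > 0, ∃ L > 0, ∀ δ : ℝ, 0 < δ → δ < η → ∃ N : ℕ, ∀ n ≥ N,
    (∃ ρ' > ρ, ∀ ζ : ℝ, 1 / √(m n : ℝ) ≤ |ζ - (θ n).2.2| → |ζ - (θ n).2.2| < δ ^ 2 →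
      ρ' ≤ 1 / |ζ - (θ n).2.2| * (Q n).real (between ζ (θ n).2.2)) ∧
    (∀ ζ : ℝ, |ζ - (θ n).2.2| < δ ^ 2 →
      |∫ x in between ζ (θ n).2.2, resid (θ n) x ∂(Q n)| ≤ L * δ / √(m n : ℝ)) ∧
    (∀ ζ : ℝ, |ζ - (θ n).2.2| < δ ^ 2 →
      |∫ x in {x : Obs | x.2 ≤ min ζ (θ n).2.2}, resid (θ n) x ∂(Q n)|
        + |∫ x in {x : Obs | max ζ (θ n).2.2 < x.2}, resid (θ n) x ∂(Q n)|
        ≤ L / √(m n : ℝ))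

/-- Conditions (I)-(V) for the sampling laws `Q_n`, the sample sizes `m_n`, the centering
parameters `θ_n`, and the limits `P`, `θ₀`. -/
structure CondsIToV (Q : ℕ → Measure Obs) (m : ℕ → ℕ) (θ : ℕ → Param)
    (P : Measure Obs) (θ₀ : Param) : Prop where
  condI : UnifConv Q P classF
  condII : ∀ M > 0, UnifConv Q P (classG M)
  condIII : UnifConv Q P classH
  condIV : Tendsto θ atTop (𝓝 θ₀)
  condV : CondV Q m θ

/-- `(√n (α* - α̂), √n (β* - β̂), n (ζ* - ζ̂))`. -/
def root (n : ℕ) (θs θ : Param) : Param :=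
  (√(n : ℝ) * (θs.1 - θ.1), √(n : ℝ) * (θs.2.1 - θ.2.1), (n : ℝ) * (θs.2.2 - θ.2.2))

/-- The first `n` observations of the sequence `X`, at the outcome `ω`. -/
def sample {Ω : Type*} (X : ℕ → Ω → Obs) (n : ℕ) (ω : Ω) : Fin n → Obs := fun j => X j ω

end ChangePoint

end

open ChangePoint

noncomputable section

namespace ChangePoint

/-! The true law and the bootstrap law have the same shape: a covariate law times a centered error
law, pushed forward by `(z, e) ↦ (regFn θ z + e, z)` (`modelLaw`). So everything about `bootLaw`
depends on three inputs: the fitted parameter, the covariate density and the error law. Almost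
surely the fitted parameter tends to `θ₀` (`RegularData.tendsto_lse`), the variance and the shifted
absolute moments of the centered residuals tend to those of the true error
(`RegularData.momentConv`), and the densities converge near `ζ₀` by hypothesis.

Conditions (I)-(III) hold because the integral of `h(y) 1_I(z)` is a combination of two interval
masses with two shifted error means (`unifConv_modelLaw`). In (V) only the lower bound on masses has
content, since the residual integrates to zero over every measurable set of covariates
(`setIntegral_resid_modelLaw`).

Tightness comes from a tail bound at each sample size, valid for any sampling law of this shape
(`measure_norm_root_gt_le`). Comparing the sum of squares at the estimator with that at the
parameter of the sampling law gives a quadratic inequality in the two level errors and in the number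
`N₂` of covariates between the two change points. Suppose that error sums over half-lines are
`O(√n)` and that error sums over windows adjacent to the change point are at most a small slope
times `k₀` plus the number of points. Then `N₂` and `√n` times the level errors are bounded
(`bounds_of_basic_inequality`, `rescaled_error_bound`). The density is bounded below, so a window of
length `M / n` holds more points than this bound with high probability, which confines the change
point to scale `1 / n`.

The error sums are controlled conditionally on the covariates: the relevant index sets then form a
deterministic chain, a permutation turns the chain into initial segments, and the Hájek–Rényi
inequality applies. Consistency uses the same quadratic inequality with error sums of size `κ n`,
supplied by the strong law and a Glivenko–Cantelli argument. -/

/-! ### Maximal inequalities for sums over a chain of index sets -/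

/-- Sum of the first `k` coordinates of `x`. -/
def partialSum {n : ℕ} (x : Fin n → ℝ) (k : ℕ) : ℝ := ∑ j : Fin n, if (j : ℕ) < k then x j else 0

lemma partialSum_zero {n : ℕ} (x : Fin n → ℝ) : partialSum x 0 = 0 := by
  simp [partialSum]

lemma partialSum_succ {n : ℕ} (x : Fin (n + 1) → ℝ) (k : ℕ) :
    partialSum x (k + 1) = x 0 + partialSum (Fin.tail x) k := by
  simp [partialSum, Fin.sum_univ_succ, Fin.tail]

lemma measurable_partialSum {n : ℕ} (k : ℕ) : Measurable fun x : Fin n → ℝ => partialSum x k := by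
  unfold partialSum
  refine Finset.measurable_sum _ fun j _ => ?_
  split_ifs
  · exact measurable_pi_apply j
  · exact measurable_const

/-- **Hájek–Rényi inequality** for i.i.d. centered square integrable summands. -/
theorem measure_exists_weight_mul_sq_ge (μ : Measure ℝ) [IsProbabilityMeasure μ]
    (hμ : MemLp id 2 μ) (h0 : ∫ x, x ∂μ = 0) (n : ℕ) :
    ∀ (w : ℕ → ℝ), (∀ k, 0 ≤ w k) → (∀ k, w (k + 1) ≤ w k) → ∀ s : ℝ,
    (Measure.pi fun _ : Fin n => μ) {x | ∃ k ≤ n, 1 ≤ w k * (s + partialSum x k) ^ 2} ≤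
      ENNReal.ofReal (w 0 * s ^ 2 + (∫ x, x ^ 2 ∂μ) * ∑ k ∈ Finset.range n, w (k + 1)) := by
  have hi1 : Integrable (fun x : ℝ => x) μ := hμ.integrable (by norm_num)
  have hi2 : Integrable (fun x : ℝ => x ^ 2) μ := hμ.integrable_sq
  have hV : 0 ≤ ∫ x, x ^ 2 ∂μ := integral_nonneg fun x => sq_nonneg x
  induction n with
  | zero =>
    intro w hw hw' s
    by_cases h : 1 ≤ w 0 * s ^ 2
    · refine le_trans prob_le_one ?_
      rw [ENNReal.one_le_ofReal]
      simpa using h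
    · have : {x : Fin 0 → ℝ | ∃ k ≤ 0, 1 ≤ w k * (s + partialSum x k) ^ 2} = ∅ := by
        ext x
        simp [partialSum_zero]
        simpa using h
      rw [this]; simp
  | succ n ih =>
    intro w hw hw' s
    -- If the threshold is already crossed at `k = 0`, the right side is at least 1. Otherwise
    -- condition on the first coordinate `x`: what remains is the same event for `n` summands,
    -- started at `s + x` with shifted weights. This is why the induction runs over all `w` and `s`.
    by_cases h : 1 ≤ w 0 * s ^ 2
    · refine le_trans prob_le_one ?_
      rw [ENNReal.one_le_ofReal]
      have : 0 ≤ (∫ x, x ^ 2 ∂μ) * ∑ k ∈ Finset.range (n + 1), w (k + 1) :=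
        mul_nonneg hV (Finset.sum_nonneg fun k _ => hw _)
      linarith
    · have hmp := measurePreserving_piFinSuccAbove (fun _ : Fin (n + 1) => μ) 0
      set E : Set (ℝ × (Fin n → ℝ)) :=
        {p | ∃ k ≤ n, 1 ≤ w (k + 1) * ((s + p.1) + partialSum p.2 k) ^ 2} with hE
      have hEm : MeasurableSet E := by
        have : E = ⋃ k ∈ Finset.range (n + 1),
            {p | 1 ≤ w (k + 1) * ((s + p.1) + partialSum p.2 k) ^ 2} := by
          ext p; simp [hE]
        rw [this]
        refine Finset.measurableSet_biUnion _ fun k _ => measurableSet_le measurable_const ?_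
        have : Measurable fun p : ℝ × (Fin n → ℝ) => partialSum p.2 k :=
          (measurable_partialSum k).comp measurable_snd
        exact (((measurable_const.add measurable_fst).add this).pow_const 2).const_mul _
      have hpre : {x : Fin (n + 1) → ℝ | ∃ k ≤ n + 1, 1 ≤ w k * (s + partialSum x k) ^ 2} =
          (MeasurableEquiv.piFinSuccAbove (fun _ : Fin (n + 1) => ℝ) 0) ⁻¹' E := by
        ext x
        simp only [mem_ofPred_eq, hE, mem_preimage]
        constructor
        · rintro ⟨k, hk, hk'⟩
          cases k with
          | zero => simp [partialSum_zero] at hk'; exact absurd hk' h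
          | succ k =>
            refine ⟨k, by omega, ?_⟩
            rw [partialSum_succ] at hk'
            simpa [MeasurableEquiv.piFinSuccAbove, Fin.insertNthEquiv, Fin.removeNth, add_assoc]
              using hk'
        · rintro ⟨k, hk, hk'⟩
          refine ⟨k + 1, by omega, ?_⟩
          rw [partialSum_succ]
          simpa [MeasurableEquiv.piFinSuccAbove, Fin.insertNthEquiv, Fin.removeNth, add_assoc]
              using hk'
      rw [hpre, hmp.measure_preimage hEm.nullMeasurableSet, Measure.prod_apply hEm]
      have hstep : ∀ x : ℝ, (Measure.pi fun _ : Fin n => μ) (Prod.mk x ⁻¹' E) ≤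
          ENNReal.ofReal (w 1 * (s + x) ^ 2 +
            (∫ x, x ^ 2 ∂μ) * ∑ k ∈ Finset.range n, w (k + 1 + 1)) := fun x =>
        ih (fun k => w (k + 1)) (fun k => hw _) (fun k => hw' _) (s + x)
      refine (lintegral_mono hstep).trans ?_
      have hexp : (fun x : ℝ => w 1 * (s + x) ^ 2 +
            (∫ x, x ^ 2 ∂μ) * ∑ k ∈ Finset.range n, w (k + 1 + 1)) =
          fun x => (w 1 * x ^ 2 + (2 * w 1 * s) * x) + (w 1 * s ^ 2 +
            (∫ x, x ^ 2 ∂μ) * ∑ k ∈ Finset.range n, w (k + 1 + 1)) := by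
        funext x; ring
      have hint1 : Integrable (fun x : ℝ => w 1 * x ^ 2 + (2 * w 1 * s) * x) μ :=
        (hi2.const_mul _).add (hi1.const_mul _)
      rw [← ofReal_integral_eq_lintegral_ofReal]
      · refine ENNReal.ofReal_le_ofReal ?_
        rw [hexp, integral_add hint1 (integrable_const _),
          integral_add (hi2.const_mul _) (hi1.const_mul _), integral_const_mul, integral_const_mul,
          h0, integral_const, Finset.sum_range_succ' (fun k => w (k + 1))]
        simp only [probReal_univ, smul_eq_mul, one_mul, zero_add]
        -- The cross term vanished with the mean; `w 1 ≤ w 0` absorbs the remaining `w 1 * s ^ 2`.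
        have := mul_le_mul_of_nonneg_right (hw' 0) (sq_nonneg s)
        nlinarith
      · rw [hexp]
        exact hint1.add (integrable_const _)
      · refine Eventually.of_forall fun x => ?_
        exact add_nonneg (mul_nonneg (hw _) (sq_nonneg _))
          (mul_nonneg hV (Finset.sum_nonneg fun k _ => hw _))

/-- A chain of finite sets of indices becomes a family of initial segments after a permutation. -/
lemma exists_perm_image_initial {n : ℕ} (C : Set (Finset (Fin n)))
    (hC : IsChain (· ⊆ ·) C) :
    ∃ σ : Equiv.Perm (Fin n), ∀ s ∈ C, ∀ j, σ j ∈ s ↔ (j : ℕ) < s.card := by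
  classical
  -- The key of `j` is the size of the smallest member containing `j`. The default `n + 1` exceeds
  -- every cardinality, so indices in no member are sorted last.
  set key : Fin n → ℕ := fun j => sInf {m | m = n + 1 ∨ ∃ s ∈ C, j ∈ s ∧ s.card = m} with hkey
  have hmem : ∀ s ∈ C, ∀ j, j ∈ s ↔ key j ≤ s.card := by
    intro s hs j
    constructor
    · intro hj
      exact Nat.sInf_le (Or.inr ⟨s, hs, hj, rfl⟩)
    · intro hle
      have hne : {m | m = n + 1 ∨ ∃ s ∈ C, j ∈ s ∧ s.card = m}.Nonempty := ⟨n + 1, Or.inl rfl⟩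
      rcases Nat.sInf_mem hne with h | ⟨t, ht, hjt, hcard⟩
      · have : s.card ≤ n := by simpa using Finset.card_le_univ s
        have h' : key j = n + 1 := h
        omega
      · have h' : t.card = key j := hcard
        rcases hC.total hs ht with hst | hts
        · have := Finset.eq_of_subset_of_card_le hst (by omega)
          rwa [this]
        · exact hts hjt
  refine ⟨Tuple.sort key, fun s hs j => ?_⟩
  have hmono : Monotone (key ∘ Tuple.sort key) := Tuple.monotone_sort key
  set t : Finset (Fin n) := s.map (Tuple.sort key).symm.toEmbedding with ht
  have hcard : t.card = s.card := Finset.card_map _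
  have hjt : ∀ j, j ∈ t ↔ Tuple.sort key j ∈ s := by
    intro j
    simp [ht]
  have hlow : ∀ i j, i ≤ j → j ∈ t → i ∈ t := by
    intro i j hij hj
    rw [hjt, hmem s hs] at hj ⊢
    exact (hmono hij).trans hj
  rw [← hjt, ← hcard]
  constructor
  · intro hj
    have : Finset.Iic j ⊆ t := fun i hi => hlow i j (Finset.mem_Iic.1 hi) hj
    have := Finset.card_le_card this
    rw [Fin.card_Iic] at this
    omega
  · intro hj
    by_contra hn
    have : t ⊆ Finset.Iio j := by
      intro i hi
      rw [Finset.mem_Iio]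
      by_contra hle
      exact hn (hlow j i (not_lt.1 hle) hi)
    have := Finset.card_le_card this
    rw [Fin.card_Iio] at this
    omega

/-- Maximal inequality over a chain of index sets. -/
theorem measure_exists_chain_weight_mul_sq_ge (μ : Measure ℝ) [IsProbabilityMeasure μ]
    (hμ : MemLp id 2 μ) (h0 : ∫ x, x ∂μ = 0) {n : ℕ} (w : ℕ → ℝ) (hw : ∀ k, 0 ≤ w k)
    (hw' : ∀ k, w (k + 1) ≤ w k) (C : Set (Finset (Fin n))) (hC : IsChain (· ⊆ ·) C) :
    (Measure.pi fun _ : Fin n => μ) {x | ∃ s ∈ C, 1 ≤ w s.card * (∑ j ∈ s, x j) ^ 2} ≤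
      ENNReal.ofReal ((∫ x, x ^ 2 ∂μ) * ∑ k ∈ Finset.range n, w (k + 1)) := by
  obtain ⟨σ, hσ⟩ := exists_perm_image_initial C hC
  have hmp := measurePreserving_piCongrLeft (fun _ : Fin n => μ) σ.symm
  have key := measure_exists_weight_mul_sq_ge μ hμ h0 n w hw hw' 0
  simp only [ne_eq, OfNat.ofNat_ne_zero, not_false_eq_true, zero_pow, mul_zero, zero_add] at key
  refine le_trans ?_ key
  have hEm : MeasurableSet {x : Fin n → ℝ | ∃ k ≤ n, 1 ≤ w k * (partialSum x k) ^ 2} := by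
    have : {x : Fin n → ℝ | ∃ k ≤ n, 1 ≤ w k * (partialSum x k) ^ 2} =
        ⋃ k ∈ Finset.range (n + 1), {p | 1 ≤ w k * (partialSum p k) ^ 2} := by
      ext p; simp
    rw [this]
    refine Finset.measurableSet_biUnion _ fun k _ => measurableSet_le measurable_const ?_
    exact ((measurable_partialSum k).pow_const 2).const_mul _
  rw [← hmp.measure_preimage hEm.nullMeasurableSet]
  refine measure_mono ?_
  rintro x ⟨s, hs, h⟩
  refine ⟨s.card, by simpa using Finset.card_le_univ s, ?_⟩
  convert h using 3
  have hval : ∀ i, MeasurableEquiv.piCongrLeft (fun _ : Fin n => ℝ) σ.symm x i = x (σ i) := by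
    intro i
    have := MeasurableEquiv.piCongrLeft_apply_apply (β := fun _ : Fin n => ℝ) (e := σ.symm) x (σ i)
    simpa using this
  simp_rw [partialSum, hval, ← hσ s hs]
  rw [Equiv.sum_comp σ (fun j => if j ∈ s then x j else 0)]
  simp

/-- **Kolmogorov's maximal inequality** over a chain of index sets. -/
theorem measure_exists_chain_abs_sum_ge (μ : Measure ℝ) [IsProbabilityMeasure μ]
    (hμ : MemLp id 2 μ) (h0 : ∫ x, x ∂μ = 0) {n : ℕ} (C : Set (Finset (Fin n)))
    (hC : IsChain (· ⊆ ·) C) {K : ℝ} (hK : 0 < K) :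
    (Measure.pi fun _ : Fin n => μ) {x | ∃ s ∈ C, K ≤ |∑ j ∈ s, x j|} ≤
      ENNReal.ofReal (n * (∫ x, x ^ 2 ∂μ) / K ^ 2) := by
  refine (measure_mono ?_).trans ((measure_exists_chain_weight_mul_sq_ge μ hμ h0
    (fun _ => 1 / K ^ 2) (fun _ => by positivity) (fun _ => le_rfl) C hC).trans_eq ?_)
  · rintro x ⟨s, hs, h⟩
    refine ⟨s, hs, ?_⟩
    rw [one_div, inv_mul_eq_div, one_le_div (by positivity), ← sq_abs (∑ j ∈ s, x j)]
    gcongr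
  · congr 1
    simp
    ring

/-- Telescoping from `1 / x ^ 2 ≤ 1 / (x - 1) - 1 / x`; the negative term is kept so that the
induction closes. -/
lemma sum_one_div_add_sq_le {k₀ : ℝ} (hk : 0 < k₀) (n : ℕ) :
    ∑ k ∈ Finset.range n, 1 / (k₀ + (k + 1 : ℕ)) ^ 2 ≤ 1 / k₀ - 1 / (k₀ + n) := by
  induction n with
  | zero => simp
  | succ n ih =>
    rw [Finset.sum_range_succ]
    have h1 : 1 / (k₀ + (n + 1 : ℕ)) ^ 2 ≤ 1 / (k₀ + n) - 1 / (k₀ + (n + 1 : ℕ)) := by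
      push_cast
      rw [div_sub_div _ _ (by positivity) (by positivity), div_le_div_iff₀ (by positivity)
        (by positivity)]
      nlinarith [sq_nonneg (k₀ + n)]
    linarith

/-- Linear growth bound for the sums over a chain of index sets. -/
theorem measure_exists_chain_abs_sum_ge_linear (μ : Measure ℝ) [IsProbabilityMeasure μ]
    (hμ : MemLp id 2 μ) (h0 : ∫ x, x ∂μ = 0) {n : ℕ} (C : Set (Finset (Fin n)))
    (hC : IsChain (· ⊆ ·) C) {τ k₀ : ℝ} (hτ : 0 < τ) (hk : 0 < k₀) :
    (Measure.pi fun _ : Fin n => μ) {x | ∃ s ∈ C, τ * (k₀ + s.card) ≤ |∑ j ∈ s, x j|} ≤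
      ENNReal.ofReal ((∫ x, x ^ 2 ∂μ) / (τ ^ 2 * k₀)) := by
  refine (measure_mono ?_).trans ((measure_exists_chain_weight_mul_sq_ge μ hμ h0
    (fun k => 1 / τ ^ 2 * (1 / (k₀ + k) ^ 2)) (fun _ => by positivity) (fun k => ?_) C hC).trans ?_)
  · rintro x ⟨s, hs, h⟩
    refine ⟨s, hs, ?_⟩
    rw [one_div_mul_one_div, ← mul_pow, one_div, inv_mul_eq_div, one_le_div (by positivity),
      ← sq_abs (∑ j ∈ s, x j)]
    gcongr
  · gcongr
    simp
  · refine ENNReal.ofReal_le_ofReal ?_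
    have hV : 0 ≤ ∫ x, x ^ 2 ∂μ := integral_nonneg fun x => sq_nonneg x
    rw [← Finset.mul_sum]
    refine (mul_le_mul_of_nonneg_left ?_ hV).trans_eq (div_eq_mul_one_div _ _).symm
    rw [← one_div_mul_one_div]
    have := sum_one_div_add_sq_le hk n
    have h2 : 0 ≤ 1 / (k₀ + n) := by positivity
    gcongr
    linarith

/-! ### Empirical measures and the maximizers of the empirical criterion -/

lemma integrable_empMeasure {E : Type*} [MeasurableSpace E] [MeasurableSingletonClass E] {n : ℕ}
    (x : Fin n → E) (φ : E → ℝ) : Integrable φ (empMeasure x) := by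
  rcases Nat.eq_zero_or_pos n with rfl | hn
  · simp [empMeasure]
  · refine Integrable.smul_measure ?_ (by simp; omega)
    exact integrable_finsetSum_measure.2 fun i _ => integrable_dirac (by simp)

lemma integral_empMeasure {E : Type*} [MeasurableSpace E] [MeasurableSingletonClass E] {n : ℕ}
    (x : Fin n → E) (φ : E → ℝ) : ∫ y, φ y ∂(empMeasure x) = (∑ j, φ (x j)) / n := by
  rw [empMeasure, integral_smul_measure, integral_finsetSum_measure]
  · simp [div_eq_inv_mul]
  · exact fun i _ => integrable_dirac (by simp)

lemma isProbabilityMeasure_empMeasure {E : Type*} [MeasurableSpace E] {n : ℕ} (hn : 1 ≤ n)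
    (x : Fin n → E) : IsProbabilityMeasure (empMeasure x) := by
  constructor
  simp only [empMeasure, Measure.smul_apply, Measure.finsetSum_apply, measure_univ,
    Finset.sum_const, Finset.card_univ, Fintype.card_fin, smul_eq_mul, nsmul_eq_mul, mul_one]
  exact ENNReal.inv_mul_cancel (by simp; omega) (by simp)

lemma crit_empMeasure {n : ℕ} (x : Fin n → Obs) (θ : Param) :
    crit (empMeasure x) θ = -((∑ j, resid θ (x j) ^ 2) / n) := by
  rw [crit, integral_empMeasure]
  simp [mFn, neg_div]

/-- A maximizer of the empirical criterion gives a genuine minimizer of the sum of squares with an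
arbitrarily close change point. -/
lemma IsMaximizer.exists_near {a b : ℝ} {n : ℕ} (hn : 1 ≤ n) {x : Fin n → Obs} {θ : Param}
    (h : IsMaximizer a b (empMeasure x) θ) {κ : ℝ} (hκ : 0 < κ) :
    ∃ ζ ∈ Icc a b, |ζ - θ.2.2| < κ ∧ ∀ θ' ∈ Theta a b,
      ∑ j, resid (θ.1, θ.2.1, ζ) (x j) ^ 2 ≤ ∑ j, resid θ' (x j) ^ 2 := by
  obtain ⟨hθ, hlub⟩ := h
  have hn' : (0 : ℝ) < n := by exact_mod_cast hn
  have key : ∀ ζ : ℝ, max (crit (empMeasure x) θ) (critLeft a (empMeasure x) θ) =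
      crit (empMeasure x) (θ.1, θ.2.1, ζ) → ∀ θ' ∈ Theta a b,
      ∑ j, resid (θ.1, θ.2.1, ζ) (x j) ^ 2 ≤ ∑ j, resid θ' (x j) ^ 2 := by
    intro ζ hζ θ' hθ'
    have := hlub.1 (mem_image_of_mem _ hθ')
    rw [hζ, crit_empMeasure, crit_empMeasure, neg_le_neg_iff,
      div_le_div_iff_of_pos_right hn'] at this
    exact this
  rcases le_total (critLeft a (empMeasure x) θ) (crit (empMeasure x) θ) with hle | hle
  · refine ⟨θ.2.2, hθ, by simpa using hκ, key _ ?_⟩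
    rw [max_eq_left hle]
  · by_cases ha : a < θ.2.2
    -- The empirical criterion is a step function of `ζ`: just to the left of a point no covariate
    -- is crossed, so the left limit is a value attained at nearby `ζ`.
    · have hev : ∀ᶠ ζ in 𝓝[<] θ.2.2, ∀ j, (x j).2 ≤ ζ ↔ (x j).2 < θ.2.2 := by
        rw [eventually_all]
        intro j
        by_cases hj : (x j).2 < θ.2.2
        · filter_upwards [Ioo_mem_nhdsLT hj] with ζ hζ
          exact ⟨fun _ => hj, fun _ => hζ.1.le⟩
        · filter_upwards [self_mem_nhdsWithin] with ζ hζ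
          exact ⟨fun h => absurd (h.trans_lt hζ) hj, fun h => absurd h hj⟩
      set v : ℝ := -((∑ j, ((x j).1 - if (x j).2 < θ.2.2 then θ.1 else θ.2.1) ^ 2) / n) with hv
      have hev' : ∀ᶠ ζ in 𝓝[<] θ.2.2, crit (empMeasure x) (θ.1, θ.2.1, ζ) = v := by
        filter_upwards [hev] with ζ hζ
        rw [crit_empMeasure, hv]
        simp only [resid, regFn, hζ]
      have hlim : critLeft a (empMeasure x) θ = v := by
        rw [critLeft, if_pos ha]
        refine leftLim_eq_of_tendsto (tendsto_const_nhds.congr' ?_)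
        filter_upwards [hev'] with ζ hζ using hζ.symm
      have hnear : ∀ᶠ ζ in 𝓝[<] θ.2.2, ζ ∈ Ioo (max a (θ.2.2 - κ)) θ.2.2 :=
        Ioo_mem_nhdsLT (max_lt ha (by linarith))
      obtain ⟨ζ, h1, h2⟩ := (hev'.and hnear).exists
      have h3 := (le_max_left _ _).trans_lt h2.1
      have h4 := (le_max_right _ _).trans_lt h2.1
      refine ⟨ζ, ⟨h3.le, h2.2.le.trans hθ.2⟩, ?_, key _ ?_⟩
      · rw [abs_lt]; constructor <;> linarith [h2.2]
      · rw [max_eq_right hle, hlim, h1]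
    · refine ⟨θ.2.2, hθ, by simpa using hκ, key _ ?_⟩
      rw [critLeft, if_neg ha, max_self]

/-! ### The basic inequality of least squares -/

/-- The indices with `z j ≤ t`. -/
def idxLE {n : ℕ} (z : Fin n → ℝ) (t : ℝ) : Finset (Fin n) := {j | z j ≤ t}

/-- The indices with `s < z j ≤ t`. -/
def idxIoc {n : ℕ} (z : Fin n → ℝ) (s t : ℝ) : Finset (Fin n) := {j | s < z j ∧ z j ≤ t}

/-- The indices with `t < z j`. -/
def idxGT {n : ℕ} (z : Fin n → ℝ) (t : ℝ) : Finset (Fin n) := {j | t < z j}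

lemma sum_three_regions {n : ℕ} (z w : Fin n → ℝ) {s t : ℝ} (hst : s ≤ t) :
    ∑ j, w j = ∑ j ∈ idxLE z s, w j + ∑ j ∈ idxIoc z s t, w j + ∑ j ∈ idxGT z t, w j := by
  simp only [idxLE, idxIoc, idxGT, Finset.sum_filter]
  rw [← Finset.sum_add_distrib, ← Finset.sum_add_distrib]
  refine Finset.sum_congr rfl fun j _ => ?_
  rcases le_or_gt (z j) s with h | h
  · simp [h, h.trans hst, not_lt.2 h, not_lt.2 (h.trans hst)]
  · rcases le_or_gt (z j) t with h' | h'
    · simp [h, h', not_le.2 h, not_lt.2 h']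
    · simp [h, h', not_le.2 h, not_le.2 h']

/-- Expansion of the excess sum of squares over the regions cut out by two change points. -/
lemma exists_excess_eq {n : ℕ} (z : Fin n → ℝ) (θ θ' : Param) :
    ∃ C : ℝ, (C = (θ'.2.1 - θ.2.1) + (θ.2.1 - θ.1) ∨ C = (θ'.1 - θ.1) - (θ.2.1 - θ.1)) ∧
      ∀ (g : ℝ → ℝ) (w : Fin n → ℝ), ∑ j, g (regFn θ' (z j) - regFn θ (z j)) * w j =
        g (θ'.1 - θ.1) * ∑ j ∈ idxLE z (min θ.2.2 θ'.2.2), w j +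
        g C * ∑ j ∈ idxIoc z (min θ.2.2 θ'.2.2) (max θ.2.2 θ'.2.2), w j +
        g (θ'.2.1 - θ.2.1) * ∑ j ∈ idxGT z (max θ.2.2 θ'.2.2), w j := by
  have aux : ∀ C : ℝ, (∀ t, min θ.2.2 θ'.2.2 < t → t ≤ max θ.2.2 θ'.2.2 →
      regFn θ' t - regFn θ t = C) →
      ∀ (g : ℝ → ℝ) (w : Fin n → ℝ), ∑ j, g (regFn θ' (z j) - regFn θ (z j)) * w j =
        g (θ'.1 - θ.1) * ∑ j ∈ idxLE z (min θ.2.2 θ'.2.2), w j +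
        g C * ∑ j ∈ idxIoc z (min θ.2.2 θ'.2.2) (max θ.2.2 θ'.2.2), w j +
        g (θ'.2.1 - θ.2.1) * ∑ j ∈ idxGT z (max θ.2.2 θ'.2.2), w j := by
    intro C hC g w
    rw [sum_three_regions z _ (min_le_max (a := θ.2.2) (b := θ'.2.2)), Finset.mul_sum,
      Finset.mul_sum, Finset.mul_sum]
    congr 1
    · congr 1
      · refine Finset.sum_congr rfl fun j hj => ?_
        have hj' : z j ≤ min θ.2.2 θ'.2.2 := by simpa [idxLE] using hj
        rw [le_min_iff] at hj'
        simp [regFn, hj'.1, hj'.2]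
      · refine Finset.sum_congr rfl fun j hj => ?_
        have hj' : min θ.2.2 θ'.2.2 < z j ∧ z j ≤ max θ.2.2 θ'.2.2 :=
          (Finset.mem_filter.1 hj).2
        rw [hC _ hj'.1 hj'.2]
    · refine Finset.sum_congr rfl fun j hj => ?_
      have hj' : max θ.2.2 θ'.2.2 < z j := (Finset.mem_filter.1 hj).2
      rw [max_lt_iff] at hj'
      simp [regFn, not_le.2 hj'.1, not_le.2 hj'.2]
  rcases le_total θ'.2.2 θ.2.2 with h | h
  · refine ⟨_, Or.inl rfl, aux _ fun t h1 h2 => ?_⟩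
    rw [min_eq_right h] at h1
    rw [max_eq_left h] at h2
    simp [regFn, not_le.2 h1, h2]
  · refine ⟨_, Or.inr rfl, aux _ fun t h1 h2 => ?_⟩
    rw [min_eq_left h] at h1
    rw [max_eq_right h] at h2
    simp [regFn, not_le.2 h1, h2]

/-- Completing the square: the concave quadratic is largest at `x = k / m`. -/
lemma two_mul_mul_sub_le {m : ℝ} (hm : 0 < m) (x k : ℝ) :
    2 * (x * k) - m * x ^ 2 ≤ k ^ 2 / m := by
  rw [le_div_iff₀ hm]
  nlinarith [sq_nonneg (m * x - k)]

/-- Bounds extracted from the basic inequality of least squares. -/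
lemma bounds_of_basic_inequality {A B C D N₁ N₂ N₃ S₁ S₂ S₃ K m : ℝ} (hD : D ≠ 0)
    (hC : C = B + D ∨ C = A - D) (hm : 0 < m) (hN₁ : m ≤ N₁) (hN₂ : 0 ≤ N₂) (hN₃ : m ≤ N₃)
    (hS₁ : |S₁| ≤ K) (hS₂ : |S₂| ≤ 2 * K) (hS₃ : |S₃| ≤ 2 * K) (hK : 192 * K ≤ m * |D|)
    (h : N₁ * A ^ 2 + N₂ * C ^ 2 + N₃ * B ^ 2 ≤ 2 * (A * S₁ + C * S₂ + B * S₃)) :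
    m * (|A| + |B|) ^ 2 ≤ 12 * K * |D| ∧
    N₂ * (9 / 16 * D ^ 2) ≤ 5 / 2 * |D| * |S₂| + 5 * K ^ 2 / m ∧
    m * (A ^ 2 + B ^ 2) ≤ 4 * K * (|A| + |B|) + 5 / 2 * |D| * |S₂| := by
  have hD' : 0 < |D| := abs_pos.2 hD
  have hK0 : 0 ≤ K := (abs_nonneg _).trans hS₁
  have hA0 := abs_nonneg A
  have hB0 := abs_nonneg B
  have hC0 := abs_nonneg C
  have e₁ : A * S₁ ≤ |A| * K := (le_abs_self _).trans (by rw [abs_mul]; gcongr)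
  have e₂ : C * S₂ ≤ |C| * (2 * K) := (le_abs_self _).trans (by rw [abs_mul]; gcongr)
  have e₂' : C * S₂ ≤ |C| * |S₂| := (le_abs_self _).trans (by rw [abs_mul])
  have e₃ : B * S₃ ≤ |B| * (2 * K) := (le_abs_self _).trans (by rw [abs_mul]; gcongr)
  have f₁ : m * A ^ 2 ≤ N₁ * A ^ 2 := by gcongr
  have f₃ : m * B ^ 2 ≤ N₃ * B ^ 2 := by gcongr
  have f₂ : 0 ≤ N₂ * C ^ 2 := by positivity
  have hCle : |C| ≤ |A| + |B| + |D| := by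
    rcases hC with rfl | rfl
    · linarith [abs_add_le B D]
    · linarith [abs_sub A D]
  have hCge : |D| - (|A| + |B|) ≤ |C| := by
    rcases hC with rfl | rfl
    · have := abs_sub_abs_le_abs_sub D (-B)
      rw [abs_neg, sub_neg_eq_add, add_comm D B] at this
      linarith
    · have := abs_sub_abs_le_abs_sub D A
      rw [abs_sub_comm D A] at this
      linarith
  have hsq : (|A| + |B|) ^ 2 ≤ 2 * (A ^ 2 + B ^ 2) := by
    rw [← sq_abs A, ← sq_abs B]; nlinarith [sq_nonneg (|A| - |B|)]
  have hKA : 0 ≤ K * |A| := by positivity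
  have hmain : m * (A ^ 2 + B ^ 2) ≤ 4 * K * (2 * (|A| + |B|) + |D|) := by
    nlinarith [mul_le_mul_of_nonneg_left hCle hK0]
  have ht : m * (|A| + |B|) ^ 2 ≤ 8 * K * (2 * (|A| + |B|) + |D|) := by
    nlinarith [mul_le_mul_of_nonneg_left hsq hm.le]
  set t := |A| + |B| with htdef
  have ht0 : 0 ≤ t := by positivity
  -- The constant 192 is `4 * 48`. If `t` exceeded `|D| / 4`, then `2 * t + |D| ≤ 6 * t` would give
  -- `m * t ≤ 48 * K`, contradicting `192 * K ≤ m * |D|`. Hence `|C|` is comparable with the jump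
  -- `|D|`.
  have htD : t ≤ |D| / 4 := by
    by_contra hlt
    push Not at hlt
    have h1 : m * t ^ 2 ≤ 48 * K * t := by
      have := mul_le_mul_of_nonneg_left (show 2 * t + |D| ≤ 6 * t by linarith) hK0
      linarith
    have htpos : 0 < t := by linarith
    have h2 : m * t ≤ 48 * K := by
      have : (m * t) * t ≤ 48 * K * t := by linarith [sq t, mul_assoc m t t]
      exact le_of_mul_le_mul_right this htpos
    have h3 := mul_lt_mul_of_pos_left hlt hm
    linarith
  have hC54 : |C| ≤ 5 / 4 * |D| := by linarith
  have hC34 : 3 / 4 * |D| ≤ |C| := by linarith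
  refine ⟨?_, ?_, ?_⟩
  · have := mul_le_mul_of_nonneg_left (show 2 * t + |D| ≤ 3 / 2 * |D| by linarith) hK0
    linarith
  · have hC2 : 9 / 16 * D ^ 2 ≤ C ^ 2 := by
      have := pow_le_pow_left₀ (by positivity) hC34 2
      rw [mul_pow, sq_abs, sq_abs] at this
      linarith
    -- The level terms are maximized out, at a cost of `K ^ 2 / m` for `A` and `4 * K ^ 2 / m` for
    -- `B`, which bounds the count without reference to `A` and `B`.
    have g₁ := two_mul_mul_sub_le hm |A| K
    have g₃ := two_mul_mul_sub_le hm |B| (2 * K)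
    rw [sq_abs] at g₁ g₃
    have g₂ := mul_le_mul_of_nonneg_left hC2 hN₂
    have g₄ := mul_le_mul_of_nonneg_right hC54 (abs_nonneg S₂)
    have : 5 * K ^ 2 / m = K ^ 2 / m + (2 * K) ^ 2 / m := by ring
    rw [this]
    linarith
  · have g₄ := mul_le_mul_of_nonneg_right hC54 (abs_nonneg S₂)
    linarith

lemma resid_eq_sub_excess (θ θ' : Param) (x : Obs) :
    resid θ' x = resid θ x - (regFn θ' x.2 - regFn θ x.2) := by
  simp only [resid]; ring

lemma measurable_regFn (θ : Param) : Measurable (regFn θ) :=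
  Measurable.ite measurableSet_Iic measurable_const measurable_const

lemma measurable_resid (θ : Param) : Measurable (resid θ) :=
  measurable_fst.sub ((measurable_regFn θ).comp measurable_snd)

/-- The basic inequality of least squares. -/
lemma exists_basic_inequality {n : ℕ} (x : Fin n → Obs) (θ θ' : Param)
    (h : ∑ j, resid θ' (x j) ^ 2 ≤ ∑ j, resid θ (x j) ^ 2) :
    ∃ C : ℝ, (C = (θ'.2.1 - θ.2.1) + (θ.2.1 - θ.1) ∨ C = (θ'.1 - θ.1) - (θ.2.1 - θ.1)) ∧
      (idxLE (fun j => (x j).2) (min θ.2.2 θ'.2.2)).card * (θ'.1 - θ.1) ^ 2 +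
        (idxIoc (fun j => (x j).2) (min θ.2.2 θ'.2.2) (max θ.2.2 θ'.2.2)).card * C ^ 2 +
        (idxGT (fun j => (x j).2) (max θ.2.2 θ'.2.2)).card * (θ'.2.1 - θ.2.1) ^ 2 ≤
      2 * ((θ'.1 - θ.1) * ∑ j ∈ idxLE (fun j => (x j).2) (min θ.2.2 θ'.2.2), resid θ (x j) +
        C * ∑ j ∈ idxIoc (fun j => (x j).2) (min θ.2.2 θ'.2.2) (max θ.2.2 θ'.2.2),
          resid θ (x j) +
        (θ'.2.1 - θ.2.1) *
          ∑ j ∈ idxGT (fun j => (x j).2) (max θ.2.2 θ'.2.2), resid θ (x j)) := by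
  obtain ⟨C, hC, hsum⟩ := exists_excess_eq (fun j => (x j).2) θ θ'
  -- One region decomposition, with one and the same `C`, yields both the cross term and the
  -- quadratic term.
  have h1 := hsum (fun t => t) (fun j => resid θ (x j))
  have h2 := hsum (fun t => t ^ 2) (fun _ => 1)
  simp only [mul_one, Finset.sum_const, nsmul_eq_mul] at h2
  have h3 : ∑ j, resid θ' (x j) ^ 2 = ∑ j, resid θ (x j) ^ 2 -
      2 * ∑ j, (regFn θ' (x j).2 - regFn θ (x j).2) * resid θ (x j) +
      ∑ j, (regFn θ' (x j).2 - regFn θ (x j).2) ^ 2 := by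
    rw [Finset.mul_sum, ← Finset.sum_sub_distrib, ← Finset.sum_add_distrib]
    refine Finset.sum_congr rfl fun j _ => ?_
    rw [resid_eq_sub_excess θ θ']
    ring
  refine ⟨C, hC, ?_⟩
  rw [← h1]
  linarith

/-! ### The model law and its integrals -/

/-- The law of `(regFn θ Z + ε, Z)` for independent `Z ∼ ν` and `ε ∼ μ`. -/
def modelLaw (θ : Param) (ν μ : Measure ℝ) : Measure Obs :=
  (ν.prod μ).map (fun p => (regFn θ p.1 + p.2, p.1))

lemma measurable_modelMap (θ : Param) :
    Measurable fun p : ℝ × ℝ => ((regFn θ p.1 + p.2, p.1) : Obs) :=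
  (((measurable_regFn θ).comp measurable_fst).add measurable_snd).prodMk measurable_fst

lemma IsDensity.isProbabilityMeasure {g : ℝ → ℝ} (hg : IsDensity g) :
    IsProbabilityMeasure (densMeasure g) := by
  constructor
  rw [densMeasure, withDensity_apply _ MeasurableSet.univ, Measure.restrict_univ, hg.2.2]

instance (g : ℝ → ℝ) : NullSingletonClass (densMeasure g) := by
  unfold densMeasure; infer_instance

/-- Independence makes the law of `(Z, ε)` a product, and the model map inverts `x ↦ (x.2, resid θ₀
x)`. -/
lemma Model.eq_modelLaw {a b : ℝ} {f : ℝ → ℝ} {θ₀ : Param} {P : Measure Obs}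
    (hP : Model a b f θ₀ P) : P = modelLaw θ₀ (densMeasure f) (P.map (resid θ₀)) := by
  have := hP.isProb
  have h := hP.indep.symm.map_prod_eq_prod_map_map measurable_snd.aemeasurable
    (measurable_resid θ₀).aemeasurable
  rw [modelLaw, densMeasure, ← hP.law_Z, ← h,
    Measure.map_map (measurable_modelMap θ₀) (measurable_snd.prodMk (measurable_resid θ₀))]
  have : (fun p : ℝ × ℝ => ((regFn θ₀ p.1 + p.2, p.1) : Obs)) ∘
      (fun ω : Obs => (ω.2, resid θ₀ ω)) = id := by
    funext x; simp [resid]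
  rw [this, Measure.map_id]

lemma Model.isDensity {a b : ℝ} {f : ℝ → ℝ} {θ₀ : Param} {P : Measure Obs}
    (hP : Model a b f θ₀ P) : IsDensity f := by
  have := hP.isProb
  refine ⟨hP.f_measurable, hP.f_nonneg, ?_⟩
  have h : (P.map Prod.snd) univ = 1 := by
    rw [Measure.map_apply measurable_snd MeasurableSet.univ]; simp
  rwa [hP.law_Z, withDensity_apply _ MeasurableSet.univ, Measure.restrict_univ] at h

lemma modelLaw_preimage_snd (θ : Param) (ν μ : Measure ℝ) [SFinite ν] [IsProbabilityMeasure μ]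
    {S : Set ℝ} (hS : MeasurableSet S) : modelLaw θ ν μ {x | x.2 ∈ S} = ν S := by
  rw [modelLaw, Measure.map_apply (measurable_modelMap θ)
    (show MeasurableSet {x : Obs | x.2 ∈ S} from measurable_snd hS)]
  have : (fun p : ℝ × ℝ => ((regFn θ p.1 + p.2, p.1) : Obs)) ⁻¹' {x | x.2 ∈ S} = S ×ˢ univ := by
    ext p; simp
  rw [this, Measure.prod_prod, measure_univ, mul_one]

/-- On each side of the change point the response is a constant plus an error independent of the
covariate, so the integrand splits into two products to which Fubini applies. -/
lemma modelLaw_integrable_and_integral (θ : Param) (ν μ : Measure ℝ) [IsProbabilityMeasure ν]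
    [IsProbabilityMeasure μ] {h : ℝ → ℝ} (hm : Measurable h)
    (h1 : Integrable (fun e => h (θ.1 + e)) μ) (h2 : Integrable (fun e => h (θ.2.1 + e)) μ)
    {S : Set ℝ} (hS : MeasurableSet S) :
    Integrable (fun x : Obs => h x.1 * S.indicator 1 x.2) (modelLaw θ ν μ) ∧
    ∫ x, h x.1 * S.indicator 1 x.2 ∂(modelLaw θ ν μ) =
      ν.real (S ∩ Iic θ.2.2) * ∫ e, h (θ.1 + e) ∂μ +
      ν.real (S ∩ Ioi θ.2.2) * ∫ e, h (θ.2.1 + e) ∂μ := by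
  have hmeas : AEStronglyMeasurable (fun x : Obs => h x.1 * S.indicator 1 x.2)
      (modelLaw θ ν μ) :=
    ((hm.comp measurable_fst).mul
      ((measurable_one.indicator hS).comp measurable_snd)).aestronglyMeasurable
  have hL : MeasurableSet (S ∩ Iic θ.2.2) := hS.inter measurableSet_Iic
  have hR : MeasurableSet (S ∩ Ioi θ.2.2) := hS.inter measurableSet_Ioi
  have hind : ∀ {A : Set ℝ}, MeasurableSet A → Integrable (A.indicator (1 : ℝ → ℝ)) ν :=
    fun hA => (integrable_const (1 : ℝ)).indicator hA
  have hsplit : ((fun x : Obs => h x.1 * S.indicator 1 x.2) ∘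
      fun p : ℝ × ℝ => ((regFn θ p.1 + p.2, p.1) : Obs)) =
      fun p => (S ∩ Iic θ.2.2).indicator 1 p.1 * h (θ.1 + p.2) +
        (S ∩ Ioi θ.2.2).indicator 1 p.1 * h (θ.2.1 + p.2) := by
    funext p
    by_cases hp : p.1 ∈ S <;> by_cases hp' : p.1 ≤ θ.2.2 <;>
      simp [hp, hp', regFn, indicator, not_lt.2, not_le.1]
  have i1 : Integrable (fun p : ℝ × ℝ => (S ∩ Iic θ.2.2).indicator (1 : ℝ → ℝ) p.1 *
      h (θ.1 + p.2)) (ν.prod μ) := (hind hL).mul_prod h1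
  have i2 : Integrable (fun p : ℝ × ℝ => (S ∩ Ioi θ.2.2).indicator (1 : ℝ → ℝ) p.1 *
      h (θ.2.1 + p.2)) (ν.prod μ) := (hind hR).mul_prod h2
  constructor
  · rw [modelLaw] at hmeas ⊢
    rw [integrable_map_measure hmeas (measurable_modelMap θ).aemeasurable, hsplit]
    exact i1.add i2
  · have := integral_map (measurable_modelMap θ).aemeasurable (μ := ν.prod μ) hmeas
    rw [modelLaw, this]
    have h' := congrFun hsplit
    simp only [Function.comp_apply] at h'
    simp_rw [h']
    rw [integral_add i1 i2, integral_prod_mul (f := (S ∩ Iic θ.2.2).indicator (1 : ℝ → ℝ))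
      (g := fun e => h (θ.1 + e)),
      integral_prod_mul (f := (S ∩ Ioi θ.2.2).indicator (1 : ℝ → ℝ))
      (g := fun e => h (θ.2.1 + e)), integral_indicator_one hL, integral_indicator_one hR]

/-- Under the model law the residual has a centered error independent of the covariate. -/
lemma setIntegral_resid_modelLaw (θ : Param) (ν μ : Measure ℝ) [IsProbabilityMeasure ν]
    [IsProbabilityMeasure μ] (h0 : ∫ e, e ∂μ = 0) {S : Set ℝ} (hS : MeasurableSet S) :
    ∫ x in {x : Obs | x.2 ∈ S}, resid θ x ∂(modelLaw θ ν μ) = 0 := by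
  rw [modelLaw, setIntegral_map
    (show MeasurableSet {x : Obs | x.2 ∈ S} from measurable_snd hS) (measurable_resid θ).aestronglyMeasurable
    (measurable_modelMap θ).aemeasurable]
  have : (fun p : ℝ × ℝ => ((regFn θ p.1 + p.2, p.1) : Obs)) ⁻¹' {x | x.2 ∈ S} = S ×ˢ univ := by
    ext p; simp
  have h1 : ∀ p : ℝ × ℝ, resid θ (regFn θ p.1 + p.2, p.1) = (fun _ => (1 : ℝ)) p.1 * p.2 := by
    intro p; simp [resid]
  rw [this]
  simp_rw [h1]
  rw [setIntegral_prod_mul (f := fun _ : ℝ => (1 : ℝ)) (g := fun e : ℝ => e)]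
  simp [h0]

/-! ### Conditions (I)-(III) for convergent model laws -/

/-- Order-connected subsets of the line are intervals. Without atoms the endpoints are irrelevant,
so each mass is at most a difference of two values of the distribution function, which accounts for
the factor 2. -/
lemma abs_measureReal_ordConnected_sub_le {ν ν' : Measure ℝ} [IsProbabilityMeasure ν]
    [IsProbabilityMeasure ν'] [NullSingletonClass ν] [NullSingletonClass ν'] {r : ℝ}
    (h : ∀ t, |ν.real (Iic t) - ν'.real (Iic t)| ≤ r) {I : Set ℝ} (hI : I.OrdConnected) :
    |ν.real I - ν'.real I| ≤ 2 * r := by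
  have hr : 0 ≤ r := (abs_nonneg _).trans (h 0)
  have hIoc : ∀ s t, |ν.real (Ioc s t) - ν'.real (Ioc s t)| ≤ 2 * r := by
    intro s t
    rcases le_total t s with hst | hst
    · simp [Ioc_eq_empty_of_le hst, hr]
    · rw [← Iic_sdiff_Iic, measureReal_sdiff (Iic_subset_Iic.2 hst) measurableSet_Iic,
        measureReal_sdiff (Iic_subset_Iic.2 hst) measurableSet_Iic]
      have h1 := abs_le.1 (h s)
      have h2 := abs_le.1 (h t)
      rw [abs_le]; constructor <;> linarith
  have hIoi : ∀ t, |ν.real (Ioi t) - ν'.real (Ioi t)| ≤ 2 * r := by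
    intro t
    rw [← compl_Iic, probReal_compl_eq_one_sub measurableSet_Iic,
      probReal_compl_eq_one_sub measurableSet_Iic]
    have h2 := abs_le.1 (h t)
    rw [abs_le]; constructor <;> linarith
  have hIic : ∀ t, |ν.real (Iic t) - ν'.real (Iic t)| ≤ 2 * r := fun t => by linarith [h t]
  have hcl : I ∈ {s : Set ℝ | IsPreconnected s} := hI.isPreconnected
  rw [setOfPred_isPreconnected_eq_of_ordered] at hcl
  simp only [mem_union, mem_range, Prod.exists, Function.uncurry_apply_pair, mem_insert_iff,
    mem_singleton_iff] at hcl
  rcases hcl with (((⟨s, t, rfl⟩ | ⟨s, t, rfl⟩) | ⟨s, t, rfl⟩) | ⟨s, t, rfl⟩) |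
    ((((⟨s, rfl⟩ | ⟨s, rfl⟩) | ⟨s, rfl⟩) | ⟨s, rfl⟩) | (rfl | rfl))
  · rw [← measureReal_congr Ioc_ae_eq_Icc, ← measureReal_congr Ioc_ae_eq_Icc]; exact hIoc s t
  · rw [measureReal_congr Ico_ae_eq_Ioc, measureReal_congr Ico_ae_eq_Ioc]; exact hIoc s t
  · exact hIoc s t
  · rw [measureReal_congr Ioo_ae_eq_Ioc, measureReal_congr Ioo_ae_eq_Ioc]; exact hIoc s t
  · rw [← measureReal_congr Ioi_ae_eq_Ici, ← measureReal_congr Ioi_ae_eq_Ici]; exact hIoi s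
  · exact hIoi s
  · exact hIic s
  · rw [measureReal_congr Iio_ae_eq_Iic, measureReal_congr Iio_ae_eq_Iic]; exact hIic s
  · simp [hr]
  · simp [hr]

lemma abs_measureReal_sub_le_of_iff_off (ν : Measure ℝ) [IsFiniteMeasure ν] {A B N : Set ℝ}
    (hAB : ∀ u, u ∉ N → (u ∈ A ↔ u ∈ B)) : |ν.real A - ν.real B| ≤ ν.real N := by
  have key : ∀ {A B : Set ℝ}, (∀ u, u ∉ N → (u ∈ A ↔ u ∈ B)) →
      ν.real A ≤ ν.real B + ν.real N := by
    intro A B h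
    refine (measureReal_mono ?_).trans (measureReal_union_le _ _)
    intro u hu
    by_cases hu' : u ∈ N
    · exact Or.inr hu'
    · exact Or.inl ((h u hu').1 hu)
  have h1 := key hAB
  have h2 := key fun u hu => (hAB u hu).symm
  rw [abs_le]; constructor <;> linarith

lemma UnifConv.union {Q : ℕ → Measure Obs} {P : Measure Obs} {𝓒 𝓓 : Set (Obs → ℝ)}
    (h𝓒 : UnifConv Q P 𝓒) (h𝓓 : UnifConv Q P 𝓓) : UnifConv Q P (𝓒 ∪ 𝓓) := by
  refine ⟨?_, ?_⟩
  · rintro φ (h | h)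
    · exact h𝓒.1 φ h
    · exact h𝓓.1 φ h
  · have h1 := Metric.tendstoUniformlyOn_iff.1 h𝓒.2
    have h2 := Metric.tendstoUniformlyOn_iff.1 h𝓓.2
    refine Metric.tendstoUniformlyOn_iff.2 fun ε hε => ?_
    filter_upwards [h1 ε hε, h2 ε hε] with n a1 a2
    rintro φ (h | h)
    · exact a1 φ h
    · exact a2 φ h

/-- The changes of the weights multiply the primed values, so only these need a bound. In the
application they are the limit integrals, for which a bound uniform over the class is available. -/
lemma abs_mixture_sub_le {p p' q q' x x' y y' C : ℝ} (hp : 0 ≤ p ∧ p ≤ 1) (hq : 0 ≤ q ∧ q ≤ 1)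
    (hx : |x'| ≤ C) (hy : |y'| ≤ C) :
    |p' * x' + q' * y' - (p * x + q * y)| ≤
      |x' - x| + |y' - y| + C * (|p' - p| + |q' - q|) := by
  have e : p' * x' + q' * y' - (p * x + q * y) =
      p * (x' - x) + q * (y' - y) + ((p' - p) * x' + (q' - q) * y') := by ring
  rw [e]
  have h1 : |p * (x' - x)| ≤ 1 * |x' - x| := by
    rw [abs_mul, abs_of_nonneg hp.1]; gcongr; exact hp.2
  have h2 : |q * (y' - y)| ≤ 1 * |y' - y| := by
    rw [abs_mul, abs_of_nonneg hq.1]; gcongr; exact hq.2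
  have h3 : |(p' - p) * x'| ≤ |p' - p| * C := by rw [abs_mul]; gcongr
  have h4 : |(q' - q) * y'| ≤ |q' - q| * C := by rw [abs_mul]; gcongr
  have a1 := abs_add_le (p * (x' - x) + q * (y' - y)) ((p' - p) * x' + (q' - q) * y')
  have a2 := abs_add_le (p * (x' - x)) (q * (y' - y))
  have a3 := abs_add_le ((p' - p) * x') ((q' - q) * y')
  linarith

/-- Uniform convergence of the masses of intervals truncated at convergent points. -/
lemma eventually_abs_measureReal_truncated_sub_lt {ν : ℕ → Measure ℝ} {ν₀ : Measure ℝ}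
    [IsProbabilityMeasure ν₀] [NullSingletonClass ν₀]
    (hν : ∀ n, 1 ≤ n → IsProbabilityMeasure (ν n)) (hνa : ∀ n, NullSingletonClass (ν n))
    (hF : TendstoUniformly (fun n t => (ν n).real (Iic t)) (fun t => ν₀.real (Iic t)) atTop)
    {ζ : ℕ → ℝ} {ζ₀ : ℝ} (hζ : Tendsto ζ atTop (𝓝 ζ₀)) {ε : ℝ} (hε : 0 < ε) :
    ∀ᶠ n in atTop, ∀ I : Set ℝ, I.OrdConnected →
      |ν₀.real (I ∩ Iic ζ₀) - (ν n).real (I ∩ Iic (ζ n))| < ε ∧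
      |ν₀.real (I ∩ Ioi ζ₀) - (ν n).real (I ∩ Ioi (ζ n))| < ε := by
  have h1 := Metric.tendstoUniformly_iff.1 hF (ε / 6) (by positivity)
  have h2 : ∃ δ > 0, ν₀.real (Icc (ζ₀ - δ) (ζ₀ + δ)) < ε / 2 := by
    have ht : Tendsto (fun δ => ν₀.real (Icc (ζ₀ - δ) (ζ₀ + δ))) (𝓝[>] 0) (𝓝 0) := by
      have := (ENNReal.tendsto_toReal ENNReal.zero_ne_top).comp (tendsto_measure_Icc ν₀ ζ₀)
      exact (by simpa using! this : Tendsto _ _ _).mono_left nhdsWithin_le_nhds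
    obtain ⟨δ, h, h'⟩ := ((ht.eventually (gt_mem_nhds (half_pos hε))).and
      self_mem_nhdsWithin).exists
    exact ⟨δ, h', h⟩
  obtain ⟨δ, hδ, hδε⟩ := h2
  filter_upwards [h1, Metric.tendsto_nhds.1 hζ δ hδ, eventually_ge_atTop 1] with n hn hζn hn1 I hI
  have := hν n hn1
  have := hνa n
  have hn' : ∀ t, |ν₀.real (Iic t) - (ν n).real (Iic t)| ≤ ε / 6 := fun t => (hn t).le
  rw [Real.dist_eq, abs_lt] at hζn
  -- Truncating at `ζ n` instead of `ζ₀` changes the set only inside a window of `ν₀`-mass below `ε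
  -- / 2`; replacing `ν₀` by `ν n` on an interval costs at most `2 * (ε / 6)`.
  have key : ∀ A B : Set ℝ, B.OrdConnected →
      (∀ u, u ∉ Icc (ζ₀ - δ) (ζ₀ + δ) → (u ∈ A ↔ u ∈ B)) →
      |ν₀.real A - (ν n).real B| < ε := by
    intro A B hB hAB
    have e1 := abs_measureReal_ordConnected_sub_le hn' hB
    have e2 := abs_measureReal_sub_le_of_iff_off ν₀ hAB
    have e3 := abs_sub_le (ν₀.real A) (ν₀.real B) ((ν n).real B)
    linarith
  constructor
  · refine key _ _ (hI.inter ordConnected_Iic) fun u hu => ?_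
    simp only [mem_inter_iff, mem_Iic, mem_Icc, not_and_or, not_le] at hu ⊢
    refine and_congr_right fun _ => ?_
    rcases hu with hu | hu <;> constructor <;> intro h <;> linarith [hζn.1, hζn.2]
  · refine key _ _ (hI.inter ordConnected_Ioi) fun u hu => ?_
    simp only [mem_inter_iff, mem_Ioi, mem_Icc, not_and_or, not_le] at hu ⊢
    refine and_congr_right fun _ => ?_
    rcases hu with hu | hu <;> constructor <;> intro h <;> linarith [hζn.1, hζn.2]

/-- The integral formula separates the interval from the function of the response. Uniformity in `I`
comes from the distribution functions, uniformity in `h` from the shifted means, and the bound `C`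
lets the two be combined. -/
theorem unifConv_modelLaw {θ : ℕ → Param} {θ₀ : Param} {ν μ : ℕ → Measure ℝ} {ν₀ μ₀ : Measure ℝ}
    [IsProbabilityMeasure ν₀] [NullSingletonClass ν₀] [IsProbabilityMeasure μ₀]
    (hν : ∀ n, 1 ≤ n → IsProbabilityMeasure (ν n)) (hνa : ∀ n, NullSingletonClass (ν n))
    (hμ : ∀ n, 1 ≤ n → IsProbabilityMeasure (μ n))
    (hF : TendstoUniformly (fun n t => (ν n).real (Iic t)) (fun t => ν₀.real (Iic t)) atTop)
    (hθ : Tendsto θ atTop (𝓝 θ₀)) {𝓗 : Set (ℝ → ℝ)} (hm : ∀ h ∈ 𝓗, Measurable h)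
    (hint₀ : ∀ h ∈ 𝓗, ∀ s, Integrable (fun e => h (s + e)) μ₀)
    (hint : ∀ n, 1 ≤ n → ∀ h ∈ 𝓗, ∀ s, Integrable (fun e => h (s + e)) (μ n))
    {C : ℝ} (hC : ∀ h ∈ 𝓗, |∫ e, h (θ₀.1 + e) ∂μ₀| ≤ C ∧ |∫ e, h (θ₀.2.1 + e) ∂μ₀| ≤ C)
    (hα : TendstoUniformlyOn (fun n (h : ℝ → ℝ) => ∫ e, h ((θ n).1 + e) ∂(μ n))
      (fun h => ∫ e, h (θ₀.1 + e) ∂μ₀) atTop 𝓗)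
    (hβ : TendstoUniformlyOn (fun n (h : ℝ → ℝ) => ∫ e, h ((θ n).2.1 + e) ∂(μ n))
      (fun h => ∫ e, h (θ₀.2.1 + e) ∂μ₀) atTop 𝓗)
    {𝓒 : Set (Obs → ℝ)} (h𝓒 : ∀ φ ∈ 𝓒, ∃ h ∈ 𝓗, ∃ I : Set ℝ, I.OrdConnected ∧
      φ = fun x => h x.1 * I.indicator 1 x.2) :
    UnifConv (fun n => modelLaw (θ n) (ν n) (μ n)) (modelLaw θ₀ ν₀ μ₀) 𝓒 := by
  refine ⟨?_, ?_⟩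
  · intro φ hφ
    obtain ⟨h, hh, I, hI, rfl⟩ := h𝓒 φ hφ
    refine ⟨(modelLaw_integrable_and_integral θ₀ ν₀ μ₀ (hm h hh) (hint₀ h hh _) (hint₀ h hh _)
      hI.measurableSet).1, fun n hn => ?_⟩
    have := hν n hn
    have := hμ n hn
    exact (modelLaw_integrable_and_integral (θ n) (ν n) (μ n) (hm h hh) (hint n hn h hh _)
      (hint n hn h hh _) hI.measurableSet).1
  · refine Metric.tendstoUniformlyOn_iff.2 fun ε hε => ?_
    have hC' : 0 < |C| + 1 := by positivity
    have hζ : Tendsto (fun n => (θ n).2.2) atTop (𝓝 θ₀.2.2) :=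
      (continuous_snd.comp continuous_snd).continuousAt.tendsto.comp hθ
    have hI := eventually_abs_measureReal_truncated_sub_lt hν hνa hF hζ
      (ε := ε / (4 * (|C| + 1))) (by positivity)
    filter_upwards [hI, Metric.tendstoUniformlyOn_iff.1 hα (ε / 4) (by positivity),
      Metric.tendstoUniformlyOn_iff.1 hβ (ε / 4) (by positivity), eventually_ge_atTop 1]
      with n h1 h2 h3 hn φ hφ
    obtain ⟨h, hh, I, hI, rfl⟩ := h𝓒 φ hφ
    have := hν n hn
    have := hμ n hn
    rw [(modelLaw_integrable_and_integral θ₀ ν₀ μ₀ (hm h hh) (hint₀ h hh _) (hint₀ h hh _)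
      hI.measurableSet).2, (modelLaw_integrable_and_integral (θ n) (ν n) (μ n) (hm h hh)
      (hint n hn h hh _) (hint n hn h hh _) hI.measurableSet).2, Real.dist_eq]
    refine (abs_mixture_sub_le (C := |C| + 1) ⟨measureReal_nonneg, measureReal_le_one⟩
      ⟨measureReal_nonneg, measureReal_le_one⟩
      ((hC h hh).1.trans (by linarith [le_abs_self C]))
      ((hC h hh).2.trans (by linarith [le_abs_self C]))).trans_lt ?_
    obtain ⟨k1, k2⟩ := h1 I hI
    have k3 := h2 h hh
    have k4 := h3 h hh
    rw [Real.dist_eq] at k3 k4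
    have k5 : (|C| + 1) * (|ν₀.real (I ∩ Iic θ₀.2.2) - (ν n).real (I ∩ Iic (θ n).2.2)| +
        |ν₀.real (I ∩ Ioi θ₀.2.2) - (ν n).real (I ∩ Ioi (θ n).2.2)|) ≤
        (|C| + 1) * (2 * (ε / (4 * (|C| + 1)))) := by gcongr; linarith
    have k6 : (|C| + 1) * (2 * (ε / (4 * (|C| + 1)))) = ε / 2 := by field_simp; norm_num
    linarith

/-- Convergence of the first two moments of centered error laws. -/
structure MomentConv (μ : ℕ → Measure ℝ) (μ₀ : Measure ℝ) : Prop where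
  prob : ∀ n, 1 ≤ n → IsProbabilityMeasure (μ n)
  prob₀ : IsProbabilityMeasure μ₀
  memLp : ∀ n, 1 ≤ n → MemLp id 2 (μ n)
  memLp₀ : MemLp id 2 μ₀
  mean : ∀ n, 1 ≤ n → ∫ e, e ∂(μ n) = 0
  mean₀ : ∫ e, e ∂μ₀ = 0
  abs_shift : ∀ M : ℝ, TendstoUniformlyOn (fun n s => ∫ e, |s + e| ∂(μ n))
    (fun s => ∫ e, |s + e| ∂μ₀) atTop (Icc (-M) M)
  sq : Tendsto (fun n => ∫ e, e ^ 2 ∂(μ n)) atTop (𝓝 (∫ e, e ^ 2 ∂μ₀))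

/-- The Lipschitz bound does not depend on the law. It allows shifts to move with `n` and later
upgrades convergence at rational shifts to uniform convergence. -/
lemma abs_integral_abs_add_sub_le {μ : Measure ℝ} [IsProbabilityMeasure μ]
    (hμ : Integrable (fun e : ℝ => e) μ) (s t : ℝ) :
    |∫ e, |s + e| ∂μ - ∫ e, |t + e| ∂μ| ≤ |s - t| := by
  have hi : ∀ s : ℝ, Integrable (fun e => |s + e|) μ := fun s =>
    ((integrable_const s).add hμ).abs
  rw [← integral_sub (hi s) (hi t)]
  refine (abs_integral_le_integral_abs).trans ?_
  calc ∫ e, |(|s + e| - |t + e|)| ∂μ ≤ ∫ _, |s - t| ∂μ := by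
        refine integral_mono ((hi s).sub (hi t)).abs (integrable_const _) fun e => ?_
        have := abs_abs_sub_abs_le_abs_sub (s + e) (t + e)
        simpa using this
    _ = |s - t| := by simp

/-- The shifts `s n + t` eventually stay within `M + |s₀| + 1`, where convergence is uniform; moving
the shift inside the limit integral costs at most `|s n - s₀|`. -/
lemma MomentConv.tendsto_abs_shift {μ : ℕ → Measure ℝ} {μ₀ : Measure ℝ} (h : MomentConv μ μ₀)
    {s : ℕ → ℝ} {s₀ : ℝ} (hs : Tendsto s atTop (𝓝 s₀)) (M : ℝ) {ε : ℝ} (hε : 0 < ε) :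
    ∀ᶠ n in atTop, ∀ t, |t| ≤ M →
      |∫ e, |s₀ + e + t| ∂μ₀ - ∫ e, |s n + e + t| ∂(μ n)| < ε := by
  have := h.prob₀
  have h1 := Metric.tendstoUniformlyOn_iff.1 (h.abs_shift (M + |s₀| + 1)) (ε / 2) (by positivity)
  filter_upwards [h1, Metric.tendsto_nhds.1 hs (min 1 (ε / 2)) (by positivity)] with n h1 h2 t ht
  rw [Real.dist_eq, lt_min_iff] at h2
  have e1 : |s n + t| ≤ M + |s₀| + 1 := by
    have a1 := abs_add_le (s n) t
    have a2 := abs_sub_abs_le_abs_sub (s n) s₀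
    linarith [h2.1]
  have e2 := h1 (s n + t) (abs_le.1 e1)
  have e3 := abs_integral_abs_add_sub_le (h.memLp₀.integrable (by norm_num)) (s₀ + t) (s n + t)
  rw [add_sub_add_right_eq_sub, abs_sub_comm s₀] at e3
  rw [Real.dist_eq] at e2
  have c1 : ∀ e, s₀ + e + t = s₀ + t + e := fun e => by ring
  have c2 : ∀ e, s n + e + t = s n + t + e := fun e => by ring
  simp_rw [c1, c2]
  have e4 := abs_sub_le (∫ e, |s₀ + t + e| ∂μ₀) (∫ e, |s n + t + e| ∂μ₀)
    (∫ e, |s n + t + e| ∂(μ n))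
  linarith [h2.2]

lemma integral_add_sq_of_centered {μ : Measure ℝ} [IsProbabilityMeasure μ]
    (hμ : MemLp id 2 μ) (h0 : ∫ e, e ∂μ = 0) (s : ℝ) :
    ∫ e, (s + e) ^ 2 ∂μ = s ^ 2 + ∫ e, e ^ 2 ∂μ := by
  have hi1 : Integrable (fun e : ℝ => e) μ := hμ.integrable (by norm_num)
  have hi2 : Integrable (fun e : ℝ => e ^ 2) μ := hμ.integrable_sq
  have : ∀ e : ℝ, (s + e) ^ 2 = (s ^ 2 + 2 * s * e) + e ^ 2 := fun e => by ring
  have hi3 : Integrable (fun e : ℝ => s ^ 2 + 2 * s * e) μ :=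
    (integrable_const _).add (hi1.const_mul _)
  simp_rw [this]
  rw [integral_add hi3 hi2, integral_add (integrable_const _) (hi1.const_mul _), integral_const_mul, h0]
  simp

/-- Each class is covered by a family of functions of the response: a constant, the identity and the
square by single functions, the shifted absolute values by a family indexed by `t`. For the identity
and the square, centering makes the shifted means explicit. -/
theorem condsIToIII_modelLaw {θ : ℕ → Param} {θ₀ : Param} {ν μ : ℕ → Measure ℝ}
    {ν₀ μ₀ : Measure ℝ} [IsProbabilityMeasure ν₀] [NullSingletonClass ν₀]
    (hν : ∀ n, 1 ≤ n → IsProbabilityMeasure (ν n)) (hνa : ∀ n, NullSingletonClass (ν n))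
    (hF : TendstoUniformly (fun n t => (ν n).real (Iic t)) (fun t => ν₀.real (Iic t)) atTop)
    (hθ : Tendsto θ atTop (𝓝 θ₀)) (hμ : MomentConv μ μ₀) :
    UnifConv (fun n => modelLaw (θ n) (ν n) (μ n)) (modelLaw θ₀ ν₀ μ₀) classF ∧
    (∀ M > 0, UnifConv (fun n => modelLaw (θ n) (ν n) (μ n)) (modelLaw θ₀ ν₀ μ₀) (classG M)) ∧
    UnifConv (fun n => modelLaw (θ n) (ν n) (μ n)) (modelLaw θ₀ ν₀ μ₀) classH := by
  have hμp := hμ.prob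
  have := hμ.prob₀
  have hα₀ : Tendsto (fun n => (θ n).1) atTop (𝓝 θ₀.1) :=
    continuous_fst.continuousAt.tendsto.comp hθ
  have hβ₀ : Tendsto (fun n => (θ n).2.1) atTop (𝓝 θ₀.2.1) :=
    (continuous_fst.comp continuous_snd).continuousAt.tendsto.comp hθ
  have hi : ∀ n, 1 ≤ n → Integrable (fun e : ℝ => e) (μ n) := fun n hn => by
    have := hμp n hn
    exact (hμ.memLp n hn).integrable (by norm_num)
  have hi₀ : Integrable (fun e : ℝ => e) μ₀ := hμ.memLp₀.integrable (by norm_num)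
  have hsq : ∀ {κ : Measure ℝ} [IsProbabilityMeasure κ], MemLp id 2 κ →
      ∀ s : ℝ, Integrable (fun e => (s + e) ^ 2) κ := fun hκ s =>
    ((memLp_const s).add hκ).integrable_sq
  -- a single function `h` whose shifted means converge
  have single : ∀ (h : ℝ → ℝ), Measurable h → (∀ s, Integrable (fun e => h (s + e)) μ₀) →
      (∀ n, 1 ≤ n → ∀ s, Integrable (fun e => h (s + e)) (μ n)) →
      (∀ (s : ℕ → ℝ) (s₀ : ℝ), Tendsto s atTop (𝓝 s₀) →
        Tendsto (fun n => ∫ e, h (s n + e) ∂(μ n)) atTop (𝓝 (∫ e, h (s₀ + e) ∂μ₀))) →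
      UnifConv (fun n => modelLaw (θ n) (ν n) (μ n)) (modelLaw θ₀ ν₀ μ₀)
        {ψ | ∃ φ ∈ classF, ψ = fun x => h x.1 * φ x} := by
    intro h hm hh₀ hh hlim
    refine unifConv_modelLaw (𝓗 := {h})
      (C := max |∫ e, h (θ₀.1 + e) ∂μ₀| |∫ e, h (θ₀.2.1 + e) ∂μ₀|) hν hνa hμp hF hθ ?_ ?_ ?_ ?_ ?_
      ?_ ?_
    · rintro _ rfl; exact hm
    · rintro _ rfl; exact hh₀
    · rintro n hn _ rfl; exact hh n hn
    · rintro _ rfl; exact ⟨le_max_left _ _, le_max_right _ _⟩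
    · rw [tendstoUniformlyOn_singleton_iff_tendsto]; exact hlim _ _ hα₀
    · rw [tendstoUniformlyOn_singleton_iff_tendsto]; exact hlim _ _ hβ₀
    · rintro _ ⟨_, ⟨I, hI, rfl⟩, rfl⟩
      exact ⟨h, rfl, I, hI, rfl⟩
  refine ⟨?_, fun M hM => ?_, ?_⟩
  · have := single (fun _ => 1) measurable_const (fun _ => integrable_const _)
      (fun n hn _ => by have := hμp n hn; exact integrable_const _) (fun s s₀ _ => ?_)
    · refine ⟨fun φ hφ => this.1 φ ⟨φ, hφ, by simp⟩, this.2.mono fun φ hφ => ⟨φ, hφ, by simp⟩⟩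
    · refine tendsto_const_nhds.congr' ?_
      filter_upwards [eventually_ge_atTop 1] with n hn
      have := hμp n hn
      simp
  · refine UnifConv.union ?_ ?_
    · refine single (fun y => y) measurable_id (fun s => (integrable_const s).add hi₀)
        (fun n hn s => ?_) (fun s s₀ hs => ?_)
      · have := hμp n hn
        exact (integrable_const s).add (hi n hn)
      · rw [integral_add (integrable_const _) hi₀, hμ.mean₀]
        simp only [integral_const, probReal_univ, smul_eq_mul, one_mul, add_zero]
        refine hs.congr' ?_
        filter_upwards [eventually_ge_atTop 1] with n hn
        have := hμp n hn
        rw [integral_add (integrable_const _) (hi n hn), hμ.mean n hn]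
        simp
    · refine unifConv_modelLaw (𝓗 := {h | ∃ t : ℝ, |t| ≤ M ∧ h = fun y => |y + t|})
        (C := ∫ e, |θ₀.1 + e| ∂μ₀ + ∫ e, |θ₀.2.1 + e| ∂μ₀ + M) hν hνa hμp hF hθ ?_ ?_ ?_ ?_ ?_
        ?_ ?_
      · rintro _ ⟨t, -, rfl⟩; exact (measurable_id.add_const t).abs
      · rintro _ ⟨t, -, rfl⟩ s
        exact (((integrable_const s).add hi₀).add (integrable_const t)).abs
      · rintro n hn _ ⟨t, -, rfl⟩ s
        have := hμp n hn
        exact (((integrable_const s).add (hi n hn)).add (integrable_const t)).abs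
      · rintro _ ⟨t, ht, rfl⟩
        have key : ∀ s : ℝ, |∫ e, |s + e + t| ∂μ₀| ≤ ∫ e, |s + e| ∂μ₀ + M := by
          intro s
          rw [abs_of_nonneg (integral_nonneg fun _ => abs_nonneg _)]
          have c1 : ∀ e, s + e + t = s + t + e := fun e => by ring
          simp_rw [c1]
          have := abs_integral_abs_add_sub_le hi₀ (s + t) s
          rw [add_sub_cancel_left] at this
          linarith [(abs_le.1 this).2]
        have n1 : 0 ≤ ∫ e, |θ₀.1 + e| ∂μ₀ := integral_nonneg fun _ => abs_nonneg _
        have n2 : 0 ≤ ∫ e, |θ₀.2.1 + e| ∂μ₀ := integral_nonneg fun _ => abs_nonneg _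
        exact ⟨(key _).trans (by linarith), (key _).trans (by linarith)⟩
      · refine Metric.tendstoUniformlyOn_iff.2 fun ε hε => ?_
        filter_upwards [hμ.tendsto_abs_shift hα₀ M hε] with n hn
        rintro _ ⟨t, ht, rfl⟩
        exact hn t ht
      · refine Metric.tendstoUniformlyOn_iff.2 fun ε hε => ?_
        filter_upwards [hμ.tendsto_abs_shift hβ₀ M hε] with n hn
        rintro _ ⟨t, ht, rfl⟩
        exact hn t ht
      · rintro _ ⟨_, ⟨I, hI, rfl⟩, t, ht, rfl⟩
        exact ⟨_, ⟨t, ht, rfl⟩, I, hI, rfl⟩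
  · refine single (fun y => y ^ 2) (measurable_id.pow_const 2) (hsq hμ.memLp₀)
      (fun n hn s => ?_) (fun s s₀ hs => ?_)
    · have := hμp n hn
      exact hsq (hμ.memLp n hn) s
    · rw [integral_add_sq_of_centered hμ.memLp₀ hμ.mean₀]
      refine ((hs.pow 2).add hμ.sq).congr' ?_
      filter_upwards [eventually_ge_atTop 1] with n hn
      have := hμp n hn
      rw [integral_add_sq_of_centered (hμ.memLp n hn) (hμ.mean n hn)]

/-! ### Condition (V) -/

/-- Condition (V) when the covariate densities are eventually bounded below near the centers. -/
theorem condV_modelLaw {θ : ℕ → Param} {θ₀ : Param} {g : ℕ → ℝ → ℝ} {μ : ℕ → Measure ℝ}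
    {μ₀ : Measure ℝ} (hg : ∀ n, 1 ≤ n → IsDensity (g n)) (hθ : Tendsto θ atTop (𝓝 θ₀))
    (hμ : MomentConv μ μ₀) {κ r : ℝ} (hκ : 0 < κ) (hr : 0 < r)
    (hlow : ∀ᶠ n in atTop, ∀ s t, |s - θ₀.2.2| ≤ r → |t - θ₀.2.2| ≤ r → s ≤ t →
      κ * (t - s) ≤ (densMeasure (g n)).real (Ioc s t)) :
    CondV (fun n => modelLaw (θ n) (densMeasure (g n)) (μ n)) (fun n => n) θ := by
  have hζ : Tendsto (fun n => (θ n).2.2) atTop (𝓝 θ₀.2.2) :=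
    (continuous_snd.comp continuous_snd).continuousAt.tendsto.comp hθ
  -- With `δ < min 1 (r / 2)` one has `δ ^ 2 ≤ r / 2`, which keeps `ζ` within `r` of `ζ₀` once the
  -- centers are within `r / 2`. Halving `κ` leaves room for `ρ' = κ`. Any `L` would do, because the
  -- residual integrals vanish.
  refine ⟨min 1 (r / 2), by positivity, κ / 2, by positivity, 1, one_pos, fun δ hδ hδη => ?_⟩
  rw [lt_min_iff] at hδη
  have hδ2 : δ ^ 2 ≤ r / 2 := by nlinarith
  obtain ⟨N, hN⟩ := eventually_atTop.1 (hlow.and ((Metric.tendsto_nhds.1 hζ (r / 2)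
    (by positivity)).and (eventually_ge_atTop 1)))
  refine ⟨N, fun n hn => ?_⟩
  obtain ⟨hlown, hζn, hn1⟩ := hN n hn
  have := (hg n hn1).isProbabilityMeasure
  have := hμ.prob n hn1
  rw [Real.dist_eq] at hζn
  have hzero : ∀ S : Set ℝ, MeasurableSet S →
      ∫ x in {x : Obs | x.2 ∈ S}, resid (θ n) x ∂(modelLaw (θ n) (densMeasure (g n)) (μ n)) = 0 :=
    fun S hS => setIntegral_resid_modelLaw _ _ _ (hμ.mean n hn1) hS
  refine ⟨⟨κ, by linarith, fun ζ h1 h2 => ?_⟩, fun ζ _ => ?_, fun ζ _ => ?_⟩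
  · have hbt : between ζ (θ n).2.2 = {x | x.2 ∈ Ioc (min ζ (θ n).2.2) (max ζ (θ n).2.2)} := rfl
    rw [hbt, measureReal_def, modelLaw_preimage_snd _ _ _ measurableSet_Ioc, ← measureReal_def]
    have hζ' : |ζ - θ₀.2.2| ≤ r := by
      have := abs_sub_le ζ (θ n).2.2 θ₀.2.2
      linarith
    have hζn' : |(θ n).2.2 - θ₀.2.2| ≤ r := by linarith
    have hpos : 0 < |ζ - (θ n).2.2| := lt_of_lt_of_le (by positivity) h1
    have := hlown (min ζ (θ n).2.2) (max ζ (θ n).2.2)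
      (by rcases min_choice ζ (θ n).2.2 with h | h <;> rw [h] <;> assumption)
      (by rcases max_choice ζ (θ n).2.2 with h | h <;> rw [h] <;> assumption) min_le_max
    rw [max_sub_min_eq_abs'] at this
    rw [one_div, inv_mul_eq_div, le_div_iff₀ hpos]
    exact this
  · rw [show between ζ (θ n).2.2 = {x | x.2 ∈ Ioc (min ζ (θ n).2.2) (max ζ (θ n).2.2)} from rfl,
      hzero _ measurableSet_Ioc, abs_zero]
    positivity
  · rw [show {x : Obs | x.2 ≤ min ζ (θ n).2.2} = {x | x.2 ∈ Iic (min ζ (θ n).2.2)} from rfl,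
      show {x : Obs | max ζ (θ n).2.2 < x.2} = {x | x.2 ∈ Ioi (max ζ (θ n).2.2)} from rfl,
      hzero _ measurableSet_Iic, hzero _ measurableSet_Ioi, abs_zero, add_zero]
    positivity

/-- Uniform convergence of densities near a point where the limit is bounded below gives a linear
lower bound for the masses of small intervals. -/
lemma eventually_linear_lower_bound {f : ℝ → ℝ} {g : ℕ → ℝ → ℝ} {ζ₀ c d η κ : ℝ}
    (hg : ∀ n, 1 ≤ n → IsDensity (g n)) (hκ : 0 < κ)
    (hf : ∀ z, |z - ζ₀| ≤ η → κ < f z) {r : ℝ} (hrη : r ≤ η) (hrc : c ≤ ζ₀ - r) (hrd : ζ₀ + r ≤ d)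
    (hgf : TendstoUniformlyOn g f atTop (Icc c d)) :
    ∀ᶠ n in atTop, ∀ s t, |s - ζ₀| ≤ r → |t - ζ₀| ≤ r → s ≤ t →
      κ / 2 * (t - s) ≤ (densMeasure (g n)).real (Ioc s t) := by
  -- Half of the lower bound `κ` is given up to the uniform error between `g n` and `f`.
  filter_upwards [Metric.tendstoUniformlyOn_iff.1 hgf (κ / 2) (by positivity),
    eventually_ge_atTop 1] with n hn hn1 s t hs ht hst
  have := (hg n hn1).isProbabilityMeasure
  rw [abs_le] at hs ht
  have hle : ENNReal.ofReal (κ / 2 * (t - s)) ≤ densMeasure (g n) (Ioc s t) := by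
    rw [densMeasure, withDensity_apply _ measurableSet_Ioc]
    calc ENNReal.ofReal (κ / 2 * (t - s)) = ∫⁻ _ in Ioc s t, ENNReal.ofReal (κ / 2) := by
          rw [setLIntegral_const, Real.volume_Ioc, ENNReal.ofReal_mul (by positivity)]
      _ ≤ _ := by
          refine setLIntegral_mono ((hg n hn1).1.ennreal_ofReal) fun z hz => ?_
          refine ENNReal.ofReal_le_ofReal ?_
          have h1 := hn z ⟨by linarith [hz.1, hs.1], by linarith [hz.2, ht.2]⟩
          have h2 := hf z (abs_le.2 ⟨by linarith [hz.1, hs.1], by linarith [hz.2, ht.2]⟩)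
          rw [Real.dist_eq, abs_lt] at h1
          linarith [h1.2]
  have := ENNReal.toReal_mono (measure_ne_top _ _) hle
  rwa [ENNReal.toReal_ofReal (mul_nonneg (by positivity) (by linarith))] at this

/-! ### Chains cut out by the covariates, and covariate counts -/

/-- The index sets which are lower sets for the key `k (z j)` among the indices with `z j ∈ m`. -/
def lowerFamily {n : ℕ} (m : Set ℝ) (k : ℝ → ℝ) (z : Fin n → ℝ) : Set (Finset (Fin n)) :=
  {s | (∀ i ∈ s, z i ∈ m) ∧ ∀ i ∈ s, ∀ j, z j ∈ m → k (z j) ≤ k (z i) → j ∈ s}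

/-- Lower sets of a total preorder are nested, and ties in the key do no harm. -/
lemma isChain_lowerFamily {n : ℕ} (m : Set ℝ) (k : ℝ → ℝ) (z : Fin n → ℝ) :
    IsChain (· ⊆ ·) (lowerFamily m k z) := by
  rintro s hs t ht -
  by_contra h
  push Not at h
  obtain ⟨h1, h2⟩ := h
  obtain ⟨i, his, hit⟩ := Finset.not_subset.1 h1
  obtain ⟨j, hjt, hjs⟩ := Finset.not_subset.1 h2
  rcases le_total (k (z i)) (k (z j)) with h | h
  · exact hit (ht.2 j hjt i (hs.1 i his) h)
  · exact hjs (hs.2 i his j (ht.1 j hjt) h)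

lemma measurableSet_mem_lowerFamily {n : ℕ} {m : Set ℝ} (hm : MeasurableSet m) {k : ℝ → ℝ}
    (hk : Measurable k) (s : Finset (Fin n)) :
    MeasurableSet {z : Fin n → ℝ | s ∈ lowerFamily m k z} := by
  have hmi : ∀ i : Fin n, MeasurableSet {z : Fin n → ℝ | z i ∈ m} := fun i =>
    measurable_pi_apply i hm
  have hki : ∀ i j : Fin n, MeasurableSet {z : Fin n → ℝ | k (z j) ≤ k (z i)} := fun i j =>
    measurableSet_le (hk.comp (measurable_pi_apply j)) (hk.comp (measurable_pi_apply i))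
  refine MeasurableSet.inter (s₁ := {z : Fin n → ℝ | ∀ i ∈ s, z i ∈ m})
    (s₂ := {z : Fin n → ℝ | ∀ i ∈ s, ∀ j, z j ∈ m → k (z j) ≤ k (z i) → j ∈ s}) ?_ ?_
  · have : {z : Fin n → ℝ | ∀ i ∈ s, z i ∈ m} = ⋂ i ∈ s, {z | z i ∈ m} := by ext; simp
    rw [this]
    exact Finset.measurableSet_biInter _ fun i _ => hmi i
  · have : {z : Fin n → ℝ | ∀ i ∈ s, ∀ j, z j ∈ m → k (z j) ≤ k (z i) → j ∈ s} =
        ⋂ i ∈ s, ⋂ j, ({z | z j ∈ m}ᶜ ∪ ({z | k (z j) ≤ k (z i)}ᶜ ∪ {_z | j ∈ s})) := by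
      ext z; simp [imp_iff_not_or]
    rw [this]
    exact Finset.measurableSet_biInter _ fun i _ => MeasurableSet.iInter fun j =>
      (hmi j).compl.union ((hki i j).compl.union (MeasurableSet.const _))

/-- A bound valid for every chain of index sets transfers to the random chain of lower sets. -/
lemma prod_measure_exists_lowerFamily_le {n : ℕ} (ν : Measure (Fin n → ℝ)) (μ : Measure (Fin n → ℝ))
    [IsProbabilityMeasure ν] [SFinite μ] {m : Set ℝ} (hm : MeasurableSet m) {k : ℝ → ℝ}
    (hk : Measurable k) {Ψ : Finset (Fin n) → Set (Fin n → ℝ)} (hΨ : ∀ s, MeasurableSet (Ψ s))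
    {c : ENNReal} (h : ∀ C : Set (Finset (Fin n)), IsChain (· ⊆ ·) C →
      μ {e | ∃ s ∈ C, e ∈ Ψ s} ≤ c) :
    (ν.prod μ) {p | ∃ s ∈ lowerFamily m k p.1, p.2 ∈ Ψ s} ≤ c := by
  have hmeas : MeasurableSet {p : (Fin n → ℝ) × (Fin n → ℝ) |
      ∃ s ∈ lowerFamily m k p.1, p.2 ∈ Ψ s} := by
    have : {p : (Fin n → ℝ) × (Fin n → ℝ) | ∃ s ∈ lowerFamily m k p.1, p.2 ∈ Ψ s} =
        ⋃ s : Finset (Fin n), {z | s ∈ lowerFamily m k z} ×ˢ Ψ s := by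
      ext p; simp
    rw [this]
    exact MeasurableSet.iUnion fun s => (measurableSet_mem_lowerFamily hm hk s).prod (hΨ s)
  -- For fixed covariates the family is a deterministic chain, so the hypothesis applies to each
  -- section.
  rw [Measure.prod_apply hmeas]
  calc ∫⁻ z, μ (Prod.mk z ⁻¹' {p | ∃ s ∈ lowerFamily m k p.1, p.2 ∈ Ψ s}) ∂ν
      ≤ ∫⁻ _, c ∂ν := lintegral_mono fun z => h _ (isChain_lowerFamily m k z)
    _ = c := by simp

/-- Chebyshev's inequality for the number of sample points in a set. -/
lemma measure_card_mem_lt_le (ν : Measure ℝ) [IsProbabilityMeasure ν] {S : Set ℝ}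
    (hS : MeasurableSet S) {n : ℕ} (hn : 1 ≤ n) {p : ℝ} (hp : 0 < p) (hpS : p ≤ ν.real S) :
    (Measure.pi fun _ : Fin n => ν) {z | (({j | z j ∈ S} : Set (Fin n)).ncard : ℝ) < p / 2 * n} ≤
      ENNReal.ofReal (4 / (n * p)) := by
  set q := ν.real S with hq
  have hn' : (0 : ℝ) < n := by exact_mod_cast hn
  have hq1 : q ≤ 1 := measureReal_le_one
  have hq0 : 0 < q := hp.trans_le hpS
  set φ : ℝ → ℝ := fun t => S.indicator 1 t - q with hφ
  have hφm : Measurable φ := (measurable_one.indicator hS).sub_const q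
  set μ := ν.map φ with hμ
  have : IsProbabilityMeasure μ := Measure.isProbabilityMeasure_map hφm.aemeasurable
  have hind : Integrable (S.indicator (1 : ℝ → ℝ)) ν := (integrable_const (1 : ℝ)).indicator hS
  have hmean : ∫ x, x ∂μ = 0 := by
    rw [hμ, integral_map hφm.aemeasurable (by fun_prop)]
    simp only [hφ]
    rw [integral_sub hind (integrable_const _), integral_indicator_one hS]
    simp [hq]
  have hL2 : MemLp id 2 μ := by
    rw [hμ, memLp_map_measure_iff aestronglyMeasurable_id hφm.aemeasurable]
    refine MemLp.of_bound hφm.aestronglyMeasurable 1 (Eventually.of_forall fun t => ?_)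
    simp only [Function.comp_apply, id_eq, hφ, Real.norm_eq_abs, abs_le]
    by_cases ht : t ∈ S <;> simp [ht] <;> constructor <;> linarith
  -- The Bernoulli variance is bounded by `q` rather than a constant, so that the final bound is of
  -- order `1 / (n * p)`. It is thus useful even for windows of mass of order `1 / n`.
  have hvar : ∫ x, x ^ 2 ∂μ ≤ q := by
    rw [hμ, integral_map hφm.aemeasurable (by fun_prop)]
    have : ∀ t, φ t ^ 2 = (1 - 2 * q) * S.indicator (1 : ℝ → ℝ) t + q ^ 2 := by
      intro t
      by_cases ht : t ∈ S <;> simp [hφ, ht]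
      ring
    simp_rw [this]
    rw [integral_add (hind.const_mul _) (integrable_const _), integral_const_mul,
      integral_indicator_one hS]
    simp only [integral_const, probReal_univ, smul_eq_mul, one_mul, ← hq]
    nlinarith
  have hpi : (Measure.pi fun _ : Fin n => ν).map (fun z j => φ (z j)) =
      Measure.pi fun _ : Fin n => μ := Measure.pi_map_pi fun _ => hφm.aemeasurable
  -- For the one-element chain `{univ}` Kolmogorov's inequality is Chebyshev's.
  have hk := measure_exists_chain_abs_sum_ge μ hL2 hmean (n := n) {Finset.univ}
    (IsChain.singleton) (K := n * q / 2) (by positivity)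
  have hcard : ∀ z : Fin n → ℝ, ∑ j, φ (z j) = (({j | z j ∈ S} : Set (Fin n)).ncard : ℝ) - n * q := by
    classical
    intro z
    simp only [hφ, Finset.sum_sub_distrib, Finset.sum_const, Finset.card_univ, Fintype.card_fin,
      nsmul_eq_mul]
    congr 1
    simp only [indicator_apply, Pi.one_apply, Finset.sum_boole]
    rw [Set.ncard_eq_toFinset_card']
    congr 2
    ext j
    simp
  have hmp : Measurable fun (z : Fin n → ℝ) j => φ (z j) :=
    measurable_pi_lambda _ fun j => hφm.comp (measurable_pi_apply j)
  rw [← hpi] at hk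
  refine ((measure_mono ?_).trans ((Measure.le_map_apply hmp.aemeasurable _).trans hk)).trans ?_
  · intro z hz
    refine ⟨Finset.univ, rfl, ?_⟩
    rw [hcard, abs_sub_comm]
    refine le_trans ?_ (le_abs_self _)
    have hz' : (({j | z j ∈ S} : Set (Fin n)).ncard : ℝ) < p / 2 * n := hz
    nlinarith
  · refine ENNReal.ofReal_le_ofReal ?_
    calc n * (∫ x, x ^ 2 ∂μ) / (n * q / 2) ^ 2 ≤ n * q / (n * q / 2) ^ 2 := by gcongr
      _ = 4 / (n * q) := by field_simp; norm_num
      _ ≤ 4 / (n * p) := by gcongr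

/-- The sample is a function of an independent pair, all covariates and all errors, which is what
permits conditioning on the covariates by Fubini. -/
lemma pi_modelLaw_eq_map (θ : Param) (ν μ : Measure ℝ) [IsProbabilityMeasure ν]
    [IsProbabilityMeasure μ] (n : ℕ) :
    (Measure.pi fun _ : Fin n => modelLaw θ ν μ) =
      ((Measure.pi fun _ : Fin n => ν).prod (Measure.pi fun _ : Fin n => μ)).map
        (fun p j => ((regFn θ (p.1 j) + p.2 j, p.1 j) : Obs)) := by
  have h1 := (measurePreserving_arrowProdEquivProdArrow ℝ ℝ (Fin n) (fun _ => ν)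
    (fun _ => μ)).symm
  have hprob : IsProbabilityMeasure
      ((ν.prod μ).map (fun p : ℝ × ℝ => ((regFn θ p.1 + p.2, p.1) : Obs))) :=
    Measure.isProbabilityMeasure_map (measurable_modelMap θ).aemeasurable
  have h2 := Measure.pi_map_pi (μ := fun _ : Fin n => ν.prod μ)
    (f := fun _ (p : ℝ × ℝ) => ((regFn θ p.1 + p.2, p.1) : Obs))
    (fun _ => (measurable_modelMap θ).aemeasurable)
  simp only [modelLaw]
  rw [← h2, ← h1.map_eq, Measure.map_map _ h1.measurable]
  · rfl
  · exact measurable_pi_lambda _ fun j => (measurable_modelMap θ).comp (measurable_pi_apply j)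

lemma sum_idxIoc_eq {n : ℕ} (z w : Fin n → ℝ) {s t : ℝ} (hst : s ≤ t) :
    ∑ j ∈ idxIoc z s t, w j = ∑ j ∈ idxLE z t, w j - ∑ j ∈ idxLE z s, w j := by
  have h1 := sum_three_regions z w hst
  have h2 := sum_three_regions z w (le_refl t)
  have h3 : idxIoc z t t = ∅ := by
    ext j; simp [idxIoc]
  rw [h3, Finset.sum_empty] at h2
  linarith

lemma sum_idxGT_eq {n : ℕ} (z w : Fin n → ℝ) (t : ℝ) :
    ∑ j ∈ idxGT z t, w j = ∑ j, w j - ∑ j ∈ idxLE z t, w j := by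
  have h2 := sum_three_regions z w (le_refl t)
  have h3 : idxIoc z t t = ∅ := by
    ext j; simp [idxIoc]
  rw [h3, Finset.sum_empty] at h2
  linarith

lemma idxLE_mem_lowerFamily {n : ℕ} (z : Fin n → ℝ) (t : ℝ) :
    idxLE z t ∈ lowerFamily univ id z := by
  refine ⟨fun _ _ => mem_univ _, fun i hi j _ hij => ?_⟩
  simp only [idxLE, Finset.mem_filter, Finset.mem_univ, true_and] at hi ⊢
  exact le_trans hij hi

lemma univ_mem_lowerFamily {n : ℕ} (z : Fin n → ℝ) :
    Finset.univ ∈ lowerFamily univ id z :=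
  ⟨fun _ _ => mem_univ _, fun _ _ _ _ _ => Finset.mem_univ _⟩

/-- With the right end `t` fixed these windows grow leftwards, hence the order by `-z` among
covariates at most `t`. -/
lemma idxIoc_mem_lowerFamily_left {n : ℕ} (z : Fin n → ℝ) (s t : ℝ) :
    idxIoc z s t ∈ lowerFamily (Iic t) Neg.neg z := by
  simp only [lowerFamily, idxIoc, Finset.mem_filter, Finset.mem_univ, true_and, mem_ofPred_eq,
    mem_Iic, neg_le_neg_iff]
  exact ⟨fun i hi => hi.2, fun i hi j hj hij => ⟨hi.1.trans_le hij, hj⟩⟩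

lemma idxIoc_mem_lowerFamily_right {n : ℕ} (z : Fin n → ℝ) (s t : ℝ) :
    idxIoc z s t ∈ lowerFamily (Ioi s) id z := by
  simp only [lowerFamily, idxIoc, Finset.mem_filter, Finset.mem_univ, true_and, mem_ofPred_eq,
    mem_Ioi, id_eq]
  exact ⟨fun i hi => hi.1, fun i hi j hj hij => ⟨hj, hij.trans hi.2⟩⟩

lemma card_idxIoc_mono {n : ℕ} (z : Fin n → ℝ) {s s' t t' : ℝ} (hs : s' ≤ s) (ht : t ≤ t') :
    (idxIoc z s t).card ≤ (idxIoc z s' t').card := by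
  refine Finset.card_le_card fun j hj => ?_
  simp only [idxIoc, Finset.mem_filter, Finset.mem_univ, true_and] at hj ⊢
  exact ⟨hs.trans_lt hj.1, hj.2.trans ht⟩

lemma card_idxLE_mono {n : ℕ} (z : Fin n → ℝ) {t t' : ℝ} (ht : t ≤ t') :
    (idxLE z t).card ≤ (idxLE z t').card := by
  refine Finset.card_le_card fun j hj => ?_
  simp only [idxLE, Finset.mem_filter, Finset.mem_univ, true_and] at hj ⊢
  exact hj.trans ht

lemma card_idxGT_anti {n : ℕ} (z : Fin n → ℝ) {t t' : ℝ} (ht : t ≤ t') :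
    (idxGT z t').card ≤ (idxGT z t).card := by
  refine Finset.card_le_card fun j hj => ?_
  simp only [idxGT, Finset.mem_filter, Finset.mem_univ, true_and] at hj ⊢
  exact ht.trans_lt hj

/-! ### Tail bound for the rescaled estimation error -/

/-- A linear growth bound on the error sum between change points bounds the count in between. -/
lemma count_le_of_linear_growth {d D K₀ p k₀ N S : ℝ} (hd : 0 < d) (hp : 0 < p)
    (hk₀ : 0 < k₀) (hN : 0 ≤ N) (hD : d / 2 ≤ D)
    (h : N * (9 / 16 * D ^ 2) ≤ 5 / 2 * D * S + 10 * K₀ ^ 2 / p) (hS : S ≤ d / 20 * (k₀ + N)) :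
    N ≤ k₀ + 160 * K₀ ^ 2 / (p * d ^ 2) := by
  have hDpos : 0 < D := by linarith
  have h1 : 5 / 2 * D * S ≤ 5 / 2 * D * (d / 20 * (k₀ + N)) := by gcongr
  have h2 : D * d ≤ 2 * D ^ 2 := by nlinarith
  have h3 := mul_le_mul_of_nonneg_right h2 (show 0 ≤ k₀ + N by positivity)
  -- The slope `d / 20` is chosen so that the error term is at most `D ^ 2 / 4 * (k₀ + N)`; its part
  -- in `N` is absorbed, and `9 / 16 - 1 / 4 = 5 / 16` remains.
  have h4 : 5 / 16 * N * D ^ 2 ≤ 1 / 4 * k₀ * D ^ 2 + 10 * K₀ ^ 2 / p := by linarith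
  have h5 : 10 * K₀ ^ 2 / p ≤ 40 * K₀ ^ 2 / (p * d ^ 2) * D ^ 2 := by
    have : d ^ 2 ≤ 4 * D ^ 2 := by nlinarith
    calc 10 * K₀ ^ 2 / p = 10 * K₀ ^ 2 / (p * d ^ 2) * d ^ 2 := by field_simp
      _ ≤ 10 * K₀ ^ 2 / (p * d ^ 2) * (4 * D ^ 2) := by gcongr
      _ = _ := by ring
  have h6 : (5 / 16 * N) * D ^ 2 ≤
      (1 / 4 * k₀ + 40 * K₀ ^ 2 / (p * d ^ 2)) * D ^ 2 := by linarith
  have h7 := le_of_mul_le_mul_right h6 (by positivity)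
  have h8 : 160 * K₀ ^ 2 / (p * d ^ 2) = 4 * (40 * K₀ ^ 2 / (p * d ^ 2)) := by ring
  have h9 : 0 ≤ 40 * K₀ ^ 2 / (p * d ^ 2) := by positivity
  rw [h8]
  linarith

/-- The quadratic inequality behind the root-`n` rate of the two levels. -/
lemma level_rate_bound {d D K₀ p k₀ N S A B r : ℝ} (hd : 0 < d) (hp : 0 < p)
    (hD : D ≤ 2 * d) (hS0 : 0 ≤ S)
    (h : p / 2 * r ^ 2 * (A ^ 2 + B ^ 2) ≤ 4 * (K₀ * r) * (A + B) + 5 / 2 * D * S)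
    (hS : S ≤ d / 20 * (k₀ + N)) (hN : N ≤ k₀ + 160 * K₀ ^ 2 / (p * d ^ 2)) :
    p / 4 * ((r * A) ^ 2 + (r * B) ^ 2) ≤
      32 * K₀ ^ 2 / p + d ^ 2 / 2 * (k₀ + 80 * K₀ ^ 2 / (p * d ^ 2)) := by
  -- Each linear term is absorbed by half of the quadratic coefficient `p / 2`.
  have hq1 : ∀ u : ℝ, 4 * K₀ * u ≤ p / 4 * u ^ 2 + 16 * K₀ ^ 2 / p := by
    intro u
    have := two_mul_mul_sub_le (show 0 < p / 4 by positivity) u (2 * K₀)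
    have h' : (2 * K₀) ^ 2 / (p / 4) = 16 * K₀ ^ 2 / p := by field_simp; ring
    rw [h'] at this
    linarith
  have hSb : 5 / 2 * D * S ≤ d ^ 2 / 2 * (k₀ + 80 * K₀ ^ 2 / (p * d ^ 2)) := by
    have h8 : 160 * K₀ ^ 2 / (p * d ^ 2) = 2 * (80 * K₀ ^ 2 / (p * d ^ 2)) := by ring
    rw [h8] at hN
    have h1 : S ≤ d / 20 * (2 * (k₀ + 80 * K₀ ^ 2 / (p * d ^ 2))) :=
      hS.trans (by gcongr; linarith)
    calc 5 / 2 * D * S ≤ 5 / 2 * (2 * d) *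
          (d / 20 * (2 * (k₀ + 80 * K₀ ^ 2 / (p * d ^ 2)))) := by gcongr
      _ = _ := by ring
  have u1 := hq1 (r * A)
  have u2 := hq1 (r * B)
  have h32 : 32 * K₀ ^ 2 / p = 16 * K₀ ^ 2 / p + 16 * K₀ ^ 2 / p := by ring
  rw [h32]
  linarith

/-- Deterministic bound on the rescaled estimation error, for samples whose error sums over
families of intervals and whose covariate counts are controlled. -/
lemma rescaled_error_bound {a b : ℝ} {n : ℕ} (hn : 1 ≤ n) {x : Fin n → Obs} {θ θs : Param}
    (hθ : θ ∈ Theta a b) (hmax : IsMaximizer a b (empMeasure x) θs)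
    {d K₀ p k₀ M : ℝ} (hd : 0 < d) (hK₀ : 0 < K₀) (hp : 0 < p) (hk₀ : 0 < k₀) (hM : 0 ≤ M)
    (hd1 : d / 2 ≤ |θ.2.1 - θ.1|) (hd2 : |θ.2.1 - θ.1| ≤ 2 * d)
    (h192 : 192 * (K₀ * √(n : ℝ)) ≤ p / 2 * n * |θ.2.1 - θ.1|)
    (hsum : ∀ s ∈ lowerFamily univ id (fun j => (x j).2),
      |∑ j ∈ s, resid θ (x j)| ≤ K₀ * √(n : ℝ))
    (hcl : p / 2 * n ≤ (idxLE (fun j => (x j).2) a).card)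
    (hcr : p / 2 * n ≤ (idxGT (fun j => (x j).2) b).card)
    (hleft : ∀ s ∈ lowerFamily (Iic θ.2.2) Neg.neg (fun j => (x j).2),
      |∑ j ∈ s, resid θ (x j)| ≤ d / 20 * (k₀ + s.card))
    (hright : ∀ s ∈ lowerFamily (Ioi θ.2.2) id (fun j => (x j).2),
      |∑ j ∈ s, resid θ (x j)| ≤ d / 20 * (k₀ + s.card))
    (hnl : k₀ + 160 * K₀ ^ 2 / (p * d ^ 2) <
      (idxIoc (fun j => (x j).2) (θ.2.2 - M / n) θ.2.2).card)
    (hnr : k₀ + 160 * K₀ ^ 2 / (p * d ^ 2) <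
      (idxIoc (fun j => (x j).2) θ.2.2 (θ.2.2 + M / n)).card) :
    n * |θs.2.2 - θ.2.2| ≤ M + 1 ∧
    p / 4 * ((√(n : ℝ) * |θs.1 - θ.1|) ^ 2 + (√(n : ℝ) * |θs.2.1 - θ.2.1|) ^ 2) ≤
      32 * K₀ ^ 2 / p + d ^ 2 / 2 * (k₀ + 80 * K₀ ^ 2 / (p * d ^ 2)) := by
  have hn' : (0 : ℝ) < n := by exact_mod_cast hn
  -- Replacing the estimator by a genuine minimizer moves the change point by less than `1 / n`,
  -- which is the extra 1 in `M + 1`.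
  obtain ⟨ζ, hζ, hζs, hmin⟩ := hmax.exists_near hn (κ := 1 / n) (by positivity)
  set θ' : Param := (θs.1, θs.2.1, ζ) with hθ'
  obtain ⟨C, hC, hbasic⟩ := exists_basic_inequality x θ θ' (hmin θ hθ)
  set z : Fin n → ℝ := fun j => (x j).2 with hz
  set e : Fin n → ℝ := fun j => resid θ (x j) with he
  change ∀ s ∈ lowerFamily univ id z, |∑ j ∈ s, e j| ≤ _ at hsum
  set lo := min θ.2.2 θ'.2.2
  set hi := max θ.2.2 θ'.2.2
  set N₂ := (idxIoc z lo hi).card with hN₂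
  have hlohi : lo ≤ hi := min_le_max
  have hS₁ := hsum _ (idxLE_mem_lowerFamily z lo)
  have hS₁' := hsum _ (idxLE_mem_lowerFamily z hi)
  have hSu := hsum _ (univ_mem_lowerFamily z)
  have hS₂ : |∑ j ∈ idxIoc z lo hi, e j| ≤ 2 * (K₀ * √(n : ℝ)) := by
    rw [sum_idxIoc_eq z e hlohi]
    refine (abs_sub _ _).trans ?_
    linarith
  have hS₃ : |∑ j ∈ idxGT z hi, e j| ≤ 2 * (K₀ * √(n : ℝ)) := by
    rw [sum_idxGT_eq z e hi]
    refine (abs_sub _ _).trans ?_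
    linarith
  have hN₁ : p / 2 * n ≤ ((idxLE z lo).card : ℝ) :=
    hcl.trans (by exact_mod_cast card_idxLE_mono z (le_min hθ.1 hζ.1))
  have hN₃ : p / 2 * n ≤ ((idxGT z hi).card : ℝ) :=
    hcr.trans (by exact_mod_cast card_idxGT_anti z (max_le hθ.2 hζ.2))
  have hD : θ.2.1 - θ.1 ≠ 0 := by
    rw [← abs_pos]; linarith
  obtain ⟨-, hb1, hb2⟩ := bounds_of_basic_inequality hD hC (by positivity) hN₁
    (Nat.cast_nonneg _) hN₃ hS₁ hS₂ hS₃ h192 hbasic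
  set S₂ := |∑ j ∈ idxIoc z lo hi, e j| with hS₂def
  set D := |θ.2.1 - θ.1| with hDdef
  -- One end of the window is the true change point, so the window lies in one of the two one-sided
  -- chains.
  have hS₂lin : S₂ ≤ d / 20 * (k₀ + N₂) := by
    rcases le_total θ'.2.2 θ.2.2 with h | h
    · refine hleft _ ?_
      have : hi = θ.2.2 := max_eq_left h
      rw [← this]
      exact idxIoc_mem_lowerFamily_left z lo hi
    · refine hright _ ?_
      have : lo = θ.2.2 := min_eq_left h
      rw [← this]
      exact idxIoc_mem_lowerFamily_right z lo hi
  have hsq : √(n : ℝ) ^ 2 = n := Real.sq_sqrt hn'.le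
  have hKm : 5 * (K₀ * √(n : ℝ)) ^ 2 / (p / 2 * n) = 10 * K₀ ^ 2 / p := by
    rw [mul_pow, hsq]; field_simp; norm_num
  have hN₂le : (N₂ : ℝ) ≤ k₀ + 160 * K₀ ^ 2 / (p * d ^ 2) := by
    rw [hKm, ← sq_abs (θ.2.1 - θ.1)] at hb1
    exact count_le_of_linear_growth hd hp hk₀ (Nat.cast_nonneg _) hd1 hb1 hS₂lin
  constructor
  · have hMn : 0 ≤ M / n := by positivity
    -- If `ζ` were farther away, the window between the change points would contain a window of
    -- length `M / n`, which already has more points than `hN₂le` allows.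
    have hclose : |ζ - θ.2.2| ≤ M / n := by
      rw [abs_le]
      constructor
      · by_contra hlt
        push Not at hlt
        have h1 : lo = ζ := min_eq_right (by linarith : ζ ≤ θ.2.2)
        have h2 : hi = θ.2.2 := max_eq_left (by linarith : ζ ≤ θ.2.2)
        have h3 : (idxIoc z (θ.2.2 - M / n) θ.2.2).card ≤ N₂ := by
          rw [hN₂, h1, h2]
          exact card_idxIoc_mono z (by linarith) le_rfl
        have h4 : ((idxIoc z (θ.2.2 - M / n) θ.2.2).card : ℝ) ≤ N₂ := by exact_mod_cast h3
        linarith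
      · by_contra hlt
        push Not at hlt
        have h1 : lo = θ.2.2 := min_eq_left (by linarith : θ.2.2 ≤ ζ)
        have h2 : hi = ζ := max_eq_right (by linarith : θ.2.2 ≤ ζ)
        have h3 : (idxIoc z θ.2.2 (θ.2.2 + M / n)).card ≤ N₂ := by
          rw [hN₂, h1, h2]
          exact card_idxIoc_mono z le_rfl (by linarith)
        have h4 : ((idxIoc z θ.2.2 (θ.2.2 + M / n)).card : ℝ) ≤ N₂ := by exact_mod_cast h3
        linarith
    have h1 : |θs.2.2 - θ.2.2| ≤ 1 / n + M / n := by
      have := abs_sub_le θs.2.2 ζ θ.2.2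
      rw [abs_sub_comm] at hζs
      linarith
    calc n * |θs.2.2 - θ.2.2| ≤ n * (1 / n + M / n) := by gcongr
      _ = M + 1 := by field_simp; ring
  · set A := |θs.1 - θ.1| with hA
    set B := |θs.2.1 - θ.2.1| with hB
    have hA2 : (θ'.1 - θ.1) ^ 2 = A ^ 2 := (sq_abs _).symm
    have hB2 : (θ'.2.1 - θ.2.1) ^ 2 = B ^ 2 := (sq_abs _).symm
    rw [hA2, hB2] at hb2
    change p / 2 * n * (A ^ 2 + B ^ 2) ≤ 4 * (K₀ * √(n : ℝ)) * (A + B) + 5 / 2 * D * S₂ at hb2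
    rw [show p / 2 * (n : ℝ) = p / 2 * √(n : ℝ) ^ 2 by rw [hsq]] at hb2
    exact level_rate_bound hd hp hd2 (abs_nonneg _) hb2 hS₂lin hN₂le

lemma prod_preimage_fst_le {α β : Type*} [MeasurableSpace α] [MeasurableSpace β] (ν : Measure α)
    (μ : Measure β) [SFinite μ] [IsProbabilityMeasure μ] [SFinite ν] {S : Set α} {c : ENNReal}
    (h : ν S ≤ c) : (ν.prod μ) {p | p.1 ∈ S} ≤ c := by
  have : {p : α × β | p.1 ∈ S} = S ×ˢ univ := by ext p; simp
  rw [this, Measure.prod_prod, measure_univ, mul_one]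
  exact h

lemma measurable_root (n : ℕ) : Measurable fun p : Param × Param => root n p.1 p.2 := by
  unfold root
  fun_prop

lemma norm_root_le {n : ℕ} {θs θ : Param} {R : ℝ} (h1 : √(n : ℝ) * |θs.1 - θ.1| ≤ R)
    (h2 : √(n : ℝ) * |θs.2.1 - θ.2.1| ≤ R) (h3 : n * |θs.2.2 - θ.2.2| ≤ R) :
    ‖root n θs θ‖ ≤ R := by
  rw [root, Prod.norm_def, Prod.norm_def]
  simp only [Real.norm_eq_abs, abs_mul, abs_of_nonneg (Real.sqrt_nonneg _), Nat.abs_cast]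
  exact max_le h1 (max_le h2 h3)

/-- Non-asymptotic tail bound for the rescaled estimation error under a model law. -/
lemma measure_norm_root_gt_le {a b : ℝ} {T : (n : ℕ) → (Fin n → Obs) → Param} (hT : IsLSE a b T)
    {n : ℕ} (hn : 1 ≤ n) {θ : Param} (hθ : θ ∈ Theta a b) {ν μ : Measure ℝ}
    [IsProbabilityMeasure ν] [IsProbabilityMeasure μ] (hμ : MemLp id 2 μ) (h0 : ∫ e, e ∂μ = 0)
    {d K₀ p k₀ M V κ R : ℝ} (hd : 0 < d) (hK₀ : 0 < K₀) (hp : 0 < p) (hk₀ : 0 < k₀) (hM : 0 < M)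
    (hκ : 0 < κ) (hV : ∫ e, e ^ 2 ∂μ ≤ V)
    (hd1 : d / 2 ≤ |θ.2.1 - θ.1|) (hd2 : |θ.2.1 - θ.1| ≤ 2 * d)
    (h192 : 192 * (K₀ * √(n : ℝ)) ≤ p / 2 * n * |θ.2.1 - θ.1|)
    (hpa : p ≤ ν.real (Iic a)) (hpb : p ≤ ν.real (Ioi b))
    (hκl : κ * (M / n) ≤ ν.real (Ioc (θ.2.2 - M / n) θ.2.2))
    (hκr : κ * (M / n) ≤ ν.real (Ioc θ.2.2 (θ.2.2 + M / n)))
    (hMk : k₀ + 160 * K₀ ^ 2 / (p * d ^ 2) < κ * M / 2)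
    (hR0 : 0 ≤ R) (hRM : M + 1 ≤ R)
    (hR : 32 * K₀ ^ 2 / p + d ^ 2 / 2 * (k₀ + 80 * K₀ ^ 2 / (p * d ^ 2)) ≤ p / 4 * R ^ 2) :
    (Measure.pi fun _ : Fin n => modelLaw θ ν μ) {x | R < ‖root n (T n x) θ‖} ≤
      ENNReal.ofReal (V / K₀ ^ 2) +
      (ENNReal.ofReal (4 / (n * p)) + ENNReal.ofReal (4 / (n * p))) +
      (ENNReal.ofReal (V / ((d / 20) ^ 2 * k₀)) + ENNReal.ofReal (V / ((d / 20) ^ 2 * k₀))) +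
      (ENNReal.ofReal (4 / (κ * M)) + ENNReal.ofReal (4 / (κ * M))) := by
  have hn' : (0 : ℝ) < n := by exact_mod_cast hn
  set Φ : (Fin n → ℝ) × (Fin n → ℝ) → Fin n → Obs :=
    fun p j => ((regFn θ (p.1 j) + p.2 j, p.1 j) : Obs) with hΦ
  have hΦm : Measurable Φ := by
    refine measurable_pi_lambda _ fun j => ?_
    have : Measurable fun p : (Fin n → ℝ) × (Fin n → ℝ) => (p.1 j, p.2 j) := by fun_prop
    exact (measurable_modelMap θ).comp this
  have hBm : MeasurableSet {x : Fin n → Obs | R < ‖root n (T n x) θ‖} := by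
    refine measurableSet_lt measurable_const (Measurable.norm ?_)
    exact (measurable_root n).comp ((hT.measurable n hn).prodMk measurable_const)
  rw [pi_modelLaw_eq_map, Measure.map_apply hΦm hBm]
  set ρ := (Measure.pi fun _ : Fin n => ν).prod (Measure.pi fun _ : Fin n => μ) with hρ
  have hsm : ∀ (s : Finset (Fin n)) (c : ℝ), MeasurableSet {e : Fin n → ℝ | c ≤ |∑ j ∈ s, e j|} :=
    fun s c => measurableSet_le measurable_const
      (Finset.measurable_sum s fun j _ => measurable_pi_apply j).abs
  set E₁ : Set ((Fin n → ℝ) × (Fin n → ℝ)) := {p | ∃ s ∈ lowerFamily univ id p.1,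
    p.2 ∈ {e : Fin n → ℝ | K₀ * √(n : ℝ) ≤ |∑ j ∈ s, e j|}} with hE₁
  set E₂ : Set (ℝ) → ℝ → Set ((Fin n → ℝ) × (Fin n → ℝ)) := fun S q =>
    {p | p.1 ∈ {z | (({j | z j ∈ S} : Set (Fin n)).ncard : ℝ) < q / 2 * n}} with hE₂
  set E₃ : Set ℝ → (ℝ → ℝ) → Set ((Fin n → ℝ) × (Fin n → ℝ)) := fun m k =>
    {p | ∃ s ∈ lowerFamily m k p.1,
      p.2 ∈ {e : Fin n → ℝ | d / 20 * (k₀ + s.card) ≤ |∑ j ∈ s, e j|}} with hE₃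
  have b₁ : ρ E₁ ≤ ENNReal.ofReal (V / K₀ ^ 2) := by
    refine prod_measure_exists_lowerFamily_le _ _ MeasurableSet.univ measurable_id
      (fun s => hsm s _) fun C hC => ?_
    refine (measure_exists_chain_abs_sum_ge μ hμ h0 C hC (by positivity)).trans
      (ENNReal.ofReal_le_ofReal ?_)
    rw [mul_pow, Real.sq_sqrt hn'.le, mul_comm (K₀ ^ 2), mul_div_mul_left _ _ hn'.ne']
    gcongr
  have b₂ : ∀ S : Set ℝ, MeasurableSet S → ∀ q : ℝ, 0 < q → q ≤ ν.real S →
      ρ (E₂ S q) ≤ ENNReal.ofReal (4 / (n * q)) := fun S hS q hq hqS =>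
    prod_preimage_fst_le _ _ (measure_card_mem_lt_le ν hS hn hq hqS)
  have b₃ : ∀ (m : Set ℝ) (k : ℝ → ℝ), MeasurableSet m → Measurable k →
      ρ (E₃ m k) ≤ ENNReal.ofReal (V / ((d / 20) ^ 2 * k₀)) := by
    intro m k hm hk
    refine prod_measure_exists_lowerFamily_le _ _ hm hk (fun s => hsm s _) fun C hC => ?_
    refine (measure_exists_chain_abs_sum_ge_linear μ hμ h0 C hC (by positivity) hk₀).trans
      (ENNReal.ofReal_le_ofReal ?_)
    gcongr
  have hκM : (n : ℝ) * (κ * (M / n)) = κ * M := by field_simp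
  have b₄ := b₂ _ measurableSet_Ioc (κ * (M / n)) (by positivity) hκl
  have b₅ := b₂ _ measurableSet_Ioc (κ * (M / n)) (by positivity) hκr
  rw [hκM] at b₄ b₅
  -- Off seven bad events the deterministic bound applies: a large half-line sum, too few covariates
  -- beyond `a` or `b`, excessive growth on one side, or too few covariates in one of the two short
  -- windows.
  have hsub : Φ ⁻¹' {x | R < ‖root n (T n x) θ‖} ⊆
      E₁ ∪ (E₂ (Iic a) p ∪ E₂ (Ioi b) p) ∪ (E₃ (Iic θ.2.2) Neg.neg ∪ E₃ (Ioi θ.2.2) id) ∪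
      (E₂ (Ioc (θ.2.2 - M / n) θ.2.2) (κ * (M / n)) ∪
        E₂ (Ioc θ.2.2 (θ.2.2 + M / n)) (κ * (M / n))) := by
    intro w hw
    by_contra hnot
    simp only [mem_union, not_or] at hnot
    obtain ⟨⟨⟨n₁, n₂, n₃⟩, n₄, n₅⟩, n₆, n₇⟩ := hnot
    have hres : ∀ j, resid θ (Φ w j) = w.2 j := fun j => by simp [hΦ, resid]
    have hz : (fun j => (Φ w j).2) = w.1 := rfl
    have hcard : ∀ (s : Finset (Fin n)) (S : Set ℝ), (∀ j, j ∈ s ↔ w.1 j ∈ S) →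
        (s.card : ℝ) = (({j | w.1 j ∈ S} : Set (Fin n)).ncard : ℝ) := by
      intro s S hs
      rw [← Set.ncard_coe_finset]
      congr 2
      ext j
      simp [hs]
    have hκM' : κ * (M / n) / 2 * n = κ * M / 2 := by field_simp
    simp only [hE₁, hE₂, hE₃, mem_ofPred_eq, not_exists, not_and, not_lt, not_le] at n₁ n₂ n₃ n₄ n₅ n₆ n₇
    rw [hκM'] at n₆ n₇
    have hbound := rescaled_error_bound hn hθ (hT.sargmax n hn (Φ w)).1 hd hK₀ hp hk₀ hM.le hd1 hd2
      h192 ?_ ?_ ?_ ?_ ?_ ?_ ?_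
    · obtain ⟨h1, h2⟩ := hbound
      have h3 := h2.trans hR
      have key : ∀ u v : ℝ, p / 4 * (u ^ 2 + v ^ 2) ≤ p / 4 * R ^ 2 → u ≤ R ∧ v ≤ R := by
        intro u v huv
        have := le_of_mul_le_mul_left huv (by positivity)
        exact ⟨(le_abs_self u).trans (abs_le_of_sq_le_sq (by linarith [sq_nonneg v]) hR0),
          (le_abs_self v).trans (abs_le_of_sq_le_sq (by linarith [sq_nonneg u]) hR0)⟩
      obtain ⟨h4, h5⟩ := key _ _ h3
      exact absurd (norm_root_le h4 h5 (h1.trans hRM)) (not_le.2 hw)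
    · simp only [hres, hz]
      exact fun s hs => (n₁ s hs).le
    · rw [hz, hcard _ (Iic a) fun j => by simp [idxLE]]; exact n₂
    · rw [hz, hcard _ (Ioi b) fun j => by simp [idxGT]]; exact n₃
    · simp only [hres, hz]
      exact fun s hs => (n₄ s hs).le
    · simp only [hres, hz]
      exact fun s hs => (n₅ s hs).le
    · rw [hz, hcard _ (Ioc (θ.2.2 - M / n) θ.2.2) fun j => by simp [idxIoc]]
      exact hMk.trans_le n₆
    · rw [hz, hcard _ (Ioc θ.2.2 (θ.2.2 + M / n)) fun j => by simp [idxIoc]]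
      exact hMk.trans_le n₇
  refine (measure_mono hsub).trans ?_
  refine (measure_union_le _ _).trans (add_le_add ?_ ?_)
  · refine (measure_union_le _ _).trans (add_le_add ?_ ?_)
    · refine (measure_union_le _ _).trans (add_le_add b₁ ?_)
      exact (measure_union_le _ _).trans (add_le_add (b₂ _ measurableSet_Iic p hp hpa)
        (b₂ _ measurableSet_Ioi p hp hpb))
    · exact (measure_union_le _ _).trans (add_le_add (b₃ _ _ measurableSet_Iic measurable_neg)
        (b₃ _ _ measurableSet_Ioi measurable_id))
  · exact (measure_union_le _ _).trans (add_le_add b₄ b₅)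

/-- The rescaled estimation errors are asymptotically tight under convergent model laws. -/
theorem eventually_measure_norm_root_gt_le {a b : ℝ} {T : (n : ℕ) → (Fin n → Obs) → Param}
    (hT : IsLSE a b T) {θ : ℕ → Param} {θ₀ : Param} (hne : θ₀.1 ≠ θ₀.2.1)
    (hθmem : ∀ n, 1 ≤ n → θ n ∈ Theta a b) (hθ : Tendsto θ atTop (𝓝 θ₀))
    {ν μ : ℕ → Measure ℝ} {μ₀ : Measure ℝ} (hν : ∀ n, 1 ≤ n → IsProbabilityMeasure (ν n))
    (hμ : MomentConv μ μ₀) {p : ℝ} (hp : 0 < p) (hpa : ∀ᶠ n in atTop, p ≤ (ν n).real (Iic a))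
    (hpb : ∀ᶠ n in atTop, p ≤ (ν n).real (Ioi b)) {κ r : ℝ} (hκ : 0 < κ) (hr : 0 < r)
    (hlow : ∀ᶠ n in atTop, ∀ s t, |s - θ₀.2.2| ≤ r → |t - θ₀.2.2| ≤ r → s ≤ t →
      κ * (t - s) ≤ (ν n).real (Ioc s t)) {ε : ℝ} (hε : 0 < ε) :
    ∃ R : ℝ, ∀ᶠ n in atTop, (Measure.pi fun _ : Fin n => modelLaw (θ n) (ν n) (μ n))
      {x | R < ‖root n (T n x) (θ n)‖} ≤ ENNReal.ofReal ε := by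
  set d := |θ₀.2.1 - θ₀.1| with hd
  have hd0 : 0 < d := abs_pos.2 (sub_ne_zero.2 hne.symm)
  set V := ∫ e, e ^ 2 ∂μ₀ + 1 with hV
  have hV0 : 0 < V := by
    have : 0 ≤ ∫ e, e ^ 2 ∂μ₀ := integral_nonneg fun _ => sq_nonneg _
    linarith
  -- The constants make each of the seven terms at most `ε / 8`. In `M`, the first summand controls
  -- the counts in the short windows and the second puts `κ * M / 2` above the count threshold; `R`
  -- then dominates both `M + 1` and the level bound `U`.
  set K₀ := √(8 * V / ε) with hK₀
  have hK₀0 : 0 < K₀ := Real.sqrt_pos.2 (by positivity)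
  have hK₀2 : V / K₀ ^ 2 = ε / 8 := by
    rw [hK₀, Real.sq_sqrt (by positivity)]; field_simp
  set k₀ := 8 * V / (ε * (d / 20) ^ 2) with hk₀
  have hk₀0 : 0 < k₀ := by positivity
  have hk₀2 : V / ((d / 20) ^ 2 * k₀) = ε / 8 := by rw [hk₀]; field_simp
  set M := 32 / (κ * ε) + 2 * (k₀ + 160 * K₀ ^ 2 / (p * d ^ 2)) / κ + 1 / κ with hM
  have hM0 : 0 < M := by positivity
  have hκM : κ * M = 32 / ε + 2 * (k₀ + 160 * K₀ ^ 2 / (p * d ^ 2)) + 1 := by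
    rw [hM]; field_simp
  have hM4 : 4 / (κ * M) ≤ ε / 8 := by
    have h1 : 32 / ε ≤ κ * M := by
      rw [hκM]
      have : 0 ≤ 2 * (k₀ + 160 * K₀ ^ 2 / (p * d ^ 2)) := by positivity
      linarith
    calc 4 / (κ * M) ≤ 4 / (32 / ε) := by gcongr
      _ = ε / 8 := by field_simp; norm_num
  have hMk : k₀ + 160 * K₀ ^ 2 / (p * d ^ 2) < κ * M / 2 := by
    rw [hκM]
    have : 0 < 32 / ε := by positivity
    linarith
  set U := 32 * K₀ ^ 2 / p + d ^ 2 / 2 * (k₀ + 80 * K₀ ^ 2 / (p * d ^ 2)) with hU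
  have hU0 : 0 < U := by positivity
  set R := M + 1 + √(4 * U / p) with hR
  have hR0 : 0 ≤ R := by positivity
  have hRU : U ≤ p / 4 * R ^ 2 := by
    have h1 : √(4 * U / p) ^ 2 ≤ R ^ 2 := by
      gcongr
      rw [hR]; linarith
    rw [Real.sq_sqrt (by positivity)] at h1
    calc U = p / 4 * (4 * U / p) := by field_simp
      _ ≤ _ := by gcongr
  have hDlim : Tendsto (fun n => |(θ n).2.1 - (θ n).1|) atTop (𝓝 d) := by
    have hc : Continuous fun t : Param => |t.2.1 - t.1| := by fun_prop
    exact hc.continuousAt.tendsto.comp hθ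
  have hζ : Tendsto (fun n => (θ n).2.2) atTop (𝓝 θ₀.2.2) :=
    (continuous_snd.comp continuous_snd).continuousAt.tendsto.comp hθ
  have hnat : Tendsto (fun n : ℕ => (n : ℝ)) atTop atTop := tendsto_natCast_atTop_atTop
  have hsqrt : Tendsto (fun n : ℕ => √(n : ℝ)) atTop atTop :=
    Real.tendsto_sqrt_atTop.comp hnat
  refine ⟨R, ?_⟩
  filter_upwards [eventually_ge_atTop 1, hpa, hpb, hlow,
    hDlim.eventually (lt_mem_nhds (half_lt_self hd0)),
    hDlim.eventually (gt_mem_nhds (show d < 2 * d by linarith)),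
    hμ.sq.eventually (gt_mem_nhds (show ∫ e, e ^ 2 ∂μ₀ < V by linarith)),
    Metric.tendsto_nhds.1 hζ (r / 2) (by positivity),
    hnat.eventually_ge_atTop (2 * M / r), hnat.eventually_ge_atTop (32 / (ε * p)),
    hsqrt.eventually_ge_atTop (192 * K₀ * 4 / (p * d))]
    with n hn hpan hpbn hlown hd1 hd2 hVn hζn hnM hnp hns
  have hn' : (0 : ℝ) < n := by exact_mod_cast hn
  have := hν n hn
  have := hμ.prob n hn
  have hMn : M / n ≤ r / 2 := by
    rw [div_le_iff₀ hn']
    rw [div_le_iff₀ hr] at hnM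
    linarith
  have hMn0 : 0 ≤ M / n := by positivity
  rw [Real.dist_eq] at hζn
  have hζn' := abs_lt.1 hζn
  have hnp' : 4 / (n * p) ≤ ε / 8 := by
    calc 4 / (n * p) ≤ 4 / (32 / (ε * p) * p) := by gcongr
      _ = ε / 8 := by field_simp; norm_num
  have h192 : 192 * (K₀ * √(n : ℝ)) ≤ p / 2 * n * |(θ n).2.1 - (θ n).1| := by
    rw [div_le_iff₀ (by positivity)] at hns
    calc 192 * (K₀ * √(n : ℝ)) = (192 * K₀ * 4) * √(n : ℝ) / 4 := by ring
      _ ≤ (√(n : ℝ) * (p * d)) * √(n : ℝ) / 4 := by gcongr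
      _ = p / 2 * (√(n : ℝ) ^ 2) * (d / 2) := by ring
      _ = p / 2 * n * (d / 2) := by rw [Real.sq_sqrt hn'.le]
      _ ≤ _ := by gcongr
  have hκl : κ * (M / n) ≤ (ν n).real (Ioc ((θ n).2.2 - M / n) (θ n).2.2) := by
    have := hlown ((θ n).2.2 - M / n) (θ n).2.2 (abs_le.2 ⟨by linarith, by linarith⟩)
      (by linarith) (by linarith)
    rwa [sub_sub_cancel] at this
  have hκr : κ * (M / n) ≤ (ν n).real (Ioc (θ n).2.2 ((θ n).2.2 + M / n)) := by
    have := hlown (θ n).2.2 ((θ n).2.2 + M / n) (by linarith)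
      (abs_le.2 ⟨by linarith, by linarith⟩) (by linarith)
    rwa [add_sub_cancel_left] at this
  refine (measure_norm_root_gt_le hT hn (hθmem n hn) (hμ.memLp n hn) (hμ.mean n hn) hd0 hK₀0 hp
    hk₀0 hM0 hκ hVn.le hd1.le hd2.le h192 hpan hpbn hκl hκr hMk hR0 (by
      have := Real.sqrt_nonneg (4 * U / p)
      linarith) hRU).trans ?_
  rw [hK₀2, hk₀2]
  have e8 : (0 : ℝ) ≤ ε / 8 := by positivity
  calc _ ≤ ENNReal.ofReal (ε / 8) + (ENNReal.ofReal (ε / 8) + ENNReal.ofReal (ε / 8)) +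
        (ENNReal.ofReal (ε / 8) + ENNReal.ofReal (ε / 8)) +
        (ENNReal.ofReal (ε / 8) + ENNReal.ofReal (ε / 8)) := by gcongr
    _ ≤ ENNReal.ofReal ε := by
        rw [← ENNReal.ofReal_add e8 e8, ← ENNReal.ofReal_add e8 (by positivity),
          ← ENNReal.ofReal_add (by positivity) (by positivity),
          ← ENNReal.ofReal_add (by positivity) (by positivity)]
        exact ENNReal.ofReal_le_ofReal (by linarith)

/-! ### Almost sure regularity of the data -/

/-- Strong law of large numbers for functions of an i.i.d. sample. -/
lemma ae_tendsto_mean {Ω : Type*} [MeasurableSpace Ω] {Pr : Measure Ω} [IsProbabilityMeasure Pr]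
    {P : Measure Obs} {X : ℕ → Ω → Obs} (hX : ∀ i, Measurable (X i))
    (hXlaw : ∀ i, Pr.map (X i) = P) (hXindep : iIndepFun X Pr) {φ : Obs → ℝ} (hφ : Measurable φ)
    (hint : Integrable φ P) :
    ∀ᵐ ω ∂Pr, Tendsto (fun n : ℕ => (∑ j : Fin n, φ (X j ω)) / n) atTop (𝓝 (∫ x, φ x ∂P)) := by
  have hident : ∀ i, IdentDistrib (fun ω => φ (X i ω)) (fun ω => φ (X 0 ω)) Pr Pr := fun i =>
    (IdentDistrib.mk (hX i).aemeasurable (hX 0).aemeasurable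
      ((hXlaw i).trans (hXlaw 0).symm)).comp hφ
  have h := strong_law_ae_real (fun i ω => φ (X i ω)) (μ := Pr)
    (by
      rw [← hXlaw 0] at hint
      exact hint.comp_measurable (hX 0))
    (fun i j hij => (hXindep.indepFun hij).comp hφ hφ) hident
  have hmean : ∫ ω, φ (X 0 ω) ∂Pr = ∫ x, φ x ∂P := by
    rw [← hXlaw 0, integral_map (hX 0).aemeasurable hφ.aestronglyMeasurable]
  filter_upwards [h] with ω hω
  rw [← hmean]
  refine hω.congr fun n => ?_
  rw [Finset.sum_range]

/-- Monotone functions converging at the rationals to a continuous function converge uniformly on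
compact intervals. -/
lemma tendstoUniformlyOn_Icc_of_monotone {F : ℕ → ℝ → ℝ} {G : ℝ → ℝ} (hF : ∀ n, Monotone (F n))
    (hG : Continuous G) (h : ∀ q : ℚ, Tendsto (fun n => F n q) atTop (𝓝 (G q))) (a b : ℝ) :
    TendstoUniformlyOn F G atTop (Icc a b) := by
  refine (tendstoLocallyUniformlyOn_iff_tendstoUniformlyOn_of_compact isCompact_Icc).1 ?_
  refine Metric.tendstoLocallyUniformlyOn_iff.2 fun ε hε t _ => ?_
  obtain ⟨δ, hδ, hδε⟩ := Metric.continuous_iff.1 hG t (ε / 4) (by positivity)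
  obtain ⟨q₁, hq₁, hq₁'⟩ := exists_rat_btwn (show t - δ < t by linarith)
  obtain ⟨q₂, hq₂, hq₂'⟩ := exists_rat_btwn (show t < t + δ by linarith)
  refine ⟨Ioo q₁ q₂, mem_nhdsWithin_of_mem_nhds (Ioo_mem_nhds hq₁' hq₂), ?_⟩
  filter_upwards [Metric.tendsto_nhds.1 (h q₁) (ε / 4) (by positivity),
    Metric.tendsto_nhds.1 (h q₂) (ε / 4) (by positivity)] with n h1 h2 s hs
  have g1 := hδε q₁ (by rw [Real.dist_eq, abs_lt]; constructor <;> linarith)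
  have g2 := hδε q₂ (by rw [Real.dist_eq, abs_lt]; constructor <;> linarith)
  have g3 := hδε s (by rw [Real.dist_eq, abs_lt]; constructor <;> linarith [hs.1, hs.2])
  have m1 := hF n hs.1.le
  have m2 := hF n hs.2.le
  rw [Real.dist_eq, abs_lt] at *
  constructor <;> linarith [h1.1, h1.2, h2.1, h2.2, g1.1, g1.2, g2.1, g2.2, g3.1, g3.2]

/-- Equi-Lipschitz functions converging at the rationals to a Lipschitz function converge uniformly
on compact intervals. -/
lemma tendstoUniformlyOn_Icc_of_lipschitz {F : ℕ → ℝ → ℝ} {G : ℝ → ℝ}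
    (hF : ∀ᶠ n in atTop, ∀ s t, |F n s - F n t| ≤ |s - t|) (hG : ∀ s t, |G s - G t| ≤ |s - t|)
    (h : ∀ q : ℚ, Tendsto (fun n => F n q) atTop (𝓝 (G q))) (a b : ℝ) :
    TendstoUniformlyOn F G atTop (Icc a b) := by
  refine (tendstoLocallyUniformlyOn_iff_tendstoUniformlyOn_of_compact isCompact_Icc).1 ?_
  refine Metric.tendstoLocallyUniformlyOn_iff.2 fun ε hε t _ => ?_
  obtain ⟨q, hq, hq'⟩ := exists_rat_btwn (show t < t + ε / 4 by linarith)
  refine ⟨Ioo (q - ε / 4) (q + ε / 4), mem_nhdsWithin_of_mem_nhds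
    (Ioo_mem_nhds (by linarith) (by linarith)), ?_⟩
  filter_upwards [Metric.tendsto_nhds.1 (h q) (ε / 4) (by positivity), hF] with n h1 h2 s hs
  have g1 := h2 s q
  have g2 := hG s q
  have g3 : |s - q| < ε / 4 := by rw [abs_lt]; constructor <;> linarith [hs.1, hs.2]
  have g1' := abs_le.1 (g1.trans g3.le)
  have g2' := abs_le.1 (g2.trans g3.le)
  rw [Real.dist_eq, abs_lt] at *
  constructor <;> linarith [h1.1, h1.2, g1'.1, g1'.2, g2'.1, g2'.2]

/-- Dominated convergence: the integrand is continuous at `t` except on the null event that the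
covariate equals `t`. -/
lemma continuous_integral_indicator_le {P : Measure Obs} [IsFiniteMeasure P]
    (hP : ∀ t : ℝ, P {x | x.2 = t} = 0) {φ : Obs → ℝ} (hφ : Measurable φ) (hint : Integrable φ P) :
    Continuous fun t : ℝ => ∫ x, (if x.2 ≤ t then φ x else 0) ∂P := by
  refine continuous_iff_continuousAt.2 fun t => ?_
  refine continuousAt_of_dominated (bound := fun x => |φ x|) (Eventually.of_forall fun s => ?_)
    (Eventually.of_forall fun s => Eventually.of_forall fun x => ?_) hint.abs ?_
  · exact (Measurable.ite (measurable_snd measurableSet_Iic) hφ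
      measurable_const).aestronglyMeasurable
  · split_ifs <;> simp
  · have : ∀ᵐ x ∂P, x.2 ≠ t := by
      rw [ae_iff]; simpa using hP t
    filter_upwards [this] with x hx
    rcases lt_or_gt_of_ne hx with h | h
    · refine (continuousAt_const (y := φ x)).congr ?_
      filter_upwards [lt_mem_nhds h] with s hs
      rw [if_pos hs.le]
    · refine (continuousAt_const (y := (0 : ℝ))).congr ?_
      filter_upwards [gt_mem_nhds h] with s hs
      rw [if_neg (not_le.2 hs)]

/-- A Glivenko–Cantelli theorem for the weighted half-line indicators. -/
lemma ae_tendstoUniformlyOn_mean_le {Ω : Type*} [MeasurableSpace Ω] {Pr : Measure Ω}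
    [IsProbabilityMeasure Pr] {P : Measure Obs} [IsFiniteMeasure P] {X : ℕ → Ω → Obs}
    (hX : ∀ i, Measurable (X i)) (hXlaw : ∀ i, Pr.map (X i) = P) (hXindep : iIndepFun X Pr)
    (hP : ∀ t : ℝ, P {x | x.2 = t} = 0) {φ : Obs → ℝ} (hφ : Measurable φ) (hφ0 : ∀ x, 0 ≤ φ x)
    (hint : Integrable φ P) (a b : ℝ) :
    ∀ᵐ ω ∂Pr, TendstoUniformlyOn
      (fun (n : ℕ) t => (∑ j : Fin n, if (X j ω).2 ≤ t then φ (X j ω) else 0) / n)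
      (fun t => ∫ x, (if x.2 ≤ t then φ x else 0) ∂P) atTop (Icc a b) := by
  have hm : ∀ t : ℝ, Measurable fun x : Obs => if x.2 ≤ t then φ x else 0 := fun t =>
    Measurable.ite (measurable_snd measurableSet_Iic) hφ measurable_const
  have h : ∀ᵐ ω ∂Pr, ∀ q : ℚ, Tendsto (fun n : ℕ =>
      (∑ j : Fin n, if (X j ω).2 ≤ (q : ℝ) then φ (X j ω) else 0) / n) atTop
      (𝓝 (∫ x, (if x.2 ≤ (q : ℝ) then φ x else 0) ∂P)) := by
    rw [ae_all_iff]
    intro q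
    refine ae_tendsto_mean hX hXlaw hXindep (hm q) (hint.mono (hm q).aestronglyMeasurable
      (Eventually.of_forall fun x => ?_))
    split_ifs <;> simp
  filter_upwards [h] with ω hω
  refine tendstoUniformlyOn_Icc_of_monotone (fun n s t hst => ?_)
    (continuous_integral_indicator_le hP hφ hint) hω a b
  gcongr with j
  split_ifs with h1 h2 h2
  · exact le_rfl
  · exact absurd (h1.trans hst) h2
  · exact hφ0 _
  · exact le_rfl

/-- The asymptotic regularity of the data sequence that holds almost surely. -/
structure RegularData (a b : ℝ) (θ₀ : Param) (P : Measure Obs) (x : ℕ → Obs) : Prop where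
  sum_le : ∀ κ > 0, ∀ᶠ n : ℕ in atTop, ∀ t ∈ Icc a b,
    |∑ j ∈ idxLE (fun j : Fin n => (x j).2) t, resid θ₀ (x j)| ≤ κ * n
  mean : Tendsto (fun n : ℕ => (∑ j : Fin n, resid θ₀ (x j)) / n) atTop (𝓝 0)
  sq : Tendsto (fun n : ℕ => (∑ j : Fin n, resid θ₀ (x j) ^ 2) / n) atTop
    (𝓝 (∫ y, resid θ₀ y ^ 2 ∂P))
  abs_shift : ∀ q : ℚ, Tendsto (fun n : ℕ => (∑ j : Fin n, |(q : ℝ) + resid θ₀ (x j)|) / n) atTop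
    (𝓝 (∫ y, |(q : ℝ) + resid θ₀ y| ∂P))
  left : Tendsto (fun n : ℕ => ((idxLE (fun j : Fin n => (x j).2) a).card : ℝ) / n) atTop
    (𝓝 (P.real {y | y.2 ≤ a}))
  right : Tendsto (fun n : ℕ => ((idxGT (fun j : Fin n => (x j).2) b).card : ℝ) / n) atTop
    (𝓝 (P.real {y | b < y.2}))
  window_left : ∀ k : ℕ, Tendsto (fun n : ℕ => ((idxIoc (fun j : Fin n => (x j).2)
    (θ₀.2.2 - 1 / (k + 1)) θ₀.2.2).card : ℝ) / n) atTop
    (𝓝 (P.real {y | θ₀.2.2 - 1 / (k + 1) < y.2 ∧ y.2 ≤ θ₀.2.2}))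
  window_right : ∀ k : ℕ, Tendsto (fun n : ℕ => ((idxIoc (fun j : Fin n => (x j).2)
    θ₀.2.2 (θ₀.2.2 + 1 / (k + 1))).card : ℝ) / n) atTop
    (𝓝 (P.real {y | θ₀.2.2 < y.2 ∧ y.2 ≤ θ₀.2.2 + 1 / (k + 1)}))

lemma Model.measure_snd_eq {a b : ℝ} {f : ℝ → ℝ} {θ₀ : Param} {P : Measure Obs}
    (hP : Model a b f θ₀ P) (t : ℝ) : P {x | x.2 = t} = 0 := by
  have h : P.map Prod.snd {t} = 0 := by
    rw [hP.law_Z]; exact measure_singleton (μ := densMeasure f) t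
  rwa [Measure.map_apply measurable_snd (measurableSet_singleton t)] at h

lemma Model.memLp_two {a b : ℝ} {f : ℝ → ℝ} {θ₀ : Param} {P : Measure Obs}
    (hP : Model a b f θ₀ P) : MemLp (resid θ₀) 2 P := by
  have := hP.isProb
  exact hP.eps_moment.mono_exponent (by norm_num)

lemma Model.setIntegral_resid {a b : ℝ} {f : ℝ → ℝ} {θ₀ : Param} {P : Measure Obs}
    (hP : Model a b f θ₀ P) {S : Set ℝ} (hS : MeasurableSet S) :
    ∫ x in {x : Obs | x.2 ∈ S}, resid θ₀ x ∂P = 0 := by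
  have := hP.isProb
  have := hP.isDensity.isProbabilityMeasure
  have : IsProbabilityMeasure (P.map (resid θ₀)) :=
    Measure.isProbabilityMeasure_map (measurable_resid θ₀).aemeasurable
  conv_lhs => rw [hP.eq_modelLaw]
  refine setIntegral_resid_modelLaw _ _ _ ?_ hS
  rw [integral_map (measurable_resid θ₀).aemeasurable (by fun_prop)]
  exact hP.eps_mean

theorem Model.ae_regularData {a b : ℝ} {f : ℝ → ℝ} {θ₀ : Param} {P : Measure Obs}
    (hP : Model a b f θ₀ P) {Ω : Type*} [MeasurableSpace Ω] {Pr : Measure Ω}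
    [IsProbabilityMeasure Pr] {X : ℕ → Ω → Obs} (hX : ∀ i, Measurable (X i))
    (hXlaw : ∀ i, Pr.map (X i) = P) (hXindep : iIndepFun X Pr) :
    ∀ᵐ ω ∂Pr, RegularData a b θ₀ P (fun j => X j ω) := by
  have := hP.isProb
  have hL2 := hP.memLp_two
  have hi : Integrable (resid θ₀) P := hL2.integrable (by norm_num)
  have hm := measurable_resid θ₀
  have slln : ∀ {φ : Obs → ℝ}, Measurable φ → Integrable φ P → ∀ᵐ ω ∂Pr,
      Tendsto (fun n : ℕ => (∑ j : Fin n, φ (X j ω)) / n) atTop (𝓝 (∫ x, φ x ∂P)) :=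
    fun h1 h2 => ae_tendsto_mean hX hXlaw hXindep h1 h2
  have count : ∀ (p : Obs → Prop) [DecidablePred p], MeasurableSet {y | p y} → ∀ᵐ ω ∂Pr,
      Tendsto (fun n : ℕ => ((Finset.univ.filter fun j : Fin n => p (X j ω)).card : ℝ) / n) atTop
        (𝓝 (P.real {y | p y})) := by
    intro p _ hp
    have h1 := slln (φ := fun y => if p y then 1 else 0)
      (Measurable.ite hp measurable_const measurable_const)
      (((integrable_const (1 : ℝ)).indicator hp).congr (Eventually.of_forall fun y => by
        simp [indicator_apply]))
    have h2 : ∫ y, (if p y then (1 : ℝ) else 0) ∂P = P.real {y | p y} := by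
      rw [← integral_indicator_one hp]
      congr 1
      funext y
      simp [indicator_apply]
    rw [h2] at h1
    filter_upwards [h1] with ω hω
    simpa using hω
  -- The Glivenko–Cantelli argument needs functions monotone in `t`, so positive and negative parts
  -- of the error are treated separately.
  have hpos := ae_tendstoUniformlyOn_mean_le hX hXlaw hXindep hP.measure_snd_eq
    (φ := fun x => max (resid θ₀ x) 0) (hm.max measurable_const) (fun x => le_max_right _ _)
    hi.pos_part a b
  have hneg := ae_tendstoUniformlyOn_mean_le hX hXlaw hXindep hP.measure_snd_eq
    (φ := fun x => max (-resid θ₀ x) 0) (hm.neg.max measurable_const)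
    (fun x => le_max_right _ _) hi.neg_part a b
  -- Centering and independence of the covariate make the two limits equal, so they cancel in the
  -- error sums.
  have hzero : ∀ t : ℝ, ∫ x, (if x.2 ≤ t then max (resid θ₀ x) 0 else 0) ∂P =
      ∫ x, (if x.2 ≤ t then max (-resid θ₀ x) 0 else 0) ∂P := by
    intro t
    have hS : MeasurableSet {x : Obs | x.2 ∈ Iic t} := measurable_snd measurableSet_Iic
    have h1 : ∀ ψ : Obs → ℝ, (fun x : Obs => if x.2 ≤ t then ψ x else 0) =
        {x : Obs | x.2 ∈ Iic t}.indicator ψ := fun ψ => by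
      funext x; simp [indicator_apply]
    rw [h1, h1, integral_indicator hS, integral_indicator hS, ← sub_eq_zero,
      ← integral_sub hi.pos_part.integrableOn hi.neg_part.integrableOn]
    have h2 : ∀ x, max (resid θ₀ x) 0 - max (-resid θ₀ x) 0 = resid θ₀ x := fun x => by
      rcases le_total (resid θ₀ x) 0 with h | h
      · rw [max_eq_right h, max_eq_left (by linarith)]; ring
      · rw [max_eq_left h, max_eq_right (by linarith)]; ring
    simp_rw [h2]
    exact hP.setIntegral_resid measurableSet_Iic
  have hmean := slln hm hi
  rw [hP.eps_mean] at hmean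
  have hshift : ∀ᵐ ω ∂Pr, ∀ q : ℚ, Tendsto (fun n : ℕ =>
      (∑ j : Fin n, |(q : ℝ) + resid θ₀ (X j ω)|) / n) atTop
      (𝓝 (∫ y, |(q : ℝ) + resid θ₀ y| ∂P)) := by
    rw [ae_all_iff]
    exact fun q => slln (φ := fun y => |(q : ℝ) + resid θ₀ y|) (hm.const_add _).abs
      ((integrable_const _).add hi).abs
  have hwl := ae_all_iff.2 fun k : ℕ => count
    (fun y => θ₀.2.2 - 1 / (k + 1) < y.2 ∧ y.2 ≤ θ₀.2.2) (measurable_snd measurableSet_Ioc)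
  have hwr := ae_all_iff.2 fun k : ℕ => count
    (fun y => θ₀.2.2 < y.2 ∧ y.2 ≤ θ₀.2.2 + 1 / (k + 1)) (measurable_snd measurableSet_Ioc)
  filter_upwards [hpos, hneg, hmean, slln (hm.pow_const 2) hL2.integrable_sq, hshift,
    count (fun y => y.2 ≤ a) (measurable_snd measurableSet_Iic),
    count (fun y => b < y.2) (measurable_snd measurableSet_Ioi), hwl, hwr]
    with ω h1 h2 h3 h4 h5 h6 h7 h8 h9
  refine ⟨fun κ hκ => ?_, h3, h4, h5, h6, h7, h8, h9⟩
  filter_upwards [Metric.tendstoUniformlyOn_iff.1 h1 (κ / 2) (by positivity),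
    Metric.tendstoUniformlyOn_iff.1 h2 (κ / 2) (by positivity), eventually_ge_atTop 1]
    with n g1 g2 hn t ht
  have hn' : (0 : ℝ) < n := by exact_mod_cast hn
  have k1 := g1 t ht
  have k2 := g2 t ht
  rw [hzero, Real.dist_eq] at k1
  rw [Real.dist_eq] at k2
  have hsplit : ∑ j ∈ idxLE (fun j : Fin n => (X j ω).2) t, resid θ₀ (X j ω) =
      (∑ j : Fin n, if (X j ω).2 ≤ t then max (resid θ₀ (X j ω)) 0 else 0) -
      ∑ j : Fin n, if (X j ω).2 ≤ t then max (-resid θ₀ (X j ω)) 0 else 0 := by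
    rw [idxLE, Finset.sum_filter, ← Finset.sum_sub_distrib]
    refine Finset.sum_congr rfl fun j _ => ?_
    split_ifs
    · rcases le_total (resid θ₀ (X j ω)) 0 with h | h
      · rw [max_eq_right h, max_eq_left (by linarith)]; ring
      · rw [max_eq_left h, max_eq_right (by linarith)]; ring
    · simp
  rw [hsplit, ← div_le_iff₀ hn', ← abs_of_pos hn', ← abs_div, sub_div]
  rw [abs_lt] at k1 k2
  rw [abs_le]
  constructor <;> linarith [k1.1, k1.2, k2.1, k2.2]

/-! ### Strong consistency of the least squares estimator -/

/-- Masses of one-sided windows at the true change point are positive. -/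
lemma Model.window_pos {a b : ℝ} {f : ℝ → ℝ} {θ₀ : Param} {P : Measure Obs}
    (hP : Model a b f θ₀ P) {s t : ℝ} (hst : s < t) (hs : s ≤ θ₀.2.2) (ht : θ₀.2.2 ≤ t) :
    0 < P.real {y | s < y.2 ∧ y.2 ≤ t} := by
  have := hP.isProb
  obtain ⟨η, hη, κ, hκ, hf⟩ := hP.f_lower
  have h1 : P.real {y : Obs | s < y.2 ∧ y.2 ≤ t} = (densMeasure f).real (Ioc s t) := by
    rw [densMeasure, ← hP.law_Z, measureReal_def, measureReal_def,
      Measure.map_apply measurable_snd measurableSet_Ioc]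
    rfl
  rw [h1]
  set s' := max s (θ₀.2.2 - η)
  set t' := min t (θ₀.2.2 + η)
  have hs' : s' ≤ θ₀.2.2 := max_le hs (by linarith)
  have ht' : θ₀.2.2 ≤ t' := le_min ht (by linarith)
  have hst' : s' < t' := by
    refine max_lt (lt_min hst (by linarith)) (lt_min (by linarith) (by linarith))
  have hden := hP.isDensity
  have := hden.isProbabilityMeasure
  -- The linear lower bound is used with the constant sequence `f`, on the part of the window within
  -- `η` of `ζ₀`.
  have h2 := (eventually_linear_lower_bound (g := fun _ => f) (c := θ₀.2.2 - η) (d := θ₀.2.2 + η)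
    (fun _ _ => hden) hκ hf le_rfl le_rfl le_rfl
    (Metric.tendstoUniformlyOn_iff.2 fun ε hε => by simp [hε])).exists
  obtain ⟨-, h3⟩ := h2
  have h4 := h3 s' t' (abs_le.2 ⟨by linarith [le_max_right s (θ₀.2.2 - η)], by linarith⟩)
    (abs_le.2 ⟨by linarith, by linarith [min_le_right t (θ₀.2.2 + η)]⟩) hst'.le
  have h5 : (densMeasure f).real (Ioc s' t') ≤ (densMeasure f).real (Ioc s t) :=
    measureReal_mono (Ioc_subset_Ioc (le_max_left _ _) (min_le_left _ _))
  have h6 : 0 < κ / 2 * (t' - s') := mul_pos (by positivity) (by linarith)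
  linarith

lemma Model.left_pos {a b : ℝ} {f : ℝ → ℝ} {θ₀ : Param} {P : Measure Obs}
    (hP : Model a b f θ₀ P) : 0 < P.real {y | y.2 ≤ a} := by
  have := hP.isProb
  have h : P {y | y.2 < a} ≤ P {y | y.2 ≤ a} := by
    refine measure_mono fun y (hy : y.2 < a) => ?_
    exact hy.le
  exact ENNReal.toReal_pos (hP.mass_left.trans_le h).ne' (measure_ne_top _ _)

lemma Model.right_pos {a b : ℝ} {f : ℝ → ℝ} {θ₀ : Param} {P : Measure Obs}
    (hP : Model a b f θ₀ P) : 0 < P.real {y | b < y.2} := by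
  have := hP.isProb
  exact ENNReal.toReal_pos hP.mass_right.ne' (measure_ne_top _ _)

/-- Strong consistency of the least squares estimator along regular data. -/
theorem RegularData.tendsto_lse {a b : ℝ} {f : ℝ → ℝ} {θ₀ : Param} {P : Measure Obs}
    (hP : Model a b f θ₀ P) {x : ℕ → Obs} (hx : RegularData a b θ₀ P x)
    {T : (n : ℕ) → (Fin n → Obs) → Param} (hT : IsLSE a b T) :
    Tendsto (fun n => T n (fun j : Fin n => x j)) atTop (𝓝 θ₀) := by
  set d := |θ₀.2.1 - θ₀.1| with hd
  have hD : θ₀.2.1 - θ₀.1 ≠ 0 := sub_ne_zero.2 hP.alpha_ne_beta.symm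
  have hd0 : 0 < d := abs_pos.2 hD
  -- a positive lower bound for the outer counts
  obtain ⟨p, hp, hpl, hpr⟩ : ∃ p > 0, p < P.real {y | y.2 ≤ a} ∧ p < P.real {y | b < y.2} := by
    refine ⟨min (P.real {y | y.2 ≤ a}) (P.real {y | b < y.2}) / 2,
      half_pos (lt_min hP.left_pos hP.right_pos), ?_, ?_⟩
    · linarith [min_le_left (P.real {y | y.2 ≤ a}) (P.real {y | b < y.2}), hP.left_pos]
    · linarith [min_le_right (P.real {y | y.2 ≤ a}) (P.real {y | b < y.2}), hP.right_pos]
  refine Metric.tendsto_nhds.2 fun ε hε => ?_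
  obtain ⟨k, hk⟩ := exists_nat_one_div_lt (show 0 < ε / 2 by positivity)
  set w : ℝ := 1 / (k + 1) with hw
  have hw0 : 0 < w := by positivity
  obtain ⟨q, hq, hql, hqr⟩ : ∃ q > 0, q < P.real {y | θ₀.2.2 - w < y.2 ∧ y.2 ≤ θ₀.2.2} ∧
      q < P.real {y | θ₀.2.2 < y.2 ∧ y.2 ≤ θ₀.2.2 + w} := by
    have h1 := hP.window_pos (show θ₀.2.2 - w < θ₀.2.2 by linarith) (by linarith) le_rfl
    have h2 := hP.window_pos (show θ₀.2.2 < θ₀.2.2 + w by linarith) le_rfl (by linarith)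
    refine ⟨min (P.real {y | θ₀.2.2 - w < y.2 ∧ y.2 ≤ θ₀.2.2})
      (P.real {y | θ₀.2.2 < y.2 ∧ y.2 ≤ θ₀.2.2 + w}) / 2, half_pos (lt_min h1 h2), ?_, ?_⟩
    · linarith [min_le_left (P.real {y | θ₀.2.2 - w < y.2 ∧ y.2 ≤ θ₀.2.2})
        (P.real {y | θ₀.2.2 < y.2 ∧ y.2 ≤ θ₀.2.2 + w})]
    · linarith [min_le_right (P.real {y | θ₀.2.2 - w < y.2 ∧ y.2 ≤ θ₀.2.2})
        (P.real {y | θ₀.2.2 < y.2 ∧ y.2 ≤ θ₀.2.2 + w})]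
  -- the tolerance for the error sums
  obtain ⟨κ, hκ, hκ1, hκ2, hκ3⟩ : ∃ κ > 0, 192 * κ ≤ p * d ∧ 12 * κ * d / p < ε ^ 2 ∧
      5 * d * κ + 5 * κ ^ 2 / p < q * (9 / 16 * d ^ 2) := by
    have e1 : ∀ᶠ κ in 𝓝[>] (0 : ℝ), 192 * κ < p * d := by
      have : Tendsto (fun κ : ℝ => 192 * κ) (𝓝[>] 0) (𝓝 (192 * 0)) :=
        (Continuous.tendsto (by fun_prop) 0).mono_left nhdsWithin_le_nhds
      exact this.eventually (gt_mem_nhds (by rw [mul_zero]; positivity))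
    have e2 : ∀ᶠ κ in 𝓝[>] (0 : ℝ), 12 * κ * d / p < ε ^ 2 := by
      have : Tendsto (fun κ : ℝ => 12 * κ * d / p) (𝓝[>] 0) (𝓝 (12 * 0 * d / p)) :=
        (Continuous.tendsto (by fun_prop) 0).mono_left nhdsWithin_le_nhds
      exact this.eventually (gt_mem_nhds (by simp; positivity))
    have e3 : ∀ᶠ κ in 𝓝[>] (0 : ℝ), 5 * d * κ + 5 * κ ^ 2 / p < q * (9 / 16 * d ^ 2) := by
      have : Tendsto (fun κ : ℝ => 5 * d * κ + 5 * κ ^ 2 / p) (𝓝[>] 0)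
          (𝓝 (5 * d * 0 + 5 * 0 ^ 2 / p)) :=
        (Continuous.tendsto (by fun_prop) 0).mono_left nhdsWithin_le_nhds
      exact this.eventually (gt_mem_nhds (by simp; positivity))
    obtain ⟨κ, ⟨⟨h1, h2⟩, h3⟩, h4⟩ := (((e1.and e2).and e3).and self_mem_nhdsWithin).exists
    exact ⟨κ, h4, h1.le, h2, h3⟩
  filter_upwards [eventually_ge_atTop 1, hx.sum_le κ hκ,
    Metric.tendsto_nhds.1 hx.mean κ hκ, hx.left.eventually (lt_mem_nhds hpl),
    hx.right.eventually (lt_mem_nhds hpr), (hx.window_left k).eventually (lt_mem_nhds hql),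
    (hx.window_right k).eventually (lt_mem_nhds hqr)]
    with n hn hS hSt hl hr hwl hwr
  have hn' : (0 : ℝ) < n := by exact_mod_cast hn
  rw [lt_div_iff₀ hn'] at hl hr hwl hwr
  rw [Real.dist_eq, sub_zero, abs_div, abs_of_pos hn', div_lt_iff₀ hn'] at hSt
  set xs : Fin n → Obs := fun j => x j with hxs
  set z : Fin n → ℝ := fun j => (xs j).2 with hz
  set e : Fin n → ℝ := fun j => resid θ₀ (xs j) with he
  set θs := T n xs with hθs
  have hmax := (hT.sargmax n hn xs).1
  obtain ⟨ζ, hζ, hζs, hmin⟩ := hmax.exists_near hn (κ := ε / 2) (by positivity)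
  set θ' : Param := (θs.1, θs.2.1, ζ) with hθ'
  obtain ⟨C, hC, hbasic⟩ := exists_basic_inequality xs θ₀ θ' (hmin θ₀ hP.zeta_mem)
  set lo := min θ₀.2.2 θ'.2.2
  set hi := max θ₀.2.2 θ'.2.2
  have hlohi : lo ≤ hi := min_le_max
  have hlo : lo ∈ Icc a b := by
    rcases min_choice θ₀.2.2 θ'.2.2 with h | h <;> simp only [lo, h]
    · exact hP.zeta_mem
    · exact hζ
  have hhi : hi ∈ Icc a b := by
    rcases max_choice θ₀.2.2 θ'.2.2 with h | h <;> simp only [hi, h]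
    · exact hP.zeta_mem
    · exact hζ
  have hS₁ : |∑ j ∈ idxLE z lo, e j| ≤ κ * n := hS lo hlo
  have hS₁' : |∑ j ∈ idxLE z hi, e j| ≤ κ * n := hS hi hhi
  have hS₂ : |∑ j ∈ idxIoc z lo hi, e j| ≤ 2 * (κ * n) := by
    rw [sum_idxIoc_eq z e hlohi]
    exact (abs_sub _ _).trans (by linarith)
  have hS₃ : |∑ j ∈ idxGT z hi, e j| ≤ 2 * (κ * n) := by
    rw [sum_idxGT_eq z e hi]
    exact (abs_sub _ _).trans (by linarith)
  have hN₁ : p * n ≤ ((idxLE z lo).card : ℝ) :=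
    hl.le.trans (by exact_mod_cast card_idxLE_mono z hlo.1)
  have hN₃ : p * n ≤ ((idxGT z hi).card : ℝ) :=
    hr.le.trans (by exact_mod_cast card_idxGT_anti z hhi.2)
  have h192 : 192 * (κ * n) ≤ p * n * |θ₀.2.1 - θ₀.1| := by
    have := mul_le_mul_of_nonneg_right hκ1 hn'.le
    linarith
  obtain ⟨hAB, hN, -⟩ := bounds_of_basic_inequality hD hC (by positivity) hN₁
    (Nat.cast_nonneg _) hN₃ hS₁ hS₂ hS₃ h192 hbasic
  have hAB' : |θs.1 - θ₀.1| + |θs.2.1 - θ₀.2.1| < ε := by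
    refine lt_of_pow_lt_pow_left₀ 2 hε.le (lt_of_le_of_lt ?_ hκ2)
    rw [le_div_iff₀ hp]
    refine le_of_mul_le_mul_left ?_ hn'
    change p * n * (|θs.1 - θ₀.1| + |θs.2.1 - θ₀.2.1|) ^ 2 ≤ 12 * (κ * n) * d at hAB
    linarith
  have hN₂ : ((idxIoc z lo hi).card : ℝ) < q * n := by
    rw [← sq_abs (θ₀.2.1 - θ₀.1), ← hd] at hN
    have h1 : 5 / 2 * d * |∑ j ∈ idxIoc z lo hi, e j| ≤ 5 / 2 * d * (2 * (κ * n)) := by gcongr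
    have h2 : 5 * (κ * n) ^ 2 / (p * n) = 5 * κ ^ 2 / p * n := by field_simp
    have h3 := mul_lt_mul_of_pos_right hκ3 hn'
    have h4 : ((idxIoc z lo hi).card : ℝ) * (9 / 16 * d ^ 2) < q * n * (9 / 16 * d ^ 2) := by
      refine hN.trans_lt ?_
      rw [h2]
      linarith
    exact lt_of_mul_lt_mul_right h4 (by positivity)
  -- A window of width `w` on either side of `ζ₀` holds more than `q * n` covariates, so it cannot
  -- fit between the change points.
  have hclose : |ζ - θ₀.2.2| ≤ w := by
    rw [abs_le]
    constructor
    · by_contra hlt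
      push Not at hlt
      have h1 : lo = ζ := min_eq_right (by linarith : ζ ≤ θ₀.2.2)
      have h2 : hi = θ₀.2.2 := max_eq_left (by linarith : ζ ≤ θ₀.2.2)
      have h3 : ((idxIoc z (θ₀.2.2 - w) θ₀.2.2).card : ℝ) ≤ (idxIoc z lo hi).card := by
        rw [h1, h2]
        exact_mod_cast card_idxIoc_mono z (by linarith) le_rfl
      linarith
    · by_contra hlt
      push Not at hlt
      have h1 : lo = θ₀.2.2 := min_eq_left (by linarith : θ₀.2.2 ≤ ζ)
      have h2 : hi = ζ := max_eq_right (by linarith : θ₀.2.2 ≤ ζ)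
      have h3 : ((idxIoc z θ₀.2.2 (θ₀.2.2 + w)).card : ℝ) ≤ (idxIoc z lo hi).card := by
        rw [h1, h2]
        exact_mod_cast card_idxIoc_mono z le_rfl (by linarith)
      linarith
  rw [Prod.dist_eq, Prod.dist_eq, Real.dist_eq, Real.dist_eq, Real.dist_eq]
  refine max_lt ?_ (max_lt ?_ ?_)
  · linarith [abs_nonneg (θs.2.1 - θ₀.2.1)]
  · linarith [abs_nonneg (θs.1 - θ₀.1)]
  · have := abs_sub_le θs.2.2 ζ θ₀.2.2
    rw [abs_sub_comm] at hζs
    linarith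

/-! ### Moments of the centered residuals -/

/-- The mean squared deviation between the fitted and true regression functions vanishes. -/
lemma RegularData.tendsto_mean_sq_excess {a b : ℝ} {f : ℝ → ℝ} {θ₀ : Param} {P : Measure Obs}
    (hP : Model a b f θ₀ P) {x : ℕ → Obs} (hx : RegularData a b θ₀ P x)
    {θ : ℕ → Param} (hθ : Tendsto θ atTop (𝓝 θ₀)) :
    Tendsto (fun n : ℕ => (∑ j : Fin n, (regFn (θ n) (x j).2 - regFn θ₀ (x j).2) ^ 2) / n) atTop
      (𝓝 0) := by
  have := hP.isProb
  have hα : Tendsto (fun n => (θ n).1 - θ₀.1) atTop (𝓝 0) := by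
    have hc : Continuous fun t : Param => t.1 - θ₀.1 := by fun_prop
    simpa using! hc.continuousAt.tendsto.comp hθ
  have hβ : Tendsto (fun n => (θ n).2.1 - θ₀.2.1) atTop (𝓝 0) := by
    have hc : Continuous fun t : Param => t.2.1 - θ₀.2.1 := by fun_prop
    simpa using! hc.continuousAt.tendsto.comp hθ
  have hζ : Tendsto (fun n => (θ n).2.2) atTop (𝓝 θ₀.2.2) :=
    (continuous_snd.comp continuous_snd).continuousAt.tendsto.comp hθ
  set d := |θ₀.2.1 - θ₀.1| with hd
  set D := (2 + d) ^ 2 with hDdef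
  have hD : 0 < D := by positivity
  -- the mass of the windows around the true change point vanishes
  have hwin : ∀ ε > 0, ∃ k : ℕ, P.real {y | θ₀.2.2 - 1 / (k + 1) < y.2 ∧ y.2 ≤ θ₀.2.2} < ε ∧
      P.real {y | θ₀.2.2 < y.2 ∧ y.2 ≤ θ₀.2.2 + 1 / (k + 1)} < ε := by
    intro ε hε
    have h1 : Tendsto (fun k : ℕ => (densMeasure f) (Icc (θ₀.2.2 - 1 / ((k : ℝ) + 1))
        (θ₀.2.2 + 1 / ((k : ℝ) + 1)))) atTop (𝓝 0) := by
      have := hP.isDensity.isProbabilityMeasure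
      exact (tendsto_measure_Icc (densMeasure f) θ₀.2.2).comp
        tendsto_one_div_add_atTop_nhds_zero_nat
    obtain ⟨k, hk⟩ := (h1.eventually (gt_mem_nhds (ENNReal.ofReal_pos.2 hε))).exists
    have h2 : ∀ S : Set ℝ, S ⊆ Icc (θ₀.2.2 - 1 / ((k : ℝ) + 1)) (θ₀.2.2 + 1 / ((k : ℝ) + 1)) →
        MeasurableSet S → P.real {y | y.2 ∈ S} < ε := by
      intro S hS hSm
      have h3 : P {y | y.2 ∈ S} = densMeasure f S := by
        rw [densMeasure, ← hP.law_Z, Measure.map_apply measurable_snd hSm]; rfl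
      rw [measureReal_def, h3]
      exact (ENNReal.toReal_lt_of_lt_ofReal ((measure_mono hS).trans_lt hk))
    have hk0 : (0 : ℝ) ≤ 1 / ((k : ℝ) + 1) := by positivity
    refine ⟨k, h2 (Ioc (θ₀.2.2 - 1 / ((k : ℝ) + 1)) θ₀.2.2) ?_ measurableSet_Ioc,
      h2 (Ioc θ₀.2.2 (θ₀.2.2 + 1 / ((k : ℝ) + 1))) ?_ measurableSet_Ioc⟩
    · exact fun u hu => ⟨hu.1.le, hu.2.trans (by linarith)⟩
    · exact fun u hu => ⟨by linarith [hu.1], hu.2⟩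
  refine Metric.tendsto_nhds.2 fun ε hε => ?_
  obtain ⟨k, hkl, hkr⟩ := hwin (ε / (4 * D)) (by positivity)
  set w : ℝ := 1 / (k + 1) with hw
  have hw0 : 0 < w := by positivity
  have hAB : Tendsto (fun n => ((θ n).1 - θ₀.1) ^ 2 + ((θ n).2.1 - θ₀.2.1) ^ 2) atTop (𝓝 0) := by
    simpa using (hα.pow 2).add (hβ.pow 2)
  filter_upwards [eventually_ge_atTop 1, (hx.window_left k).eventually (gt_mem_nhds hkl),
    (hx.window_right k).eventually (gt_mem_nhds hkr), Metric.tendsto_nhds.1 hζ w hw0,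
    hAB.eventually (gt_mem_nhds (show 0 < ε / 2 by positivity)),
    Metric.tendsto_nhds.1 hα 1 one_pos, Metric.tendsto_nhds.1 hβ 1 one_pos]
    with n hn hwl hwr hζn hABn hA1 hB1
  have hn' : (0 : ℝ) < n := by exact_mod_cast hn
  rw [Real.dist_eq, sub_zero] at hA1 hB1
  rw [Real.dist_eq, abs_lt] at hζn
  rw [Real.dist_eq, sub_zero, abs_of_nonneg (by positivity), div_lt_iff₀ hn']
  rw [div_lt_iff₀ hn'] at hwl hwr
  set z : Fin n → ℝ := fun j => (x j).2 with hz
  -- Either both regression functions use corresponding levels, or the covariate lies within `w` of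
  -- `ζ₀`; in the latter case the square is at most `D`, and such covariates are rare.
  have hpt : ∀ j : Fin n, (regFn (θ n) (z j) - regFn θ₀ (z j)) ^ 2 ≤
      (((θ n).1 - θ₀.1) ^ 2 + ((θ n).2.1 - θ₀.2.1) ^ 2) +
      ((if θ₀.2.2 - w < z j ∧ z j ≤ θ₀.2.2 then D else 0) +
        if θ₀.2.2 < z j ∧ z j ≤ θ₀.2.2 + w then D else 0) := by
    intro j
    have hA0 := sq_nonneg ((θ n).1 - θ₀.1)
    have hB0 := sq_nonneg ((θ n).2.1 - θ₀.2.1)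
    have i1 : (0 : ℝ) ≤ if θ₀.2.2 - w < z j ∧ z j ≤ θ₀.2.2 then D else 0 := by
      split_ifs <;> positivity
    have i2 : (0 : ℝ) ≤ if θ₀.2.2 < z j ∧ z j ≤ θ₀.2.2 + w then D else 0 := by
      split_ifs <;> positivity
    by_cases h1 : z j ≤ (θ n).2.2 <;> by_cases h2 : z j ≤ θ₀.2.2
    · rw [show regFn (θ n) (z j) - regFn θ₀ (z j) = (θ n).1 - θ₀.1 by simp [regFn, h1, h2]]
      linarith
    · have hC : ((θ n).1 - θ₀.2.1) ^ 2 ≤ D := by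
        rw [← sq_abs, hDdef]
        gcongr
        have := abs_sub ((θ n).1 - θ₀.1) (θ₀.2.1 - θ₀.1)
        rw [sub_sub_sub_cancel_right] at this
        linarith
      have h3 : θ₀.2.2 < z j ∧ z j ≤ θ₀.2.2 + w := ⟨not_le.1 h2, by linarith [hζn.2]⟩
      rw [if_pos h3]
      rw [show regFn (θ n) (z j) - regFn θ₀ (z j) = (θ n).1 - θ₀.2.1 by simp [regFn, h1, h2]]
      linarith
    · have hC : ((θ n).2.1 - θ₀.1) ^ 2 ≤ D := by
        rw [← sq_abs, hDdef]
        gcongr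
        have := abs_add_le ((θ n).2.1 - θ₀.2.1) (θ₀.2.1 - θ₀.1)
        rw [sub_add_sub_cancel] at this
        linarith
      have h3 : θ₀.2.2 - w < z j ∧ z j ≤ θ₀.2.2 := ⟨by linarith [hζn.1, not_le.1 h1], h2⟩
      rw [if_pos h3]
      rw [show regFn (θ n) (z j) - regFn θ₀ (z j) = (θ n).2.1 - θ₀.1 by simp [regFn, h1, h2]]
      linarith
    · rw [show regFn (θ n) (z j) - regFn θ₀ (z j) = (θ n).2.1 - θ₀.2.1 by simp [regFn, h1, h2]]
      linarith
  refine (Finset.sum_le_sum fun j _ => hpt j).trans_lt ?_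
  generalize ((θ n).1 - θ₀.1) ^ 2 + ((θ n).2.1 - θ₀.2.1) ^ 2 = W at hABn ⊢
  rw [Finset.sum_add_distrib, Finset.sum_add_distrib, ← Finset.sum_filter, ← Finset.sum_filter]
  simp only [Finset.sum_const, Finset.card_univ, Fintype.card_fin, nsmul_eq_mul]
  change (n : ℝ) * _ + (((idxIoc z (θ₀.2.2 - w) θ₀.2.2).card : ℝ) * D +
    ((idxIoc z θ₀.2.2 (θ₀.2.2 + w)).card : ℝ) * D) < ε * n
  have g1 := mul_lt_mul_of_pos_right hwl hD
  have g2 := mul_lt_mul_of_pos_right hwr hD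
  have g3 : ε / (4 * D) * n * D = ε / 4 * n := by field_simp
  rw [g3] at g1 g2
  have g4 := mul_lt_mul_of_pos_left hABn hn'
  linarith

lemma abs_sum_mul_div_le {n : ℕ} (u v : Fin n → ℝ) :
    |(∑ j, u j * v j) / n| ≤ √((∑ j, u j ^ 2) / n) * √((∑ j, v j ^ 2) / n) := by
  rw [← Real.sqrt_mul (by positivity)]
  refine Real.abs_le_sqrt ?_
  rw [div_pow, div_mul_div_comm, ← sq]
  gcongr
  exact Finset.sum_mul_sq_le_sq_mul_sq _ _ _

lemma sum_abs_div_le {n : ℕ} (u : Fin n → ℝ) :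
    (∑ j, |u j|) / n ≤ √((∑ j, u j ^ 2) / n) := by
  rcases Nat.eq_zero_or_pos n with rfl | hn
  · simp
  have hn' : (n : ℝ) ≠ 0 := by positivity
  have := (le_abs_self _).trans (abs_sum_mul_div_le (fun j => |u j|) (fun _ => 1))
  simpa [hn'] using this

/-- The empirical laws of the centered residuals converge to the law of the errors. -/
theorem RegularData.momentConv {a b : ℝ} {f : ℝ → ℝ} {θ₀ : Param} {P : Measure Obs}
    (hP : Model a b f θ₀ P) {x : ℕ → Obs} (hx : RegularData a b θ₀ P x)
    {θ : ℕ → Param} (hθ : Tendsto θ atTop (𝓝 θ₀)) :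
    MomentConv (fun n => empMeasure (centeredResid (θ n) (fun j : Fin n => x j)))
      (P.map (resid θ₀)) := by
  have := hP.isProb
  have hm := measurable_resid θ₀
  have hprob : IsProbabilityMeasure (P.map (resid θ₀)) :=
    Measure.isProbabilityMeasure_map hm.aemeasurable
  set D : (n : ℕ) → Fin n → ℝ := fun n j => regFn (θ n) (x j).2 - regFn θ₀ (x j).2 with hD
  set e : (n : ℕ) → Fin n → ℝ := fun n j => resid θ₀ (x j) with he
  set m : ℕ → ℝ := fun n => (∑ j : Fin n, resid (θ n) (x j)) / n with hmdef
  -- The centered residual is the true error minus `u`, so all moment limits reduce to `u` being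
  -- small in mean square.
  set u : (n : ℕ) → Fin n → ℝ := fun n j => D n j + m n with hu
  have hc : ∀ n, ∀ j : Fin n, centeredResid (θ n) (fun j : Fin n => x j) j = e n j - u n j := by
    intro n j
    simp only [centeredResid, hu, hD, he, hmdef]
    rw [resid_eq_sub_excess θ₀ (θ n) (x j)]
    ring
  have hDlim := hx.tendsto_mean_sq_excess hP hθ
  change Tendsto (fun n : ℕ => (∑ j, D n j ^ 2) / n) atTop (𝓝 0) at hDlim
  have hDsqrt : Tendsto (fun n : ℕ => √((∑ j, D n j ^ 2) / n)) atTop (𝓝 0) := by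
    have := (Real.continuous_sqrt.tendsto 0).comp hDlim
    rw [Real.sqrt_zero] at this
    exact this
  have hDmean : Tendsto (fun n : ℕ => (∑ j, D n j) / n) atTop (𝓝 0) := by
    refine squeeze_zero_norm (fun n => ?_) hDsqrt
    rw [Real.norm_eq_abs, abs_div, Nat.abs_cast]
    refine le_trans ?_ (sum_abs_div_le (D n))
    gcongr
    exact Finset.abs_sum_le_sum_abs _ _
  have hmlim : Tendsto m atTop (𝓝 0) := by
    have := hx.mean.sub hDmean
    rw [sub_zero] at this
    refine this.congr fun n => ?_
    rw [← sub_div, ← Finset.sum_sub_distrib]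
    simp only [hmdef, hD]
    congr 1
    exact Finset.sum_congr rfl fun j _ => (resid_eq_sub_excess θ₀ (θ n) (x j)).symm
  have hulim : Tendsto (fun n : ℕ => (∑ j, u n j ^ 2) / n) atTop (𝓝 0) := by
    have hlim : Tendsto (fun n : ℕ => 2 * ((∑ j, D n j ^ 2) / n) + 2 * m n ^ 2) atTop (𝓝 0) := by
      simpa using (hDlim.const_mul 2).add ((hmlim.pow 2).const_mul 2)
    refine squeeze_zero' (Eventually.of_forall fun n => by positivity) ?_ hlim
    filter_upwards [eventually_ge_atTop 1] with n hn
    have hn' : (0 : ℝ) < n := by exact_mod_cast hn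
    rw [div_le_iff₀ hn']
    calc ∑ j, u n j ^ 2 ≤ ∑ j, (2 * D n j ^ 2 + 2 * m n ^ 2) :=
          Finset.sum_le_sum fun j _ => by
            simp only [hu]; nlinarith [sq_nonneg (D n j - m n)]
      _ = _ := by
          rw [Finset.sum_add_distrib, ← Finset.mul_sum]
          simp only [Finset.sum_const, Finset.card_univ, Fintype.card_fin, nsmul_eq_mul]
          field_simp
  have husqrt : Tendsto (fun n : ℕ => √((∑ j, u n j ^ 2) / n)) atTop (𝓝 0) := by
    have := (Real.continuous_sqrt.tendsto 0).comp hulim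
    rw [Real.sqrt_zero] at this
    exact this
  have hmap : ∀ {φ : ℝ → ℝ}, Measurable φ →
      ∫ t, φ t ∂(P.map (resid θ₀)) = ∫ y, φ (resid θ₀ y) ∂P := fun hφ =>
    integral_map hm.aemeasurable hφ.aestronglyMeasurable
  have hL2 : MemLp id 2 (P.map (resid θ₀)) := by
    rw [memLp_map_measure_iff aestronglyMeasurable_id hm.aemeasurable]
    exact hP.memLp_two
  have hprobn : ∀ n, 1 ≤ n →
      IsProbabilityMeasure (empMeasure (centeredResid (θ n) (fun j : Fin n => x j))) :=
    fun n hn => isProbabilityMeasure_empMeasure hn _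
  refine ⟨hprobn, hprob, fun n hn => ?_, hL2, fun n hn => ?_, ?_, fun M => ?_, ?_⟩
  · refine (memLp_two_iff_integrable_sq aestronglyMeasurable_id).2 ?_
    exact integrable_empMeasure _ _
  · have hn' : (n : ℝ) ≠ 0 := by positivity
    rw [integral_empMeasure]
    simp only [centeredResid, Finset.sum_sub_distrib, Finset.sum_const, Finset.card_univ,
      Fintype.card_fin, nsmul_eq_mul]
    rw [mul_div_cancel₀ _ hn', sub_self, zero_div]
  · rw [hmap measurable_id']
    exact hP.eps_mean
  -- The shifted absolute moments are 1-Lipschitz in the shift, so the countably many rational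
  -- shifts suffice.
  · refine tendstoUniformlyOn_Icc_of_lipschitz ?_ ?_ (fun q => ?_) _ _
    · filter_upwards [eventually_ge_atTop 1] with n hn s t
      have := hprobn n hn
      exact abs_integral_abs_add_sub_le (integrable_empMeasure _ _) s t
    · exact abs_integral_abs_add_sub_le (hL2.integrable (by norm_num))
    · rw [hmap (φ := fun t => |(q : ℝ) + t|) (by fun_prop)]
      have h1 := hx.abs_shift q
      have h2 : Tendsto (fun n : ℕ => (∑ j : Fin n, |(q : ℝ) + (e n j - u n j)|) / n -
          (∑ j : Fin n, |(q : ℝ) + e n j|) / n) atTop (𝓝 0) := by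
        refine squeeze_zero_norm (fun n => ?_) husqrt
        rw [Real.norm_eq_abs, ← sub_div, ← Finset.sum_sub_distrib, abs_div, Nat.abs_cast]
        refine le_trans ?_ (sum_abs_div_le (u n))
        gcongr
        refine (Finset.abs_sum_le_sum_abs _ _).trans (Finset.sum_le_sum fun j _ => ?_)
        have := abs_abs_sub_abs_le_abs_sub ((q : ℝ) + (e n j - u n j)) ((q : ℝ) + e n j)
        rwa [show (q : ℝ) + (e n j - u n j) - (q + e n j) = -u n j by ring, abs_neg] at this
      have h3 := h2.add h1
      rw [zero_add] at h3
      refine h3.congr fun n => ?_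
      rw [integral_empMeasure]
      simp only [hc]
      ring
  · rw [hmap (φ := fun t => t ^ 2) (by fun_prop)]
    have h1 := hx.sq
    -- Cauchy–Schwarz: the errors have bounded mean square and that of `u` vanishes.
    have h2 : Tendsto (fun n : ℕ => (∑ j, e n j * u n j) / n) atTop (𝓝 0) := by
      refine squeeze_zero_norm (fun n => abs_sum_mul_div_le (e n) (u n)) ?_
      have := ((Real.continuous_sqrt.tendsto _).comp h1).mul husqrt
      rw [mul_zero] at this
      exact this
    have h3 := (h1.sub (h2.const_mul 2)).add hulim
    simp only [mul_zero, sub_zero, add_zero] at h3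
    refine h3.congr fun n => ?_
    rw [integral_empMeasure]
    simp only [hc]
    rw [← mul_div_assoc, ← sub_div, ← add_div, Finset.mul_sum, ← Finset.sum_sub_distrib,
      ← Finset.sum_add_distrib]
    congr 1
    refine Finset.sum_congr rfl fun j _ => ?_
    ring

/-! ### Conditional distributions and tightness -/

/-- The conditional distribution of a function of `(X, Y)` given `X` is the image of the conditional
distribution of `Y` given `X`. -/
lemma condDistrib_comp_pair_ae_eq {Ω β E F : Type*} [MeasurableSpace Ω] [MeasurableSpace β]
    [MeasurableSpace E] [StandardBorelSpace E] [Nonempty E] [MeasurableSpace F]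
    [StandardBorelSpace F] [Nonempty F] (μ : Measure Ω) [IsFiniteMeasure μ] {X : Ω → β} {Y : Ω → E}
    (hX : Measurable X) (hY : Measurable Y) {G : β × E → F} (hG : Measurable G) :
    ∀ᵐ ω ∂μ, condDistrib (fun ω => G (X ω, Y ω)) X μ (X ω) =
      (condDistrib Y X μ (X ω)).map (fun y => G (X ω, y)) := by
  -- The candidate kernel keeps `b` and pushes the conditional law of `Y` through `G (b, ·)`; it is
  -- identified by comparing joint laws.
  set κ : Kernel β F := (Kernel.id ×ₖ condDistrib Y X μ).map G with hκ
  have hκa : ∀ b, κ b = (condDistrib Y X μ b).map (fun y => G (b, y)) := by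
    intro b
    rw [hκ, Kernel.map_apply _ hG, Kernel.prod_apply, Kernel.id_apply, Measure.dirac_prod,
      Measure.map_map hG measurable_prodMk_left]
    rfl
  have : IsFiniteKernel κ := by rw [hκ]; infer_instance
  have h : condDistrib (fun ω => G (X ω, Y ω)) X μ =ᵐ[μ.map X] κ := by
    refine condDistrib_ae_eq_of_measure_eq_compProd X
      (show AEMeasurable (fun ω => G (X ω, Y ω)) μ from
        (hG.comp (hX.prodMk hY)).aemeasurable) ?_
    have hGm : Measurable fun p : β × E => (p.1, G p) := measurable_fst.prodMk hG
    have h1 : μ.map (fun ω => (X ω, G (X ω, Y ω))) =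
        (μ.map (fun ω => (X ω, Y ω))).map (fun p => (p.1, G p)) := by
      rw [Measure.map_map hGm (hX.prodMk hY)]
      rfl
    rw [h1, ← compProd_map_condDistrib hY.aemeasurable]
    ext s hs
    rw [Measure.map_apply hGm hs, Measure.compProd_apply (hGm hs), Measure.compProd_apply hs]
    refine lintegral_congr fun b => ?_
    have hGb : Measurable fun y => G (b, y) := hG.comp measurable_prodMk_left
    rw [hκa, Measure.map_apply hGb (measurable_prodMk_left hs)]
    rfl
  filter_upwards [ae_of_ae_map hX.aemeasurable h] with ω hω
  rw [hω, hκa]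

/-- A sequence of finite measures with eventually small tails is tight. -/
lemma isTightMeasureSet_range_of_eventually_le {μ : ℕ → Measure Param}
    [∀ n, IsFiniteMeasure (μ n)]
    (h : ∀ ε : ℝ, 0 < ε → ∃ R : ℝ, ∀ᶠ n in atTop, μ n {x | R < ‖x‖} ≤ ENNReal.ofReal ε) :
    IsTightMeasureSet (range μ) := by
  refine isTightMeasureSet_range_of_tendsto_limsup_measure_norm_gt ?_
  refine ENNReal.tendsto_nhds_zero.2 fun ε hε => ?_
  obtain ⟨δ, hδ, hδε⟩ : ∃ δ : ℝ, 0 < δ ∧ ENNReal.ofReal δ ≤ ε := by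
    rcases eq_or_ne ε ⊤ with rfl | hne
    · exact ⟨1, one_pos, le_top⟩
    · exact ⟨ε.toReal, ENNReal.toReal_pos hε.ne' hne, ENNReal.ofReal_toReal_le⟩
  obtain ⟨R, hR⟩ := h δ hδ
  filter_upwards [eventually_ge_atTop R] with r hr
  refine limsup_le_of_le (by isBoundedDefault) ?_
  filter_upwards [hR] with n hn
  refine le_trans (measure_mono fun x (hx : r < ‖x‖) => ?_) (hn.trans hδε)
  exact lt_of_le_of_lt hr hx

lemma IsDensity.measureReal_Ioi {g : ℝ → ℝ} (hg : IsDensity g) (t : ℝ) :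
    (densMeasure g).real (Ioi t) = 1 - distFn g t := by
  have := hg.isProbabilityMeasure
  rw [← compl_Iic, probReal_compl_eq_one_sub measurableSet_Iic, distFn]

lemma Model.measureReal_eq {a b : ℝ} {f : ℝ → ℝ} {θ₀ : Param} {P : Measure Obs}
    (hP : Model a b f θ₀ P) {S : Set ℝ} (hS : MeasurableSet S) :
    P.real {y | y.2 ∈ S} = (densMeasure f).real S := by
  rw [densMeasure, ← hP.law_Z, measureReal_def, measureReal_def,
    Measure.map_apply measurable_snd hS]
  rfl

end ChangePoint

end

/-! ### The main theorem -/

open ChangePoint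
theorem proposition6
    {Ω : Type*} [MeasurableSpace Ω] (Pr : Measure Ω) [IsProbabilityMeasure Pr]
    -- the model
    (a b : ℝ) (f : ℝ → ℝ) (θ₀ : Param) (P : Measure Obs) (hP : Model a b f θ₀ P)
    -- the i.i.d. data
    (X : ℕ → Ω → Obs) (hX : ∀ i, Measurable (X i)) (hXlaw : ∀ i, Pr.map (X i) = P)
    (hXindep : iIndepFun X Pr)
    -- the least squares estimator
    (T : (n : ℕ) → (Fin n → Obs) → Param) (hT : IsLSE a b T)
    -- the density estimators
    (fhat : ℕ → Ω → ℝ → ℝ) (hfhat : ∀ n, 1 ≤ n → ∀ᵐ ω ∂Pr, IsDensity (fhat n ω))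
    (hF : ∀ᵐ ω ∂Pr, TendstoUniformly (fun n => distFn (fhat n ω)) (distFn f) atTop)
    (c d : ℝ) (hcd : θ₀.2.2 ∈ Ioo c d)
    (hf : ∀ᵐ ω ∂Pr, TendstoUniformlyOn (fun n => fhat n ω) f atTop (Icc c d))
    -- the bootstrap samples: given the data, i.i.d. from the smoothed bootstrap law
    (Xs : (n : ℕ) → Ω → (Fin n → Obs)) (hXs : ∀ n, Measurable (Xs n))
    (hboot : ∀ n, 1 ≤ n → ∀ᵐ ω ∂Pr,
      condDistrib (Xs n) (fun ω i => X i ω) Pr (fun i => X i ω) =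
        Measure.pi (fun _ : Fin n =>
          bootLaw (T n (sample X n ω)) (sample X n ω) (fhat n ω))) :
    ∀ᵐ ω ∂Pr,
      CondsIToV (fun n => bootLaw (T n (sample X n ω)) (sample X n ω) (fhat n ω))
        (fun n => n) (fun n => T n (sample X n ω)) P θ₀ ∧
      IsTightMeasureSet {ν : Measure Param | ∃ n, 1 ≤ n ∧
        ν = condDistrib (fun ω => root n (T n (Xs n ω)) (T n (sample X n ω)))
          (fun ω i => X i ω) Pr (fun i => X i ω)} := by
  have := hP.isProb
  have hfden := hP.isDensity
  have := hfden.isProbabilityMeasure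
  obtain ⟨η, hη, κ, hκ, hflow⟩ := hP.f_lower
  obtain ⟨r, hr, hrη, hrc, hrd⟩ : ∃ r > 0, r ≤ η ∧ c ≤ θ₀.2.2 - r ∧ θ₀.2.2 + r ≤ d := by
    refine ⟨min η (min (θ₀.2.2 - c) (d - θ₀.2.2)), lt_min hη (lt_min (by linarith [hcd.1])
      (by linarith [hcd.2])), min_le_left _ _, ?_, ?_⟩
    · linarith [(min_le_right η _).trans (min_le_left (θ₀.2.2 - c) (d - θ₀.2.2))]
    · linarith [(min_le_right η _).trans (min_le_right (θ₀.2.2 - c) (d - θ₀.2.2))]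
  have hXm : Measurable fun ω i => X i ω := measurable_pi_lambda _ hX
  have hden : ∀ᵐ ω ∂Pr, ∀ n, 1 ≤ n → IsDensity (fhat n ω) :=
    ae_all_iff.2 fun n => eventually_imp_distrib_left.2 (hfhat n)
  -- The rescaled error is a measurable function of the data sequence and the bootstrap sample, so
  -- its conditional law is the image of the product of bootstrap laws with the data frozen.
  have hcond : ∀ᵐ ω ∂Pr, ∀ n, 1 ≤ n →
      condDistrib (fun ω => root n (T n (Xs n ω)) (T n (sample X n ω)))
        (fun ω i => X i ω) Pr (fun i => X i ω) =
      (Measure.pi fun _ : Fin n =>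
        bootLaw (T n (sample X n ω)) (sample X n ω) (fhat n ω)).map
          (fun y => root n (T n y) (T n (sample X n ω))) := by
    refine ae_all_iff.2 fun n => eventually_imp_distrib_left.2 fun hn => ?_
    have hTm := hT.measurable n hn
    have hGm : Measurable fun p : (ℕ → Obs) × (Fin n → Obs) =>
        root n (T n p.2) (T n fun j => p.1 j) := by
      have h1 : Measurable fun p : (ℕ → Obs) × (Fin n → Obs) => fun j : Fin n => p.1 j :=
        measurable_pi_lambda _ fun j => (measurable_pi_apply (j : ℕ)).comp measurable_fst
      exact (measurable_root n).comp ((hTm.comp measurable_snd).prodMk (hTm.comp h1))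
    filter_upwards [condDistrib_comp_pair_ae_eq Pr hXm (hXs n) hGm, hboot n hn] with ω h1 h2
    rw [← h2]
    exact h1
  obtain ⟨p, hp, hpl, hpr⟩ : ∃ p > 0, p < distFn f a ∧ p < 1 - distFn f b := by
    have h1 : 0 < distFn f a := by
      have := hP.left_pos
      rwa [show {y : Obs | y.2 ≤ a} = {y | y.2 ∈ Iic a} from rfl,
        hP.measureReal_eq measurableSet_Iic] at this
    have h2 : 0 < 1 - distFn f b := by
      have := hP.right_pos
      rwa [show {y : Obs | b < y.2} = {y | y.2 ∈ Ioi b} from rfl,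
        hP.measureReal_eq measurableSet_Ioi, hfden.measureReal_Ioi] at this
    refine ⟨min (distFn f a) (1 - distFn f b) / 2, half_pos (lt_min h1 h2), ?_, ?_⟩
    · linarith [min_le_left (distFn f a) (1 - distFn f b)]
    · linarith [min_le_right (distFn f a) (1 - distFn f b)]
  filter_upwards [hP.ae_regularData hX hXlaw hXindep, hden, hF, hf, hcond]
    with ω hreg hdenω hFω hfω hcondω
  have hθ : Tendsto (fun n => T n (sample X n ω)) atTop (𝓝 θ₀) := hreg.tendsto_lse hP hT
  have hθmem : ∀ n, 1 ≤ n → T n (sample X n ω) ∈ Theta a b := fun n hn =>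
    (hT.sargmax n hn _).1.1
  have hμ : MomentConv
      (fun n => empMeasure (centeredResid (T n (sample X n ω)) (sample X n ω)))
      (P.map (resid θ₀)) := hreg.momentConv hP hθ
  have hν : ∀ n, 1 ≤ n → IsProbabilityMeasure (densMeasure (fhat n ω)) := fun n hn =>
    (hdenω n hn).isProbabilityMeasure
  have hlow := eventually_linear_lower_bound hdenω hκ hflow hrη hrc hrd hfω
  -- `bootLaw` is by definition a `modelLaw` with the empirical law of the centered residuals as
  -- error law.
  have hconds := condsIToIII_modelLaw (ν₀ := densMeasure f) hν (fun n => inferInstance) hFω hθ hμ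
  rw [← hP.eq_modelLaw] at hconds
  refine ⟨⟨hconds.1, hconds.2.1, hconds.2.2, hθ,
    condV_modelLaw hdenω hθ hμ (half_pos hκ) hr hlow⟩, ?_⟩
  -- Reindexing by `n = k + 1` turns the family into the range of a sequence, so that eventual tail
  -- bounds suffice.
  have hset : {ν : Measure Param | ∃ n, 1 ≤ n ∧
      ν = condDistrib (fun ω => root n (T n (Xs n ω)) (T n (sample X n ω)))
        (fun ω i => X i ω) Pr (fun i => X i ω)} =
      range fun k : ℕ => condDistrib
        (fun ω => root (k + 1) (T (k + 1) (Xs (k + 1) ω)) (T (k + 1) (sample X (k + 1) ω)))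
        (fun ω i => X i ω) Pr (fun i => X i ω) := by
    ext ν
    constructor
    · rintro ⟨n, hn, rfl⟩
      obtain ⟨k, rfl⟩ := Nat.exists_eq_add_of_le' hn
      exact ⟨k, rfl⟩
    · rintro ⟨k, rfl⟩
      exact ⟨k + 1, by omega, rfl⟩
  rw [hset]
  refine isTightMeasureSet_range_of_eventually_le fun ε hε => ?_
  have hpa : ∀ᶠ n in atTop, p ≤ (densMeasure (fhat n ω)).real (Iic a) :=
    ((hFω.tendsto_at a).eventually (lt_mem_nhds hpl)).mono fun n hn => hn.le
  have hpb : ∀ᶠ n in atTop, p ≤ (densMeasure (fhat n ω)).real (Ioi b) := by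
    filter_upwards [(hFω.tendsto_at b).eventually
      (gt_mem_nhds (show distFn f b < 1 - p by linarith)), eventually_ge_atTop 1] with n h1 h2
    rw [(hdenω n h2).measureReal_Ioi]
    linarith
  obtain ⟨R, hR⟩ := eventually_measure_norm_root_gt_le hT hP.alpha_ne_beta hθmem hθ hν hμ hp hpa
    hpb (half_pos hκ) hr hlow hε
  refine ⟨R, ?_⟩
  filter_upwards [(tendsto_add_atTop_nat 1).eventually hR] with k hk
  have hroot : Measurable fun y =>
      root (k + 1) (T (k + 1) y) (T (k + 1) (sample X (k + 1) ω)) :=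
    (measurable_root (k + 1)).comp ((hT.measurable (k + 1) (by omega)).prodMk measurable_const)
  rw [hcondω (k + 1) (by omega), Measure.map_apply hroot
    (measurableSet_lt measurable_const measurable_norm)]
  exact hk
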